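/- Let $D$ be a compact smooth manifold (possibly with boundary), let $M$ and $M'$ be finite-dimensional smooth manifolds (without boundary, Hausdorff, second countable), and let $k\ge 2$ be an integer. A connection on a (Banach) manifold $X$ is a smooth map $P\colon T(TX)\to TX$ which maps each $T_e(TX)$, $e\in T_xX$, linearly into $T_xX$, and which in every chart has the form $P(\eta)=\omega+\Gamma_z(u,v)$ for $\eta=((z,v),(u,\omega))$, with $z\mapsto\Gamma_z$ a smooth map into the bounded bilinear maps. A smooth map $f\colon X\to X'$ between manifolds with connections $P$, $P'$ is affine if $P'\circ \mathrm d(\mathrm df)=\mathrm df\circ P$. The charts $y\mapsto \big(p\mapsto(\pi,\alpha)^{-1}(x(p),y(p))\big)$, where $x\in\mathcal C^k(D,M)$ and $\alpha$ is a local addition on $M$ defined around $x(D)$ (that is, $\alpha$ is a smooth map to $M$ from an open subset of $TM$ containing the zero vectors over $x(D)$ and, with any vector of $T_yM$, also $0_y$; $\alpha(0_y)=y$; and, with $\pi\colon TM\to M$ the projection, $(\pi,\alpha)$ is a diffeomorphism onto an open subset of $M\times M$), with values in the Banach spaces of $\mathcal C^k$ vector fields along $x$, make $\mathcal C^k(D,M)$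 a smooth Banach manifold; the same holds for $M'$. For every connection $P$ on $M$ there is exactly one connection $Q$ on $\mathcal C^k(D,M)$, called the natural connection induced by $P$, such that $\mathrm d(\mathrm{ev}_p)\circ Q=P\circ \mathrm d(\mathrm d(\mathrm{ev}_p))$ for all $p\in D$, where $\mathrm{ev}_p(x)=x(p)$ (so that $Q$ is the left-composition with $P$, under the identifications $T\mathcal C^k(D,M)\cong\mathcal C^k(D,TM)$ and $T(T\mathcal C^k(D,M))\cong\mathcal C^k(D,T(TM))$); the same holds for $M'$. If $M$ and $M'$ are endowed with connections, and $\mathcal C^k(D,M)$ and $\mathcal C^k(D,M')$ with the natural connections that these induce, and if $f\colon M\to M'$ is affine, then the left-composition map $$f_*\colon\mathcal C^k(D,M)\to\mathcal C^k(D,M'),\qquad f_*(x)=f\circ x,$$ is affine. In particular, if $M$ and $M'$ carry semi-Riemannian metrics and $f\colon M\to M'$ is an isometry (a smooth diffeomorphism preserving the metrics), then $f_*$ is affine for the natural connections induced by the Levi-Civita connections. -/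

import Mathlib

open scoped Manifold ContDiff Topology

universe u v w u' v' w'

set_option linter.checkUnivs false
set_option linter.unusedSectionVars false

namespace BanachGeometry

noncomputable section

/-- A family of charts on a set `X`, with values in (possibly different) normed spaces. -/
structure BanachAtlas (X : Type u) where
  /-- the index set of the atlas -/
  ι : Type v
  /-- the model space of each chart -/
  model : ι → Type w
  [normedAddCommGroup : ∀ i, NormedAddCommGroup (model i)]
  [normedSpace : ∀ i, NormedSpace ℝ (model i)]
  /-- the charts -/
  chart : ∀ i, PartialEquiv X (model i)

attribute [instance] BanachAtlas.normedAddCommGroup BanachAtlas.normedSpace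

namespace BanachAtlas

variable {X : Type u} (A : BanachAtlas.{u, v, w} X)

/-- The domain, in the `i`-th model space, of the transition map from chart `i` to chart `j`. -/
def overlap (i j : A.ι) : Set (A.model i) :=
  (A.chart i).target ∩ (A.chart i).symm ⁻¹' (A.chart j).source

/-- The transition map from chart `i` to chart `j`. -/
def trans (i j : A.ι) : A.model i → A.model j := A.chart j ∘ (A.chart i).symm

/-- The charts form a smooth atlas of a Banach manifold: the model spaces are complete, the chart
domains cover `X`, overlaps are open in the model spaces (for `i = j` this says that the image of
each chart is open), and the transition maps are smooth. -/
structure IsSmoothAtlas : Prop where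
  complete : ∀ i, CompleteSpace (A.model i)
  cover : ∀ x : X, ∃ i, x ∈ (A.chart i).source
  isOpen_overlap : ∀ i j, IsOpen (A.overlap i j)
  contDiffOn_trans : ∀ i j, ContDiffOn ℝ ∞ (A.trans i j) (A.overlap i j)

end BanachAtlas

/-- A smooth Banach manifold structure on a set `X`, given by an atlas (the topology is the one
induced by the charts). -/
structure BanachManifold (X : Type u) extends BanachAtlas.{u, v, w} X where
  isSmoothAtlas : toBanachAtlas.IsSmoothAtlas

namespace BanachManifold

variable {X : Type u} (A : BanachManifold.{u, v, w} X)

theorem mem_overlap {x : X} {i j : A.ι} (hi : x ∈ (A.chart i).source)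
    (hj : x ∈ (A.chart j).source) : A.chart i x ∈ A.overlap i j :=
  ⟨(A.chart i).map_source hi, by simpa [(A.chart i).left_inv hi] using hj⟩

theorem differentiableAt_trans {i j : A.ι} {z : A.model i} (hz : z ∈ A.overlap i j) :
    DifferentiableAt ℝ (A.trans i j) z :=
  ((A.isSmoothAtlas.contDiffOn_trans i j).contDiffAt
    ((A.isSmoothAtlas.isOpen_overlap i j).mem_nhds hz)).differentiableAt (by simp)

theorem trans_apply {x : X} {i j : A.ι} (hi : x ∈ (A.chart i).source) :
    A.trans i j (A.chart i x) = A.chart j x := by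
  simp [BanachAtlas.trans, (A.chart i).left_inv hi]

/-- The chain rule for transition maps. -/
theorem fderiv_trans_comp {x : X} {i j k : A.ι} (hi : x ∈ (A.chart i).source)
    (hj : x ∈ (A.chart j).source) (hk : x ∈ (A.chart k).source) :
    fderiv ℝ (A.trans i k) (A.chart i x) =
      (fderiv ℝ (A.trans j k) (A.chart j x)).comp (fderiv ℝ (A.trans i j) (A.chart i x)) := by
  have h1 := A.differentiableAt_trans (A.mem_overlap hi hj)
  have h2 := A.differentiableAt_trans (A.mem_overlap hj hk)
  rw [← A.trans_apply (j := j) hi] at h2 ⊢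
  rw [← fderiv_comp _ h2 h1]
  refine Filter.EventuallyEq.fderiv_eq ?_
  filter_upwards [(A.isSmoothAtlas.isOpen_overlap i j).mem_nhds (A.mem_overlap hi hj)] with z hz
  simp only [BanachAtlas.trans, Function.comp_apply]
  rw [(A.chart j).left_inv hz.2]

/-- The tangent space at `x`: a tangent vector is given by its coordinate representation in every
chart around `x`, representations in different charts being related by the derivative of the
transition map. -/
def Tangent (x : X) : Submodule ℝ (∀ i : {i : A.ι // x ∈ (A.chart i).source}, A.model i.1) where
  carrier := {v | ∀ i j, fderiv ℝ (A.trans i.1 j.1) (A.chart i.1 x) (v i) = v j}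
  add_mem' := by
    intro v w hv hw i j
    simp [hv i j, hw i j]
  zero_mem' := by
    intro i j
    simp
  smul_mem' := by
    intro c v hv i j
    simp [hv i j]

/-- The total space of the tangent bundle. -/
def TBundle : Type _ := Σ x : X, A.Tangent x

variable {A} in
/-- The representation of a tangent vector in the chart `i` (zero outside of the chart domain). -/
def coord (i : A.ι) {x : X} (v : A.Tangent x) : A.model i := by
  classical exact if h : x ∈ (A.chart i).source then v.1 ⟨i, h⟩ else 0

/-- The tangent vector at `x` whose representation in the chart `i` is `w` (zero outside of the
chart domain). -/
def ofCoord (i : A.ι) (x : X) (w : A.model i) : A.Tangent x := by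
  classical exact
    if h : x ∈ (A.chart i).source then
      ⟨fun j => fderiv ℝ (A.trans i j.1) (A.chart i x) w, fun j k => by
        exact (congrArg (fun L => L w) (A.fderiv_trans_comp h j.2 k.2)).symm⟩
    else 0

theorem coord_ofCoord {i j : A.ι} {x : X} (hi : x ∈ (A.chart i).source)
    (hj : x ∈ (A.chart j).source) (w : A.model i) :
    coord j (A.ofCoord i x w) = fderiv ℝ (A.trans i j) (A.chart i x) w := by
  simp [coord, ofCoord, hi, hj]

theorem fderiv_trans_self {i : A.ι} {x : X} (hi : x ∈ (A.chart i).source) :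
    fderiv ℝ (A.trans i i) (A.chart i x) = ContinuousLinearMap.id ℝ _ := by
  rw [← fderiv_id (x := A.chart i x)]
  refine Filter.EventuallyEq.fderiv_eq ?_
  filter_upwards [(A.isSmoothAtlas.isOpen_overlap i i).mem_nhds (A.mem_overlap hi hi)] with z hz
  simp [BanachAtlas.trans, (A.chart i).right_inv hz.1]

theorem coord_ofCoord_self {i : A.ι} {x : X} (hi : x ∈ (A.chart i).source) (w : A.model i) :
    coord i (A.ofCoord i x w) = w := by
  rw [A.coord_ofCoord hi hi, A.fderiv_trans_self hi]; rfl

theorem ofCoord_coord {i : A.ι} {x : X} (hi : x ∈ (A.chart i).source) (v : A.Tangent x) :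
    A.ofCoord i x (coord i v) = v := by
  ext j
  simpa [coord, ofCoord, hi] using v.2 ⟨i, hi⟩ j

/-- The charts of the tangent bundle: `(x, v)` is sent to the coordinates of `x` and of `v`. -/
def tangentAtlas : BanachAtlas A.TBundle where
  ι := A.ι
  model i := A.model i × A.model i
  chart i :=
    { toFun := fun e => (A.chart i e.1, coord i e.2)
      invFun := fun z => ⟨(A.chart i).symm z.1, A.ofCoord i _ z.2⟩
      source := {e | e.1 ∈ (A.chart i).source}
      target := (A.chart i).target ×ˢ Set.univ
      map_source' := fun e he => ⟨(A.chart i).map_source he, trivial⟩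
      map_target' := fun z hz => (A.chart i).map_target hz.1
      left_inv' := by
        rintro ⟨x, v⟩ (hx : x ∈ (A.chart i).source)
        have key : ∀ y, y = x → (⟨y, A.ofCoord i y (coord i v)⟩ : A.TBundle) = ⟨x, v⟩ := by
          rintro y rfl
          rw [A.ofCoord_coord hx]
        exact key _ ((A.chart i).left_inv hx)
      right_inv' := by
        rintro ⟨z, w⟩ ⟨hz, -⟩
        exact Prod.ext ((A.chart i).right_inv hz)
          (A.coord_ofCoord_self ((A.chart i).map_target hz) w) }

theorem tangentAtlas_overlap (i j : A.ι) :
    A.tangentAtlas.overlap i j = A.overlap i j ×ˢ (Set.univ : Set (A.model i)) := by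
  ext ⟨z, w⟩
  change ((z ∈ (A.chart i).target ∧ w ∈ Set.univ) ∧ _) ↔ (_ ∧ _) ∧ _
  exact ⟨fun h => ⟨⟨h.1.1, h.2⟩, h.1.2⟩, fun h => ⟨⟨h.1.1, h.2⟩, h.1.2⟩⟩

theorem isSmoothAtlas_tangentAtlas : A.tangentAtlas.IsSmoothAtlas where
  complete := fun i : A.ι => by
    have : CompleteSpace (A.model i) := A.isSmoothAtlas.complete i
    exact inferInstanceAs (CompleteSpace (A.model i × A.model i))
  cover e := A.isSmoothAtlas.cover e.1
  isOpen_overlap := fun i j : A.ι => by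
    rw [A.tangentAtlas_overlap i j]
    exact (A.isSmoothAtlas.isOpen_overlap i j).prod isOpen_univ
  contDiffOn_trans := fun i j : A.ι => by
    rw [A.tangentAtlas_overlap i j]
    have ho := A.isSmoothAtlas.isOpen_overlap i j
    have hs := A.isSmoothAtlas.contDiffOn_trans i j
    have h : ContDiffOn ℝ ∞ (fun z : A.model i × A.model i =>
        (A.trans i j z.1, fderiv ℝ (A.trans i j) z.1 z.2)) (A.overlap i j ×ˢ Set.univ) := by
      refine ContDiffOn.prodMk (hs.comp contDiffOn_fst fun z hz => hz.1) ?_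
      refine ContDiffOn.clm_apply ?_ contDiffOn_snd
      exact (hs.fderiv_of_isOpen ho (by simp)).comp contDiffOn_fst fun z hz => hz.1
    refine h.congr ?_
    rintro ⟨z, w⟩ ⟨hz, -⟩
    refine Prod.ext rfl ?_
    have h1 := A.coord_ofCoord ((A.chart i).map_target hz.1) hz.2 w
    rw [(A.chart i).right_inv hz.1] at h1
    exact h1

/-- The tangent bundle of a Banach manifold, as a Banach manifold. -/
def tangent : BanachManifold A.TBundle := ⟨A.tangentAtlas, A.isSmoothAtlas_tangentAtlas⟩

/-- A chosen chart around a given point. -/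
def chartIdx (x : X) : A.ι := (A.isSmoothAtlas.cover x).choose

section Maps

variable {X : Type u} {Y : Type u'} (A : BanachManifold.{u, v, w} X)
  (B : BanachManifold.{u', v', w'} Y)

/-- Smooth maps between Banach manifolds: in all charts, the local representative has open domain
and is smooth. -/
def IsSmooth (f : X → Y) : Prop :=
  ∀ (i : A.ι) (j : B.ι),
    IsOpen ((A.chart i).target ∩ (A.chart i).symm ⁻¹' (f ⁻¹' (B.chart j).source)) ∧
    ContDiffOn ℝ ∞ (B.chart j ∘ f ∘ (A.chart i).symm)
      ((A.chart i).target ∩ (A.chart i).symm ⁻¹' (f ⁻¹' (B.chart j).source))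

/-- The differential at `x` of a smooth map `f`: the derivative of the local representative of `f`,
read in charts around `x` and around `f x`. -/
def dmap (f : X → Y) (x : X) (v : A.Tangent x) : B.Tangent (f x) :=
  B.ofCoord (B.chartIdx (f x)) (f x)
    (fderiv ℝ (B.chart (B.chartIdx (f x)) ∘ f ∘ (A.chart (A.chartIdx x)).symm)
      (A.chart (A.chartIdx x) x) (coord (A.chartIdx x) v))

/-- The tangent map `df : TX → TY`. -/
def tmap (f : X → Y) : A.TBundle → B.TBundle := fun e => ⟨f e.1, dmap A B f e.1 e.2⟩

end Maps

/-- `Γ` represents the map `P : T(TX) → TX` in the chart `i`: if `η ∈ T(TX)` has coordinates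
`((z, v), (u, ω))` in the induced chart, then `P η` is the vector with coordinates
`ω + Γ z (u, v)`; moreover `Γ` is a smooth map into the space of bounded bilinear maps. -/
structure IsChristoffel (P : A.tangent.TBundle → A.TBundle) (i : A.ι)
    (Γ : A.model i → A.model i →L[ℝ] A.model i →L[ℝ] A.model i) : Prop where
  smooth : ContDiffOn ℝ ∞ Γ (A.chart i).target
  eq : ∀ (e : A.TBundle) (η : A.tangent.Tangent e), e.1 ∈ (A.chart i).source →
    coord i (P ⟨e, η⟩).2 =
      (coord (A := A.tangent) i η).2 +
        Γ (A.chart i e.1) (coord (A := A.tangent) i η).1 (coord i e.2)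

/-- A connection on (the tangent bundle of) the Banach manifold `X`: a smooth map
`P : T(TX) → TX` whose restriction to each `T_e(TX)`, `e ∈ T_x X`, is a linear map into `T_x X`,
and which is given by smooth Christoffel symbols in the trivializations of `TX` induced by the
charts. -/
structure IsConnection (P : A.tangent.TBundle → A.TBundle) : Prop where
  smooth : IsSmooth A.tangent.tangent A.tangent P
  linear : ∀ e : A.TBundle, ∃ L : A.tangent.Tangent e →ₗ[ℝ] A.Tangent e.1,
    ∀ η, P ⟨e, η⟩ = ⟨e.1, L η⟩
  christoffel : ∀ i, ∃ Γ, A.IsChristoffel P i Γ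

section Affine

variable {X : Type u} {Y : Type u'} (A : BanachManifold.{u, v, w} X)
  (B : BanachManifold.{u', v', w'} Y)

/-- A map `f : X → Y` between manifolds with connections `P`, `P'` is affine if it is smooth and
`P' ∘ d(df) = df ∘ P`. -/
def IsAffine (P : A.tangent.TBundle → A.TBundle) (P' : B.tangent.TBundle → B.TBundle)
    (f : X → Y) : Prop :=
  IsSmooth A B f ∧
    ∀ η : A.tangent.TBundle, P' (tmap A.tangent B.tangent (tmap A B f) η) = tmap A B f (P η)

end Affine

/-- A smooth semi-Riemannian metric on a manifold with finite-dimensional model spaces (smoothness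
is required for each coefficient of the metric in each chart). -/
structure SemiRiemannianMetric where
  /-- the scalar product on each tangent space -/
  inner : ∀ x, A.Tangent x →ₗ[ℝ] A.Tangent x →ₗ[ℝ] ℝ
  symm : ∀ x v w, inner x v w = inner x w v
  nondegenerate : ∀ x v, (∀ w, inner x v w = 0) → v = 0
  smooth : ∀ (i : A.ι) (v w : A.model i), ContDiffOn ℝ ∞
    (fun z => inner ((A.chart i).symm z) (A.ofCoord i _ v) (A.ofCoord i _ w)) (A.chart i).target

/-- `P` is the Levi-Civita connection of the semi-Riemannian metric `g`: it is a connection which,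
in every chart, is torsion-free (its Christoffel symbols are symmetric) and for which `g` is
parallel. -/
def IsLeviCivita (g : A.SemiRiemannianMetric) (P : A.tangent.TBundle → A.TBundle) : Prop :=
  A.IsConnection P ∧ ∀ i Γ, A.IsChristoffel P i Γ → ∀ z ∈ (A.chart i).target,
    (∀ u v, Γ z u v = Γ z v u) ∧
    ∀ u v w, fderiv ℝ (fun y =>
        g.inner ((A.chart i).symm y) (A.ofCoord i _ v) (A.ofCoord i _ w)) z u =
      g.inner ((A.chart i).symm z) (A.ofCoord i _ (Γ z u v)) (A.ofCoord i _ w) +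
        g.inner ((A.chart i).symm z) (A.ofCoord i _ v) (A.ofCoord i _ (Γ z u w))

section Isometry

variable {X : Type u} {Y : Type u'} {A : BanachManifold.{u, v, w} X}
  {B : BanachManifold.{u', v', w'} Y}

/-- The differential of `f` preserves the scalar products. -/
def PreservesMetric (g : A.SemiRiemannianMetric) (g' : B.SemiRiemannianMetric) (f : X → Y) : Prop :=
  ∀ x v w, g'.inner (f x) (dmap A B f x v) (dmap A B f x w) = g.inner x v w

end Isometry

section FiniteDimensional

variable (E : Type v) [NormedAddCommGroup E] [NormedSpace ℝ E] [FiniteDimensional ℝ E]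
  (M : Type u) [TopologicalSpace M] [ChartedSpace E M] [IsManifold 𝓘(ℝ, E) ∞ M]

/-- A finite-dimensional smooth manifold, seen as a Banach manifold with the same atlas. -/
def ofManifold : BanachManifold.{u, max u v, v} M where
  ι := atlas E M
  model _ := E
  chart e := e.1.toPartialEquiv
  isSmoothAtlas :=
    { complete := fun _ => FiniteDimensional.complete ℝ E
      cover := fun x => ⟨⟨chartAt E x, chart_mem_atlas E x⟩, mem_chart_source E x⟩
      isOpen_overlap := fun e e' => e.1.symm.isOpen_inter_preimage e'.1.open_source
      contDiffOn_trans := fun e e' => by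
        have h := ((contDiffGroupoid ∞ 𝓘(ℝ, E)).compatible e.2 e'.2).1
        have h' : ContDiffOn ℝ ∞ (e'.1 ∘ e.1.symm)
            (e.1.target ∩ e.1.symm ⁻¹' e'.1.source) := by
          simpa [contDiffPregroupoid] using h
        exact h' }

end FiniteDimensional

end BanachManifold

/-! ### The Banach manifold of maps of class `C^k` -/

section MappingSpace

variable {ED : Type*} [NormedAddCommGroup ED] [NormedSpace ℝ ED] {HD : Type*} [TopologicalSpace HD]
  {I : ModelWithCorners ℝ ED HD} {D : Type*} [TopologicalSpace D] [ChartedSpace HD D]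
  {E : Type*} [NormedAddCommGroup E] [NormedSpace ℝ E]
  {M : Type*} [TopologicalSpace M] [ChartedSpace E M] [IsManifold 𝓘(ℝ, E) ∞ M]
  {k : ℕ}

/-- A vector field along a map `x : D → M` in the trivialization of `TM` at `x p`. -/
def fieldTriv (x : D → M) (p : D) (v : ∀ q, TangentSpace 𝓘(ℝ, E) (x q)) (q : D) : E :=
  (trivializationAt E (TangentSpace 𝓘(ℝ, E)) (x p) ⟨x q, v q⟩).2

/-- The map `x` together with a field along it, as a map into the tangent bundle. -/
def fieldMap (x : D → M) (v : ∀ q, TangentSpace 𝓘(ℝ, E) (x q)) (q : D) :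
    TangentBundle 𝓘(ℝ, E) M := ⟨x q, v q⟩

theorem contMDiffVectorBundle_nat :
    ContMDiffVectorBundle k E (TangentSpace 𝓘(ℝ, E) : M → Type _) 𝓘(ℝ, E) := by
  have : IsManifold 𝓘(ℝ, E) ((k : WithTop ℕ∞) + 1) M :=
    IsManifold.of_le (n := ∞) (by exact_mod_cast le_top)
  exact TangentBundle.contMDiffVectorBundle

theorem contMDiffAt_fieldMap_iff (x : C^k⟮I, D; 𝓘(ℝ, E), M⟯) {p q : D}
    (hq : x q ∈ (chartAt E (x p)).source) (v : ∀ q, TangentSpace 𝓘(ℝ, E) (x q)) :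
    ContMDiffAt I 𝓘(ℝ, E).tangent k (fieldMap x v) q ↔
      ContMDiffAt I 𝓘(ℝ, E) k (fieldTriv x p v) q := by
  have := contMDiffVectorBundle_nat (E := E) (M := M) (k := k)
  rw [(trivializationAt E (TangentSpace 𝓘(ℝ, E)) (x p)).contMDiffAt_iff
    (f := fieldMap x v) (x₀ := q) (by simpa [fieldMap] using hq)]
  exact and_iff_right x.contMDiff.contMDiffAt

theorem fieldTriv_linear (x : D → M) {p q : D} (hq : x q ∈ (chartAt E (x p)).source)
    (v w : ∀ q, TangentSpace 𝓘(ℝ, E) (x q)) (c : ℝ) :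
    fieldTriv x p (v + w) q = fieldTriv x p v q + fieldTriv x p w q ∧
      fieldTriv x p (c • v) q = c • fieldTriv x p v q := by
  have h := (trivializationAt E (TangentSpace 𝓘(ℝ, E)) (x p)).linear ℝ (b := x q) (by simpa using hq)
  exact ⟨h.map_add _ _, h.map_smul _ _⟩

variable (x : C^k⟮I, D; 𝓘(ℝ, E), M⟯)

/-- The space of vector fields of class `C^k` along `x`, i.e. of maps `v : D → TM` of class `C^k`
with `v p ∈ T_{x p} M` for all `p`. -/
def FieldsAlong : Submodule ℝ (∀ p, TangentSpace 𝓘(ℝ, E) (x p)) where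
  carrier := {v | ContMDiff I 𝓘(ℝ, E).tangent k (fieldMap x v)}
  add_mem' := by
    intro v w hv hw p
    have hp := mem_chart_source E (x p)
    rw [contMDiffAt_fieldMap_iff x hp]
    refine (((contMDiffAt_fieldMap_iff x hp v).1 (hv p)).add
      ((contMDiffAt_fieldMap_iff x hp w).1 (hw p))).congr_of_eventuallyEq ?_
    filter_upwards [x.contMDiff.continuous.continuousAt.preimage_mem_nhds
      ((chartAt E (x p)).open_source.mem_nhds hp)] with q hq
    exact (fieldTriv_linear x hq v w 0).1
  zero_mem' := by
    intro p
    have hp := mem_chart_source E (x p)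
    rw [contMDiffAt_fieldMap_iff x hp]
    refine (contMDiffAt_const (c := (0 : E))).congr_of_eventuallyEq ?_
    filter_upwards [x.contMDiff.continuous.continuousAt.preimage_mem_nhds
      ((chartAt E (x p)).open_source.mem_nhds hp)] with q hq
    simpa using (fieldTriv_linear x hq 0 0 0).2
  smul_mem' := by
    intro c v hv p
    have hp := mem_chart_source E (x p)
    rw [contMDiffAt_fieldMap_iff x hp]
    have h := (contDiff_const_smul (n := (k : WithTop ℕ∞)) (F := E) c).contMDiff.contMDiffAt.comp p
      ((contMDiffAt_fieldMap_iff x hp v).1 (hv p))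
    refine h.congr_of_eventuallyEq ?_
    filter_upwards [x.contMDiff.continuous.continuousAt.preimage_mem_nhds
      ((chartAt E (x p)).open_source.mem_nhds hp)] with q hq
    exact (fieldTriv_linear x hq v 0 c).2

/-- A finite family of compact sets, contained in chart domains of `D` and mapped by `x` into chart
domains of `M`, whose interiors cover `D`. -/
structure ChartCover where
  /-- the base points of the charts -/
  pts : Finset D
  /-- the compact sets -/
  cpt : D → Set D
  isCompact : ∀ p ∈ pts, IsCompact (cpt p)
  subset : ∀ p ∈ pts, cpt p ⊆ (chartAt HD p).source ∩ x ⁻¹' (chartAt E (x p)).source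
  cover : ∀ q, ∃ p ∈ pts, q ∈ interior (cpt p)

theorem nonempty_chartCover [CompactSpace D] [T2Space D] : Nonempty (ChartCover x) := by
  classical
  have h : ∀ p : D, ∃ K : Set D, IsCompact K ∧ p ∈ interior K ∧
      K ⊆ (chartAt HD p).source ∩ x ⁻¹' (chartAt E (x p)).source := fun p =>
    exists_compact_subset ((chartAt HD p).open_source.inter
      ((chartAt E (x p)).open_source.preimage x.contMDiff.continuous))
      ⟨mem_chart_source HD p, mem_chart_source E (x p)⟩
  choose K hK hp hs using h
  obtain ⟨t, ht⟩ := isCompact_univ.elim_finite_subcover (fun p => interior (K p))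
    (fun _ => isOpen_interior) fun p _ => Set.mem_iUnion.2 ⟨p, hp p⟩
  refine ⟨⟨t, K, fun p _ => hK p, fun p _ => hs p, fun q => ?_⟩⟩
  simpa using ht (Set.mem_univ q)

/-- The space of vector fields of class `C^k` along `x`, endowed below with the `C^k` norm. -/
def CkField : Type _ := FieldsAlong x

instance : AddCommGroup (CkField x) := inferInstanceAs (AddCommGroup (FieldsAlong x))

instance : Module ℝ (CkField x) := inferInstanceAs (Module ℝ (FieldsAlong x))

variable {x}

/-- The values of a vector field along `x`. -/
def CkField.val (v : CkField x) : ∀ p, TangentSpace 𝓘(ℝ, E) (x p) := Subtype.val v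

/-- A vector field of class `C^k` along `x`, given by its values. -/
def CkField.mk (v : ∀ p, TangentSpace 𝓘(ℝ, E) (x p))
    (hv : ContMDiff I 𝓘(ℝ, E).tangent k (fieldMap x v)) : CkField x := Subtype.mk v hv

theorem CkField.contMDiff (v : CkField x) : ContMDiff I 𝓘(ℝ, E).tangent k (fieldMap x v.val) :=
  Subtype.property v

@[ext]
theorem CkField.ext {v w : CkField x} (h : ∀ p, v.val p = w.val p) : v = w :=
  Subtype.ext (funext h)

/-- The norm of the `j`-th derivative, at the point `q` and in the charts at `p` and `x p`, of a
vector field along `x`. -/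
def jetNorm (p : D) (j : ℕ) (v : CkField x) (q : D) : ℝ :=
  ‖iteratedFDerivWithin ℝ j (fieldTriv x p v.val ∘ (extChartAt I p).symm) (Set.range I)
    (extChartAt I p q)‖

theorem contDiffWithinAt_fieldTriv [IsManifold I ∞ D] {p q : D}
    (hq : q ∈ (chartAt HD p).source ∩ x ⁻¹' (chartAt E (x p)).source) (v : CkField x) :
    ContDiffWithinAt ℝ k (fieldTriv x p v.val ∘ (extChartAt I p).symm) (Set.range I)
      (extChartAt I p q) := by
  have h := (contMDiffAt_fieldMap_iff x hq.2 v.val).1 (v.contMDiff q)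
  have h2 := ((contMDiffAt_iff_source_of_mem_source hq.1).1 h)
  exact h2.contDiffWithinAt

theorem eventually_mem_source {p q : D}
    (hq : q ∈ (chartAt HD p).source ∩ x ⁻¹' (chartAt E (x p)).source) :
    ∀ᶠ z in 𝓝[Set.range I] (extChartAt I p q),
      x ((extChartAt I p).symm z) ∈ (chartAt E (x p)).source := by
  have h1 : ContinuousAt (extChartAt I p).symm (extChartAt I p q) :=
    continuousAt_extChartAt_symm' (by simpa using hq.1)
  have h2 : (extChartAt I p).symm (extChartAt I p q) = q :=
    (extChartAt I p).left_inv (by simpa using hq.1)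
  have h3 : ContinuousAt (fun z => x ((extChartAt I p).symm z)) (extChartAt I p q) :=
    x.contMDiff.continuous.continuousAt.comp h1
  refine (h3.eventually ((chartAt E (x p)).open_source.mem_nhds ?_)).filter_mono
    nhdsWithin_le_nhds
  change x ((extChartAt I p).symm (extChartAt I p q)) ∈ _
  rw [h2]
  exact hq.2

theorem jetNorm_add_le [IsManifold I ∞ D] {p q : D} {j : ℕ} (hj : j ≤ k)
    (hq : q ∈ (chartAt HD p).source ∩ x ⁻¹' (chartAt E (x p)).source) (v w : CkField x) :
    jetNorm p j (v + w) q ≤ jetNorm p j v q + jetNorm p j w q := by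
  have hmem : extChartAt I p q ∈ Set.range I := Set.mem_range_self _
  have h : fieldTriv x p (v + w).val ∘ (extChartAt I p).symm =ᶠ[𝓝[Set.range I] (extChartAt I p q)]
      fieldTriv x p v.val ∘ (extChartAt I p).symm + fieldTriv x p w.val ∘ (extChartAt I p).symm := by
    filter_upwards [eventually_mem_source hq] with z hz
    exact (fieldTriv_linear x hz v.val w.val 0).1
  have hj' : (j : WithTop ℕ∞) ≤ k := by exact_mod_cast hj
  unfold jetNorm
  rw [h.iteratedFDerivWithin_eq (h.self_of_nhdsWithin hmem) j, iteratedFDerivWithin_add_apply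
    ((contDiffWithinAt_fieldTriv hq v).of_le hj') ((contDiffWithinAt_fieldTriv hq w).of_le hj')
    I.uniqueDiffOn hmem]
  exact norm_add_le _ _

theorem jetNorm_smul [IsManifold I ∞ D] {p q : D} {j : ℕ} (hj : j ≤ k)
    (hq : q ∈ (chartAt HD p).source ∩ x ⁻¹' (chartAt E (x p)).source) (c : ℝ) (v : CkField x) :
    jetNorm p j (c • v) q = |c| * jetNorm p j v q := by
  have hmem : extChartAt I p q ∈ Set.range I := Set.mem_range_self _
  have h : fieldTriv x p (c • v).val ∘ (extChartAt I p).symm =ᶠ[𝓝[Set.range I] (extChartAt I p q)]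
      c • (fieldTriv x p v.val ∘ (extChartAt I p).symm) := by
    filter_upwards [eventually_mem_source hq] with z hz
    exact (fieldTriv_linear x hz v.val 0 c).2
  have hj' : (j : WithTop ℕ∞) ≤ k := by exact_mod_cast hj
  unfold jetNorm
  rw [h.iteratedFDerivWithin_eq (h.self_of_nhdsWithin hmem) j, iteratedFDerivWithin_const_smul_apply
    ((contDiffWithinAt_fieldTriv hq v).of_le hj') I.uniqueDiffOn hmem, norm_smul, Real.norm_eq_abs]

theorem continuousAt_jetNorm [IsManifold I ∞ D] {p q : D} {j : ℕ} (hj : j ≤ k)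
    (hq : q ∈ (chartAt HD p).source ∩ x ⁻¹' (chartAt E (x p)).source) (v : CkField x) :
    ContinuousAt (jetNorm p j v) q := by
  have h := (contDiffWithinAt_fieldTriv hq v).continuousWithinAt_iteratedFDerivWithin
    I.uniqueDiffOn (by exact_mod_cast hj) (Set.mem_range_self _)
  refine ContinuousAt.norm ?_
  have h2 : Filter.Tendsto (extChartAt I p) (𝓝 q) (𝓝[Set.range I] (extChartAt I p q)) := by
    refine tendsto_nhdsWithin_iff.2 ⟨continuousAt_extChartAt' (by simpa using hq.1), ?_⟩
    exact Filter.Eventually.of_forall fun y => Set.mem_range_self _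
  exact h.tendsto.comp h2

variable (x) in
/-- A chosen finite cover used to define the norm. -/
def chartCover [CompactSpace D] [T2Space D] : ChartCover x := (nonempty_chartCover x).some


variable [CompactSpace D] [T2Space D] [IsManifold I ∞ D]

/-- The `C^k` norm of a vector field `v` along `x`: the sum of the suprema of the norms of the
derivatives of order at most `k` of the local representatives of `v`, over the compact sets of a
finite cover. (Different covers give equivalent norms.) -/
instance : Norm (CkField x) where
  norm v := ∑ p ∈ (chartCover x).pts, ∑ j ∈ Finset.range (k + 1),
    ⨆ q : (chartCover x).cpt p, jetNorm p j v q

theorem norm_def (v : CkField x) : ‖v‖ = ∑ p ∈ (chartCover x).pts, ∑ j ∈ Finset.range (k + 1),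
    ⨆ q : (chartCover x).cpt p, jetNorm p j v q := rfl

theorem bddAbove_jetNorm (v : CkField x) {p : D} (hp : p ∈ (chartCover x).pts) {j : ℕ}
    (hj : j ≤ k) : BddAbove (Set.range fun q : (chartCover x).cpt p => jetNorm p j v q) := by
  have h := ((chartCover x).isCompact p hp).bddAbove_image (f := jetNorm p j v) fun q hq =>
    (continuousAt_jetNorm hj ((chartCover x).subset p hp hq) v).continuousWithinAt
  rwa [Set.image_eq_range] at h

theorem jetNorm_nonneg (p : D) (j : ℕ) (v : CkField x) (q : D) : 0 ≤ jetNorm p j v q :=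
  norm_nonneg _

theorem norm_core : NormedSpace.Core ℝ (CkField x) where
  norm_nonneg v := Finset.sum_nonneg fun p _ => Finset.sum_nonneg fun j _ =>
    Real.iSup_nonneg fun q => jetNorm_nonneg p j v q
  norm_smul c v := by
    simp only [norm_def, Finset.mul_sum, Real.norm_eq_abs, Real.mul_iSup_of_nonneg (abs_nonneg c)]
    refine Finset.sum_congr rfl fun p hp => Finset.sum_congr rfl fun j hj => ?_
    exact iSup_congr fun q => jetNorm_smul (Finset.mem_range_succ_iff.1 hj)
      ((chartCover x).subset p hp q.2) c v
  norm_triangle v w := by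
    simp only [norm_def, ← Finset.sum_add_distrib]
    refine Finset.sum_le_sum fun p hp => Finset.sum_le_sum fun j hj => ?_
    have hj' := Finset.mem_range_succ_iff.1 hj
    refine Real.iSup_le (fun q => ?_) (add_nonneg (Real.iSup_nonneg fun q => jetNorm_nonneg p j v q)
      (Real.iSup_nonneg fun q => jetNorm_nonneg p j w q))
    exact (jetNorm_add_le hj' ((chartCover x).subset p hp q.2) v w).trans
      (add_le_add (le_ciSup (bddAbove_jetNorm v hp hj') q) (le_ciSup (bddAbove_jetNorm w hp hj') q))
  norm_eq_zero_iff v := by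
    constructor
    · intro h
      refine CkField.ext fun q => ?_
      obtain ⟨p, hp, hq⟩ := (chartCover x).cover q
      have hq := interior_subset hq
      have hs := (chartCover x).subset p hp hq
      rw [norm_def] at h
      have h1 := (Finset.sum_eq_zero_iff_of_nonneg fun p _ => Finset.sum_nonneg fun j _ =>
        Real.iSup_nonneg fun q : (chartCover x).cpt p => jetNorm_nonneg p j v q).1 h p hp
      have h2 := (Finset.sum_eq_zero_iff_of_nonneg fun j _ =>
        Real.iSup_nonneg fun q : (chartCover x).cpt p => jetNorm_nonneg p j v q).1 h1 0 (by simp)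
      have h3 : jetNorm p 0 v q ≤ 0 := h2 ▸
        le_ciSup (bddAbove_jetNorm v hp (Nat.zero_le k)) (⟨q, hq⟩ : (chartCover x).cpt p)
      have h4 : fieldTriv x p v.val q = 0 := by
        have h5 := le_antisymm h3 (jetNorm_nonneg _ _ _ _)
        rw [jetNorm, norm_iteratedFDerivWithin_zero, norm_eq_zero, Function.comp_apply,
          (extChartAt I p).left_inv (by simpa using hs.1)] at h5
        exact h5
      have hb : x q ∈ (trivializationAt E (TangentSpace 𝓘(ℝ, E)) (x p)).baseSet := by
        simpa using hs.2
      have h6 := ((trivializationAt E (TangentSpace 𝓘(ℝ, E)) (x p)).linearEquivAt ℝ (x q) hb).map_eq_zero_iff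
        (x := v.val q)
      exact h6.1 h4
    · rintro rfl
      have h : ∀ p ∈ (chartCover x).pts, ∀ j ∈ Finset.range (k + 1),
          (⨆ q : (chartCover x).cpt p, jetNorm p j (0 : CkField x) q) = 0 := fun p hp j hj => by
        have : ∀ q : (chartCover x).cpt p, jetNorm p j (0 : CkField x) q = 0 := fun q => by
          simpa using jetNorm_smul (Finset.mem_range_succ_iff.1 hj)
            ((chartCover x).subset p hp q.2) 0 (0 : CkField x)
        simp [this]
      exact Finset.sum_eq_zero fun p hp => Finset.sum_eq_zero fun j hj => h p hp j hj

instance : NormedAddCommGroup (CkField x) := NormedAddCommGroup.ofCore norm_core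

instance : NormedSpace ℝ (CkField x) := NormedSpace.ofCore norm_core

/-! #### The charts -/

variable (E M) in
/-- A local addition on an open subset of `M`: an open subset `source` of `TM`, which contains with
a vector `v ∈ T_y M` also the zero vector of `T_y M`, and a smooth map `α` from `source` to `M`,
with `α 0_y = y`, such that `v ↦ (π v, α v)` is a diffeomorphism from `source` onto an open subset
of `M × M`. The field `toOpenPartialHomeomorph` is the map `(π, α)`. (The exponential map of a
connection, restricted to a suitable neighbourhood of the zero section, is an example.) -/
structure LocalAddition extends OpenPartialHomeomorph (TangentBundle 𝓘(ℝ, E) M) (M × M) where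
  fst_apply : ∀ v ∈ source, (toFun v).1 = v.proj
  zero_mem : ∀ v ∈ source, (⟨v.proj, 0⟩ : TangentBundle 𝓘(ℝ, E) M) ∈ source
  apply_zero : ∀ v ∈ source, toFun ⟨v.proj, 0⟩ = (v.proj, v.proj)
  contMDiffOn_toFun : ContMDiffOn 𝓘(ℝ, E).tangent (𝓘(ℝ, E).prod 𝓘(ℝ, E)) ∞ toFun source
  contMDiffOn_invFun : ContMDiffOn (𝓘(ℝ, E).prod 𝓘(ℝ, E)) 𝓘(ℝ, E).tangent ∞ invFun target

namespace LocalAddition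

variable (α : LocalAddition E M)

theorem proj_symm {z : M × M} (hz : z ∈ α.target) : (α.toOpenPartialHomeomorph.symm z).proj = z.1 := by
  have h := α.fst_apply _ (α.map_target hz)
  have h2 := α.toOpenPartialHomeomorph.right_inv hz
  rw [← h]
  exact congrArg Prod.fst h2

/-- The vector field `p ↦ (π, α)⁻¹ (x p, y p)` along `x`. -/
def fieldTo (x y : D → M) (p : D) : TangentSpace 𝓘(ℝ, E) (x p) :=
  (α.toOpenPartialHomeomorph.symm (x p, y p)).2

theorem fieldMap_fieldTo {x y : D → M} (h : ∀ p, (x p, y p) ∈ α.target) :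
    fieldMap x (α.fieldTo x y) = fun p => α.toOpenPartialHomeomorph.symm (x p, y p) := by
  have key : ∀ (t : TangentBundle 𝓘(ℝ, E) M) (y : M), t.proj = y →
      (⟨y, t.2⟩ : TangentBundle 𝓘(ℝ, E) M) = t := by
    rintro ⟨y, v⟩ _ rfl
    rfl
  exact funext fun p => key _ _ (α.proj_symm (h p))

end LocalAddition

variable (I D E M k) in
/-- The index set of the natural atlas of `C^k(D, M)`: a centre `x : D → M` of class `C^k`, and a
local addition defined around the image of `x`. -/
structure MapChartIndex where
  /-- the centre of the chart -/
  center : C^k⟮I, D; 𝓘(ℝ, E), M⟯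
  /-- the local addition -/
  add : LocalAddition E M
  zero_mem : ∀ p, (⟨center p, 0⟩ : TangentBundle 𝓘(ℝ, E) M) ∈ add.source

namespace MapChartIndex

variable (i : MapChartIndex I D E M k)

theorem contMDiff_fieldTo (y : C^k⟮I, D; 𝓘(ℝ, E), M⟯)
    (h : ∀ p, (i.center p, y p) ∈ i.add.target) :
    ContMDiff I 𝓘(ℝ, E).tangent k (fieldMap i.center (i.add.fieldTo i.center y)) := by
  rw [i.add.fieldMap_fieldTo h]
  exact (i.add.contMDiffOn_invFun.of_le (by exact_mod_cast le_top)).comp_contMDiff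
    (i.center.contMDiff.prodMk y.contMDiff) h

theorem contMDiff_add (v : CkField i.center)
    (h : ∀ p, fieldMap i.center v.val p ∈ i.add.source) :
    ContMDiff I 𝓘(ℝ, E) k
      (fun p => (i.add.toOpenPartialHomeomorph (fieldMap i.center v.val p)).2) :=
  contMDiff_snd.comp ((i.add.contMDiffOn_toFun.of_le (by exact_mod_cast le_top)).comp_contMDiff
    v.2 h)

/-- The field `p ↦ (π, α)⁻¹ (x p, y p)` along the centre `x`. -/
def toField (y : C^k⟮I, D; 𝓘(ℝ, E), M⟯) (h : ∀ p, (i.center p, y p) ∈ i.add.target) :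
    CkField i.center :=
  CkField.mk (i.add.fieldTo i.center y) (i.contMDiff_fieldTo y h)

/-- The map `p ↦ α (v p)`. -/
def ofField (v : CkField i.center) (h : ∀ p, fieldMap i.center v.val p ∈ i.add.source) :
    C^k⟮I, D; 𝓘(ℝ, E), M⟯ :=
  ⟨fun p => (i.add.toOpenPartialHomeomorph (fieldMap i.center v.val p)).2, i.contMDiff_add v h⟩

theorem fieldMap_toField (y : C^k⟮I, D; 𝓘(ℝ, E), M⟯)
    (h : ∀ p, (i.center p, y p) ∈ i.add.target) (p : D) :
    fieldMap i.center (i.toField y h).val p =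
      i.add.toOpenPartialHomeomorph.symm (i.center p, y p) :=
  congrFun (i.add.fieldMap_fieldTo h) p

theorem center_ofField (v : CkField i.center)
    (h : ∀ p, fieldMap i.center v.val p ∈ i.add.source) (p : D) :
    (i.center p, i.ofField v h p) = i.add.toOpenPartialHomeomorph (fieldMap i.center v.val p) :=
  Prod.ext (i.add.fst_apply _ (h p)).symm rfl

open Classical in
/-- The chart of `C^k(D, M)` centred at `x`, with values in the Banach space of vector fields of
class `C^k` along `x`. It maps `y` to the field `p ↦ (π, α)⁻¹ (x p, y p)`; its inverse maps a field
`v`, with values in the domain of the local addition `α`, to the map `p ↦ α (v p)`. -/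
def chart : PartialEquiv (C^k⟮I, D; 𝓘(ℝ, E), M⟯) (CkField i.center) where
  toFun y := if h : ∀ p, (i.center p, y p) ∈ i.add.target then i.toField y h else 0
  invFun v := if h : ∀ p, fieldMap i.center v.val p ∈ i.add.source then i.ofField v h else i.center
  source := {y | ∀ p, (i.center p, y p) ∈ i.add.target}
  target := {v | ∀ p, fieldMap i.center v.val p ∈ i.add.source}
  map_source' y (h : ∀ p, (i.center p, y p) ∈ i.add.target) p := by
    rw [dif_pos h, fieldMap_toField]
    exact i.add.toOpenPartialHomeomorph.map_target (h p)
  map_target' v (h : ∀ p, fieldMap i.center v.val p ∈ i.add.source) p := by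
    rw [dif_pos h, center_ofField]
    exact i.add.toOpenPartialHomeomorph.map_source (h p)
  left_inv' y (h : ∀ p, (i.center p, y p) ∈ i.add.target) := by
    have h1 : ∀ p, fieldMap i.center (i.toField y h).val p ∈ i.add.source := fun p => by
      rw [fieldMap_toField]
      exact i.add.toOpenPartialHomeomorph.map_target (h p)
    rw [dif_pos h, dif_pos h1]
    ext p
    have h2 : (i.center p, i.ofField (i.toField y h) h1 p) = (i.center p, y p) := by
      rw [center_ofField, fieldMap_toField]
      exact i.add.toOpenPartialHomeomorph.right_inv (h p)
    exact congrArg Prod.snd h2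
  right_inv' v (h : ∀ p, fieldMap i.center v.val p ∈ i.add.source) := by
    have h1 : ∀ p, (i.center p, i.ofField v h p) ∈ i.add.target := fun p => by
      rw [center_ofField]
      exact i.add.toOpenPartialHomeomorph.map_source (h p)
    rw [dif_pos h, dif_pos h1]
    ext p
    have h2 := i.fieldMap_toField _ h1 p
    rw [center_ofField, i.add.toOpenPartialHomeomorph.left_inv (h p)] at h2
    simpa [fieldMap] using h2

end MapChartIndex

variable (I D E M k) in
/-- The natural atlas of the set `C^k(D, M)` of maps of class `C^k` from `D` to `M`. -/
def mapAtlas : BanachAtlas (C^k⟮I, D; 𝓘(ℝ, E), M⟯) where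
  ι := MapChartIndex I D E M k
  model i := CkField i.center
  chart i := i.chart

/-- The Banach manifold `C^k(D, M)`. -/
def mapManifold (h : (mapAtlas I D E M k).IsSmoothAtlas) :
    BanachManifold (C^k⟮I, D; 𝓘(ℝ, E), M⟯) := ⟨mapAtlas I D E M k, h⟩

open BanachManifold

/-- The natural connection on `C^k(D, M)` induced by a connection `P` on `M`. Via the identifications
`T C^k(D, M) ≅ C^k(D, TM)` and `T(T C^k(D, M)) ≅ C^k(D, T(TM))`, which send a tangent vector `v` to
`p ↦ d(ev_p)(v)` and a vector `η` tangent to the tangent bundle to `p ↦ d(d(ev_p))(η)`, with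
`ev_p` the evaluation at `p`, it is the left-composition with `P : T(TM) → TM`. -/
def IsNaturalConnection [FiniteDimensional ℝ E] (h : (mapAtlas I D E M k).IsSmoothAtlas)
    (P : (ofManifold E M).tangent.TBundle → (ofManifold E M).TBundle)
    (Q : (mapManifold h).tangent.TBundle → (mapManifold h).TBundle) : Prop :=
  (mapManifold h).IsConnection Q ∧ ∀ (p : D) (η : (mapManifold h).tangent.TBundle),
    tmap (mapManifold h) (ofManifold E M) (fun x => x p) (Q η) =
      P (tmap (mapManifold h).tangent (ofManifold E M).tangent
        (tmap (mapManifold h) (ofManifold E M) (fun x => x p)) η)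

end MappingSpace

/-- The left-composition with a smooth map `f : M → M'`, as a map `C^k(D, M) → C^k(D, M')`. -/
def leftComp {ED : Type*} [NormedAddCommGroup ED] [NormedSpace ℝ ED]
    {HD : Type*} [TopologicalSpace HD] (I : ModelWithCorners ℝ ED HD)
    (D : Type*) [TopologicalSpace D] [ChartedSpace HD D]
    {E : Type*} [NormedAddCommGroup E] [NormedSpace ℝ E]
    {M : Type*} [TopologicalSpace M] [ChartedSpace E M]
    {E' : Type*} [NormedAddCommGroup E'] [NormedSpace ℝ E']
    {M' : Type*} [TopologicalSpace M'] [ChartedSpace E' M'] (k : ℕ)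
    (f : C^∞⟮𝓘(ℝ, E), M; 𝓘(ℝ, E'), M'⟯) (x : C^k⟮I, D; 𝓘(ℝ, E), M⟯) :
    C^k⟮I, D; 𝓘(ℝ, E'), M'⟯ :=
  ⟨fun p => f (x p), (f.contMDiff.of_le (by exact_mod_cast le_top)).comp x.contMDiff⟩

end
end BanachGeometry

open BanachGeometry BanachGeometry.BanachManifold

/-!
The proof rests on a smoothness criterion for maps into the Banach spaces of `C^k` fields. The jets of
a field, at the points of a finite family of compact sets covering `D`, form a norming family of linear
maps, and a map into a Banach space is smooth as soon as its compositions with a norming family are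
smooth with locally uniform bounds for all derivatives (`IsNorming.contDiffOn`): difference quotients
are then Cauchy, and this argument can be iterated. For a pushforward `u ↦ f ∘ u` with a smooth function
`f`, the jets of `f ∘ u` are smooth functions of the jets of `u` by the formula of Faà di Bruno, and the
bounds are uniform by compactness. So pushforwards are smooth (`contDiffOn_of_hasPushforwardForm`).

Local additions exist around every compact set (`exists_localAddition`): a sum of differences in charts,
weighted with bump functions, is a local diffeomorphism from a neighbourhood of the diagonal of `M × M`
to a neighbourhood of the zero section of `TM`, and its inverse is a local addition. Hence the natural
charts of `C^k(D, M)` cover. In these charts, left-compositions with smooth maps are pushforwards; with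
the identity, this shows that transition maps are smooth (`isSmoothAtlas_mapAtlas`). The evaluations
`ev_p` are smooth as well.

A tangent vector of `C^k(D, M)` is determined by its images under all `d(ev_p)`
(`tmap_eval_injective`), whence the uniqueness of the natural connection. For the existence, the
Christoffel symbol in a chart has to be `G_z(u, v)` with
`Dψ_q (G_z(u, v)) = D²ψ_q (u, v) + Γ(Dψ_q u, Dψ_q v)`, where `ψ_q` represents `ev_q` in charts. This can
be solved at each `q`, because the derivative of a local addition along the fibres is invertible, and
the solution is a pushforward by a function that is bilinear in `(u, v)`; thus it is a smooth family of
bounded bilinear maps (`MapChartIndex.exists_christoffel`).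

If `f` is affine, then `f_*` is affine because this can be tested after applying the evaluations
(`isAffine_leftComp`). An isometry is affine for the Levi-Civita connections: the defect of the
transformation law of the Christoffel symbols is symmetric, because both connections are torsion-free,
and it is skew with respect to the metric, because both metrics are parallel; so it vanishes
(`isAffine_of_preservesMetric`).
-/

namespace BanachGeometry

/-! ### Smoothness tested on a norming family -/

section WeakSmoothness

variable {X F : Type*} [NormedAddCommGroup X] [NormedSpace ℝ X]
  [NormedAddCommGroup F] [NormedSpace ℝ F]
  {Q : Type*} {B : Q → Type*} [∀ q, NormedAddCommGroup (B q)] [∀ q, NormedSpace ℝ (B q)]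

/-- A family `e` of continuous linear maps on `F` is norming with constant `c` if a bound `r` on all
values `e q y` bounds `y` by `c * r`. -/
def IsNorming (e : ∀ q, F →L[ℝ] B q) (c : ℝ) : Prop :=
  0 ≤ c ∧ ∀ (y : F) (r : ℝ), 0 ≤ r → (∀ q, ‖e q y‖ ≤ r) → ‖y‖ ≤ c * r

theorem IsNorming.eq_of_forall {e : ∀ q, F →L[ℝ] B q} {c : ℝ} (he : IsNorming e c) {y z : F}
    (h : ∀ q, e q y = e q z) : y = z := by
  have := he.2 (y - z) 0 le_rfl fun q => by simp [h q]
  rw [mul_zero] at this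
  exact sub_eq_zero.1 (norm_le_zero_iff.1 this)

/-- A norming family on `F` induces one on the multilinear maps into `F`, with the same constant. This
is what makes an induction over the order of differentiation possible. -/
theorem IsNorming.multilinear {e : ∀ q, F →L[ℝ] B q} {c : ℝ} (he : IsNorming e c) (m : ℕ) :
    IsNorming (fun q => ContinuousLinearMap.compContinuousMultilinearMapL ℝ (fun _ : Fin m => X)
      F (B q) (e q)) c := by
  refine ⟨he.1, fun A r hr h => ContinuousMultilinearMap.opNorm_le_bound
    (mul_nonneg he.1 hr) fun v => ?_⟩
  rw [mul_assoc]
  refine he.2 _ _ (mul_nonneg hr (Finset.prod_nonneg fun i _ => norm_nonneg _)) fun q => ?_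
  exact ContinuousMultilinearMap.le_of_opNorm_le (h q) v

/-- If a map into a Banach space has first order expansions, uniformly along a norming family of
linear maps, then it is differentiable: the difference quotients form Cauchy sequences. -/
theorem IsNorming.exists_hasFDerivAt [CompleteSpace F] {e : ∀ q, F →L[ℝ] B q} {c : ℝ}
    (he : IsNorming e c) {f : X → F} {u₀ : X} {g' : ∀ q, X →L[ℝ] B q} {M₁ M₂ δ : ℝ} (hδ : 0 < δ)
    (hM₂ : 0 ≤ M₂) (hg' : ∀ q, ‖g' q‖ ≤ M₁)
    (h : ∀ u ∈ Metric.ball u₀ δ, ∀ q,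
      ‖e q (f u) - e q (f u₀) - g' q (u - u₀)‖ ≤ M₂ * ‖u - u₀‖ ^ 2) :
    ∃ L : X →L[ℝ] F, HasFDerivAt f L u₀ ∧ ∀ q, (e q).comp L = g' q := by
  -- the limit of the difference quotients in the direction `v`
  have key : ∀ v : X, ∃ y : F, ∀ q, e q y = g' q v := by
    intro v
    -- the step `s` keeps `u₀ + t n • v` inside of the ball of radius `δ`
    let s : ℝ := δ / (2 * (‖v‖ + 1))
    have hs : 0 < s := by positivity
    let t : ℕ → ℝ := fun n => s * (1 / ((n : ℝ) + 1))
    have ht : ∀ n, 0 < t n := fun n => by positivity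
    have ht0 : Filter.Tendsto t Filter.atTop (𝓝 0) := by
      simpa [t] using (tendsto_one_div_add_atTop_nhds_zero_nat (𝕜 := ℝ)).const_mul s
    have hmono : ∀ n m, n ≤ m → t m ≤ t n := fun n m hnm =>
      mul_le_mul_of_nonneg_left (Nat.one_div_le_one_div hnm) hs.le
    let y : ℕ → F := fun n => (t n)⁻¹ • (f (u₀ + t n • v) - f u₀)
    have hy : ∀ n q, ‖e q (y n) - g' q v‖ ≤ M₂ * ‖v‖ ^ 2 * t n := by
      intro n q
      have hb : u₀ + t n • v ∈ Metric.ball u₀ δ := by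
        rw [mem_ball_iff_norm, add_sub_cancel_left, norm_smul, Real.norm_eq_abs, abs_of_pos (ht n)]
        have h1 : t n ≤ s := by
          simpa [t] using hmono 0 n (Nat.zero_le n)
        calc t n * ‖v‖ ≤ s * ‖v‖ := by gcongr
          _ < δ := by
            rw [div_mul_eq_mul_div, div_lt_iff₀ (by positivity)]
            nlinarith [norm_nonneg v]
      have h2 := h _ hb q
      rw [add_sub_cancel_left, norm_smul, Real.norm_eq_abs, abs_of_pos (ht n)] at h2
      have h3 : e q (y n) - g' q v =
          (t n)⁻¹ • (e q (f (u₀ + t n • v)) - e q (f u₀) - g' q (t n • v)) := by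
        simp only [y, map_smul, map_sub, smul_sub, smul_smul]
        rw [inv_mul_cancel₀ (ht n).ne', one_smul]
      rw [h3, norm_smul, norm_inv, Real.norm_eq_abs, abs_of_pos (ht n), inv_mul_le_iff₀ (ht n)]
      refine h2.trans (le_of_eq ?_)
      ring
    have hC : CauchySeq y := by
      refine cauchySeq_of_le_tendsto_0' (fun n => c * (2 * (M₂ * ‖v‖ ^ 2 * t n))) ?_ ?_
      · intro n m hnm
        rw [dist_eq_norm]
        refine he.2 _ _ (by have := (ht n).le; positivity) fun q => ?_
        have h1 := hy n q
        have h2 := hy m q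
        have h3 : M₂ * ‖v‖ ^ 2 * t m ≤ M₂ * ‖v‖ ^ 2 * t n := by
          have := hmono n m hnm
          gcongr
        rw [map_sub]
        calc ‖e q (y n) - e q (y m)‖
            = ‖(e q (y n) - g' q v) - (e q (y m) - g' q v)‖ := by congr 1; abel
          _ ≤ _ := norm_sub_le _ _
          _ ≤ _ := by linarith
      · simpa using (((ht0.const_mul (M₂ * ‖v‖ ^ 2)).const_mul 2).const_mul c)
    obtain ⟨z, hz⟩ := cauchySeq_tendsto_of_complete hC
    refine ⟨z, fun q => ?_⟩
    have h1 : Filter.Tendsto (fun n => ‖e q (y n) - g' q v‖) Filter.atTop (𝓝 0) := by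
      refine squeeze_zero (fun _ => norm_nonneg _) (fun n => hy n q) ?_
      simpa using ht0.const_mul (M₂ * ‖v‖ ^ 2)
    exact tendsto_nhds_unique (((e q).continuous.tendsto z).comp hz)
      (tendsto_iff_norm_sub_tendsto_zero.2 h1)
  choose L hL using key
  let L' : X →ₗ[ℝ] F :=
    { toFun := L
      map_add' := fun v w => he.eq_of_forall fun q => by simp [hL]
      map_smul' := fun a v => he.eq_of_forall fun q => by simp [hL] }
  let L'' : X →L[ℝ] F := L'.mkContinuous (c * |M₁|) fun v => by
    rw [mul_assoc]
    refine he.2 _ _ (by positivity) fun q => ?_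
    change ‖e q (L v)‖ ≤ _
    rw [hL]
    exact (g' q).le_of_opNorm_le ((hg' q).trans (le_abs_self _)) v
  refine ⟨L'', ?_, fun q => ContinuousLinearMap.ext fun v => hL v q⟩
  rw [hasFDerivAt_iff_isLittleO_nhds_zero]
  refine Asymptotics.IsBigO.trans_isLittleO (g := fun v : X => ‖v‖ ^ 2) ?_ ?_
  · refine Asymptotics.IsBigO.of_bound (c * M₂) ?_
    filter_upwards [Metric.ball_mem_nhds (0 : X) hδ] with v hv
    rw [Real.norm_eq_abs, abs_of_nonneg (by positivity), mul_assoc]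
    refine he.2 _ _ (by positivity) fun q => ?_
    have h1 := h (u₀ + v) (by simpa [mem_ball_iff_norm] using hv) q
    rw [add_sub_cancel_left] at h1
    rw [map_sub, map_sub]
    change ‖_ - e q (L v)‖ ≤ _
    rwa [hL]
  · simpa using (Asymptotics.isLittleO_norm_pow_id (E' := X) one_lt_two)

/-- A map into a Banach space is smooth if its compositions with a norming family of linear maps are
smooth, with derivatives of all orders locally bounded uniformly in the family. -/
theorem IsNorming.contDiffOn [CompleteSpace F] {e : ∀ q, F →L[ℝ] B q} {c : ℝ}
    (he : IsNorming e c) {T : X → F} {U : Set X} (hU : IsOpen U)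
    (hs : ∀ q, ContDiffOn ℝ ∞ (fun u => e q (T u)) U)
    (hb : ∀ u₀ ∈ U, ∀ n : ℕ, ∃ M : ℝ, ∀ᶠ u in 𝓝 u₀, ∀ q,
      ‖iteratedFDeriv ℝ n (fun u => e q (T u)) u‖ ≤ M) :
    ContDiffOn ℝ ∞ T U := by
  have hda : ∀ q (n : ℕ), ∀ u ∈ U,
      DifferentiableAt ℝ (iteratedFDeriv ℝ n (fun u => e q (T u))) u := by
    intro q n u hu
    exact ((hs q).contDiffAt (hU.mem_nhds hu)).differentiableAt_iteratedFDeriv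
      (by exact_mod_cast ENat.natCast_lt_top n)
  -- the `m`-th derivative of `T` is differentiable, once its images under the norming family are known
  have hstep : ∀ m : ℕ, (∀ u ∈ U, ∀ q, (e q).compContinuousMultilinearMap
      (iteratedFDeriv ℝ m T u) = iteratedFDeriv ℝ m (fun u => e q (T u)) u) → ∀ u₀ ∈ U,
      ∃ L, HasFDerivAt (iteratedFDeriv ℝ m T) L u₀ ∧ ∀ q,
        (ContinuousLinearMap.compContinuousMultilinearMapL ℝ (fun _ : Fin m => X)
          F (B q) (e q)).comp L = fderiv ℝ (iteratedFDeriv ℝ m (fun u => e q (T u))) u₀ := by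
    intro m hm u₀ hu₀
    obtain ⟨M₁, hM₁⟩ := hb u₀ hu₀ (m + 1)
    obtain ⟨M₂, hM₂⟩ := hb u₀ hu₀ (m + 2)
    obtain ⟨δ, hδ, hball⟩ := Metric.eventually_nhds_iff_ball.1
      ((hM₁.and hM₂).and (hU.mem_nhds hu₀))
    refine (he.multilinear m).exists_hasFDerivAt (M₁ := M₁) (M₂ := |M₂|) hδ (abs_nonneg _)
      (fun q => ?_) fun u hu q => ?_
    · rw [norm_fderiv_iteratedFDeriv]
      exact hM₁.self_of_nhds q
    · rw [ContinuousLinearMap.compContinuousMultilinearMapL_apply,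
        ContinuousLinearMap.compContinuousMultilinearMapL_apply, hm u (hball u hu).2 q,
        hm u₀ hu₀ q]
      set g := fun u => e q (T u) with hg
      have hsub : Metric.closedBall u₀ ‖u - u₀‖ ⊆ Metric.ball u₀ δ :=
        Metric.closedBall_subset_ball (mem_ball_iff_norm.1 hu)
      have hlip : ∀ w ∈ Metric.closedBall u₀ ‖u - u₀‖,
          ‖fderiv ℝ (iteratedFDeriv ℝ m g) w - fderiv ℝ (iteratedFDeriv ℝ m g) u₀‖ ≤
            |M₂| * ‖u - u₀‖ := by
        intro w hw
        have h1 := (convex_ball u₀ δ).norm_image_sub_le_of_norm_fderiv_le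
          (f := iteratedFDeriv ℝ (m + 1) g) (𝕜 := ℝ) (C := |M₂|)
          (fun z hz => hda q (m + 1) z (hball z hz).2)
          (fun z hz => by
            rw [norm_fderiv_iteratedFDeriv]
            exact ((hball z hz).1.2 q).trans (le_abs_self _))
          (Metric.mem_ball_self hδ) (hsub hw)
        rw [iteratedFDeriv_succ_eq_comp_left, Function.comp_apply, Function.comp_apply,
          ← dist_eq_norm, LinearIsometryEquiv.dist_map, dist_eq_norm] at h1
        refine h1.trans ?_
        have := mem_closedBall_iff_norm.1 hw
        gcongr
      have h2 := (convex_closedBall u₀ ‖u - u₀‖).norm_image_sub_le_of_norm_hasFDerivWithin_le'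
        (f := iteratedFDeriv ℝ m g) (f' := fderiv ℝ (iteratedFDeriv ℝ m g)) (𝕜 := ℝ)
        (fun z hz => (hda q m z (hball z (hsub hz)).2).hasFDerivAt.hasFDerivWithinAt)
        hlip (Metric.mem_closedBall_self (norm_nonneg _))
        (mem_closedBall_iff_norm.2 le_rfl)
      refine h2.trans (le_of_eq ?_)
      ring
  have hcomp : ∀ m : ℕ, ∀ u ∈ U, ∀ q, (e q).compContinuousMultilinearMap
      (iteratedFDeriv ℝ m T u) = iteratedFDeriv ℝ m (fun u => e q (T u)) u := by
    intro m
    induction m with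
    | zero =>
      intro u hu q
      ext v
      simp
    | succ m ih =>
      intro u hu q
      obtain ⟨L, hL, hL'⟩ := hstep m ih u hu
      rw [iteratedFDeriv_succ_eq_comp_left, iteratedFDeriv_succ_eq_comp_left,
        Function.comp_apply, Function.comp_apply, hL.fderiv, ← hL' q]
      ext v
      rfl
  refine contDiffOn_of_differentiableOn (n := (⊤ : ℕ∞)) fun m _ => ?_
  refine DifferentiableOn.congr (f := iteratedFDeriv ℝ m T) (fun u hu => ?_)
    fun u hu => iteratedFDerivWithin_of_isOpen m hU hu
  obtain ⟨L, hL, -⟩ := hstep m (hcomp m) u hu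
  exact hL.differentiableAt.differentiableWithinAt

end WeakSmoothness

/-- Uniform limits of derivatives within a convex set. Mathlib has this on open sets; convex sets that
need not be open occur in charts at the boundary of a manifold. -/
theorem hasFDerivWithinAt_of_tendstoUniformlyOn {X F : Type*} [NormedAddCommGroup X]
    [NormedSpace ℝ X] [NormedAddCommGroup F] [NormedSpace ℝ F] {s : Set X} (hs : Convex ℝ s)
    {f : ℕ → X → F} {f' : ℕ → X → X →L[ℝ] F} {g : X → F} {g' : X → X →L[ℝ] F}
    (hf : ∀ n, ∀ x ∈ s, HasFDerivWithinAt (f n) (f' n x) s x)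
    (hfg : ∀ x ∈ s, Filter.Tendsto (fun n => f n x) Filter.atTop (𝓝 (g x)))
    (hf' : TendstoUniformlyOn f' g' Filter.atTop s) {x : X} (hx : x ∈ s) :
    HasFDerivWithinAt g (g' x) s x := by
  rw [hasFDerivWithinAt_iff_isLittleO, Asymptotics.isLittleO_iff]
  intro ε hε
  obtain ⟨N, hN⟩ := Filter.eventually_atTop.1
    (Metric.tendstoUniformlyOn_iff.1 hf' (ε / 4) (by positivity))
  have h1 := (hasFDerivWithinAt_iff_isLittleO.1 (hf N x hx))
  rw [Asymptotics.isLittleO_iff] at h1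
  filter_upwards [h1 (show (0 : ℝ) < ε / 4 by positivity), self_mem_nhdsWithin] with y hy hys
  have h2 : ‖(g y - f N y) - (g x - f N x)‖ ≤ ε / 2 * ‖y - x‖ := by
    have h3 : ∀ n, N ≤ n → ‖(f n y - f N y) - (f n x - f N x)‖ ≤ ε / 2 * ‖y - x‖ := by
      intro n hn
      refine hs.norm_image_sub_le_of_norm_hasFDerivWithin_le (f := fun z => f n z - f N z)
        (fun z hz => (hf n z hz).sub (hf N z hz)) (fun z hz => ?_) hx hys
      have h4 := hN n hn z hz
      have h5 := hN N le_rfl z hz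
      rw [← dist_eq_norm]
      calc dist (f' n z) (f' N z) ≤ dist (g' z) (f' n z) + dist (g' z) (f' N z) :=
            dist_triangle_left _ _ _
        _ ≤ ε / 2 := by linarith
    refine le_of_tendsto ((((hfg y hys).sub_const _).sub ((hfg x hx).sub_const _)).norm) ?_
    exact Filter.eventually_atTop.2 ⟨N, h3⟩
  have h6 : ‖(f' N x - g' x) (y - x)‖ ≤ ε / 4 * ‖y - x‖ := by
    refine ContinuousLinearMap.le_of_opNorm_le _ ?_ _
    rw [← dist_eq_norm, dist_comm]
    exact (hN N le_rfl x hx).le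
  calc ‖g y - g x - g' x (y - x)‖
      = ‖((g y - f N y) - (g x - f N x)) + (f N y - f N x - f' N x (y - x)) +
          (f' N x - g' x) (y - x)‖ := by
        congr 1
        rw [_root_.sub_apply]
        abel
    _ ≤ _ := norm_add₃_le
    _ ≤ ε / 2 * ‖y - x‖ + ε / 4 * ‖y - x‖ + ε / 4 * ‖y - x‖ := by gcongr
    _ = ε * ‖y - x‖ := by ring

/-! ### Smooth maps and connections on Banach manifolds -/

namespace BanachManifold

universe u₁ v₁ w₁ u₂ v₂ w₂ u₃ v₃ w₃

section

variable {X : Type u₁} (A : BanachManifold.{u₁, v₁, w₁} X)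

theorem fderiv_trans_coord {x : X} {i j : A.ι} (hi : x ∈ (A.chart i).source)
    (hj : x ∈ (A.chart j).source) (v : A.Tangent x) :
    fderiv ℝ (A.trans i j) (A.chart i x) (coord i v) = coord j v := by
  simpa [coord, hi, hj] using v.2 ⟨i, hi⟩ ⟨j, hj⟩

variable {A}

theorem coord_injective {x : X} {i : A.ι} (hi : x ∈ (A.chart i).source) {v w : A.Tangent x}
    (h : coord i v = coord i w) : v = w := by
  rw [← A.ofCoord_coord hi v, h, A.ofCoord_coord hi w]

theorem coord_add (i : A.ι) {x : X} (v w : A.Tangent x) :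
    coord i (v + w) = coord i v + coord i w := by
  unfold coord
  split_ifs <;> simp

theorem coord_smul (i : A.ι) {x : X} (c : ℝ) (v : A.Tangent x) :
    coord i (c • v) = c • coord i v := by
  unfold coord
  split_ifs <;> simp

theorem coord_zero (i : A.ι) {x : X} : coord i (0 : A.Tangent x) = 0 := by
  simpa using coord_smul i 0 (0 : A.Tangent x)

theorem ofCoord_add (i : A.ι) (x : X) (v w : A.model i) :
    A.ofCoord i x (v + w) = A.ofCoord i x v + A.ofCoord i x w := by
  by_cases h : x ∈ (A.chart i).source
  · refine coord_injective h ?_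
    rw [coord_add, A.coord_ofCoord_self h, A.coord_ofCoord_self h, A.coord_ofCoord_self h]
  · simp [ofCoord, h]

theorem ofCoord_smul (i : A.ι) (x : X) (c : ℝ) (v : A.model i) :
    A.ofCoord i x (c • v) = c • A.ofCoord i x v := by
  by_cases h : x ∈ (A.chart i).source
  · refine coord_injective h ?_
    rw [coord_smul, A.coord_ofCoord_self h, A.coord_ofCoord_self h]
  · simp [ofCoord, h]

theorem TBundle.ext_coord {e e' : A.TBundle} {i : A.ι} (h : e.1 = e'.1)
    (hi : e.1 ∈ (A.chart i).source) (hc : coord i e.2 = coord i e'.2) : e = e' := by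
  obtain ⟨x, v⟩ := e
  obtain ⟨x', v'⟩ := e'
  obtain rfl : x = x' := h
  exact congrArg (Sigma.mk x) (coord_injective hi hc)

theorem isOpen_target (i : A.ι) : IsOpen (A.chart i).target := by
  have h := A.isSmoothAtlas.isOpen_overlap i i
  have h2 : A.overlap i i = (A.chart i).target :=
    Set.inter_eq_left.2 fun z hz => (A.chart i).map_target hz
  rwa [h2] at h

end

section Maps

variable {X : Type u₁} {Y : Type u₂} {Z : Type u₃} (A : BanachManifold.{u₁, v₁, w₁} X)
  (B : BanachManifold.{u₂, v₂, w₂} Y) (C : BanachManifold.{u₃, v₃, w₃} Z)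

/-- The representation of a map `f` in the charts `i` and `j`. -/
def rep (i : A.ι) (j : B.ι) (f : X → Y) : A.model i → B.model j :=
  B.chart j ∘ f ∘ (A.chart i).symm

/-- The domain of the representation of a map `f` in the charts `i` and `j`. -/
def repDomain (i : A.ι) (j : B.ι) (f : X → Y) : Set (A.model i) :=
  (A.chart i).target ∩ (A.chart i).symm ⁻¹' (f ⁻¹' (B.chart j).source)

variable {A B C} {f : X → Y} {g : Y → Z} {x : X}

theorem mem_repDomain {i : A.ι} {j : B.ι} (hi : x ∈ (A.chart i).source)
    (hj : f x ∈ (B.chart j).source) : A.chart i x ∈ repDomain A B i j f :=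
  ⟨(A.chart i).map_source hi, by simpa [(A.chart i).left_inv hi] using hj⟩

theorem rep_apply {i : A.ι} (j : B.ι) (hi : x ∈ (A.chart i).source) :
    rep A B i j f (A.chart i x) = B.chart j (f x) := by
  simp [rep, (A.chart i).left_inv hi]

theorem IsSmooth.isOpen_repDomain (hf : IsSmooth A B f) (i : A.ι) (j : B.ι) :
    IsOpen (repDomain A B i j f) := (hf i j).1

theorem IsSmooth.contDiffOn_rep (hf : IsSmooth A B f) (i : A.ι) (j : B.ι) :
    ContDiffOn ℝ ∞ (rep A B i j f) (repDomain A B i j f) := (hf i j).2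

theorem IsSmooth.contDiffAt_rep (hf : IsSmooth A B f) {i : A.ι} {j : B.ι}
    (hi : x ∈ (A.chart i).source) (hj : f x ∈ (B.chart j).source) :
    ContDiffAt ℝ ∞ (rep A B i j f) (A.chart i x) :=
  (hf.contDiffOn_rep i j).contDiffAt ((hf.isOpen_repDomain i j).mem_nhds (mem_repDomain hi hj))

theorem IsSmooth.differentiableAt_rep (hf : IsSmooth A B f) {i : A.ι} {j : B.ι}
    (hi : x ∈ (A.chart i).source) (hj : f x ∈ (B.chart j).source) :
    DifferentiableAt ℝ (rep A B i j f) (A.chart i x) :=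
  (hf.contDiffAt_rep hi hj).differentiableAt (by simp)

theorem mem_chartIdx (x : X) : x ∈ (A.chart (A.chartIdx x)).source :=
  (A.isSmoothAtlas.cover x).choose_spec

/-- The chain rule for representations in charts. -/
theorem IsSmooth.fderiv_rep_comp (hf : IsSmooth A B f) (hg : IsSmooth B C g) {i : A.ι} {j : B.ι}
    {k : C.ι} (hi : x ∈ (A.chart i).source) (hj : f x ∈ (B.chart j).source)
    (hk : g (f x) ∈ (C.chart k).source) :
    fderiv ℝ (rep A C i k (g ∘ f)) (A.chart i x) =
      (fderiv ℝ (rep B C j k g) (B.chart j (f x))).comp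
        (fderiv ℝ (rep A B i j f) (A.chart i x)) := by
  have h2 := hg.differentiableAt_rep hj hk
  rw [← rep_apply j hi] at h2 ⊢
  rw [← fderiv_comp _ h2 (hf.differentiableAt_rep hi hj)]
  refine Filter.EventuallyEq.fderiv_eq ?_
  filter_upwards [(hf.isOpen_repDomain i j).mem_nhds (mem_repDomain hi hj)] with z hz
  simp only [rep, Function.comp_apply]
  rw [(B.chart j).left_inv hz.2]

theorem isSmooth_id : IsSmooth A A id := fun i j =>
  ⟨A.isSmoothAtlas.isOpen_overlap i j, A.isSmoothAtlas.contDiffOn_trans i j⟩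

/-- The differential of a smooth map, in arbitrary charts. -/
theorem IsSmooth.coord_dmap (hf : IsSmooth A B f) {i : A.ι} {j : B.ι}
    (hi : x ∈ (A.chart i).source) (hj : f x ∈ (B.chart j).source) (v : A.Tangent x) :
    coord j (dmap A B f x v) = fderiv ℝ (rep A B i j f) (A.chart i x) (coord i v) := by
  have hi₀ := mem_chartIdx (A := A) x
  have hj₀ := mem_chartIdx (A := B) (f x)
  have h1 := hf.fderiv_rep_comp isSmooth_id (k := j) hi₀ hj₀ hj
  have h2 := isSmooth_id.fderiv_rep_comp hf (k := j) hi hi₀ hj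
  have h3 : fderiv ℝ (rep A A i (A.chartIdx x) id) (A.chart i x) (coord i v) =
      coord (A.chartIdx x) v := A.fderiv_trans_coord hi hi₀ v
  rw [dmap, B.coord_ofCoord hj₀ hj]
  change _ = fderiv ℝ (rep A B i j (f ∘ id)) (A.chart i x) (coord i v)
  rw [h2, ContinuousLinearMap.comp_apply, h3]
  exact congrArg (fun L => L (coord (A.chartIdx x) v)) h1.symm

theorem tmap_comp (hf : IsSmooth A B f) (hg : IsSmooth B C g) (e : A.TBundle) :
    tmap A C (g ∘ f) e = tmap B C g (tmap A B f e) := by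
  obtain ⟨x, v⟩ := e
  have hi := mem_chartIdx (A := A) x
  have hj := mem_chartIdx (A := B) (f x)
  have hk := mem_chartIdx (A := C) (g (f x))
  refine TBundle.ext_coord (i := C.chartIdx (g (f x))) rfl hk ?_
  change coord _ (dmap A C (g ∘ f) x v) = coord _ (dmap B C g (f x) (dmap A B f x v))
  rw [hg.coord_dmap hj hk, hf.coord_dmap hi hj]
  refine (C.coord_ofCoord_self hk _).trans ?_
  exact congrArg (fun L => L (coord (A.chartIdx x) v)) (hf.fderiv_rep_comp hg hi hj hk)

theorem repDomain_tmap (i : A.ι) (j : B.ι) :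
    repDomain A.tangent B.tangent i j (tmap A B f) =
      repDomain A B i j f ×ˢ (Set.univ : Set (A.model i)) := by
  ext ⟨z, w⟩
  change ((z ∈ (A.chart i).target ∧ w ∈ Set.univ) ∧ _) ↔ (_ ∧ _) ∧ _
  exact ⟨fun h => ⟨⟨h.1.1, h.2⟩, h.1.2⟩, fun h => ⟨⟨h.1.1, h.2⟩, h.1.2⟩⟩

theorem IsSmooth.rep_tmap (hf : IsSmooth A B f) {i : A.ι} {j : B.ι} {z : A.model i}
    (hz : z ∈ repDomain A B i j f) (w : A.model i) :
    rep A.tangent B.tangent i j (tmap A B f) (z, w) =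
      (rep A B i j f z, fderiv ℝ (rep A B i j f) z w) := by
  refine Prod.ext rfl ?_
  change coord j (dmap A B f ((A.chart i).symm z) (A.ofCoord i _ w)) = _
  have hx := (A.chart i).map_target hz.1
  rw [hf.coord_dmap hx hz.2, A.coord_ofCoord_self hx, (A.chart i).right_inv hz.1]

theorem IsSmooth.tmap (hf : IsSmooth A B f) : IsSmooth A.tangent B.tangent (tmap A B f) := by
  intro (i : A.ι) (j : B.ι)
  let S : Set (A.model i × A.model i) :=
    repDomain A.tangent B.tangent i j (BanachManifold.tmap A B f)
  let G : A.model i × A.model i → B.model j × B.model j :=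
    rep A.tangent B.tangent i j (BanachManifold.tmap A B f)
  suffices h : IsOpen S ∧ ContDiffOn ℝ ∞ G S from h
  have hS : S = repDomain A B i j f ×ˢ (Set.univ : Set (A.model i)) := repDomain_tmap i j
  rw [hS]
  have ho := hf.isOpen_repDomain i j
  have hs := hf.contDiffOn_rep i j
  refine ⟨ho.prod isOpen_univ, ?_⟩
  have h : ContDiffOn ℝ ∞ (fun z : A.model i × A.model i =>
      (rep A B i j f z.1, fderiv ℝ (rep A B i j f) z.1 z.2))
      (repDomain A B i j f ×ˢ Set.univ) := by
    refine ContDiffOn.prodMk (hs.comp contDiffOn_fst fun z hz => hz.1) ?_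
    refine ContDiffOn.clm_apply ?_ contDiffOn_snd
    exact (hs.fderiv_of_isOpen ho (by simp)).comp contDiffOn_fst fun z hz => hz.1
  exact h.congr fun z hz => hf.rep_tmap hz.1 z.2

/-- The coordinates of a vector tangent to the tangent bundle, in the chart induced by `i`. -/
noncomputable def dcoord (i : A.ι) {e : A.TBundle} (η : A.tangent.Tangent e) : A.model i × A.model i :=
  coord (A := A.tangent) i η

theorem dcoord_add (i : A.ι) {e : A.TBundle} (η η' : A.tangent.Tangent e) :
    dcoord i (η + η') = dcoord i η + dcoord i η' := coord_add (A := A.tangent) i η η'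

theorem dcoord_smul (i : A.ι) {e : A.TBundle} (c : ℝ) (η : A.tangent.Tangent e) :
    dcoord i (c • η) = c • dcoord i η := coord_smul (A := A.tangent) i c η

variable (A) in
/-- The vector tangent to the tangent bundle with given coordinates. -/
noncomputable def ofDcoord (i : A.ι) (e : A.TBundle) (w : A.model i × A.model i) : A.tangent.Tangent e :=
  A.tangent.ofCoord i e w

theorem dcoord_ofDcoord {i : A.ι} {e : A.TBundle} (hi : e.1 ∈ (A.chart i).source)
    (w : A.model i × A.model i) : dcoord i (A.ofDcoord i e w) = w :=
  A.tangent.coord_ofCoord_self (x := e) hi w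

theorem IsChristoffel.coord_eq {P : A.tangent.TBundle → A.TBundle} {i : A.ι}
    {Γ : A.model i → A.model i →L[ℝ] A.model i →L[ℝ] A.model i} (hΓ : A.IsChristoffel P i Γ)
    (e : A.TBundle) (η : A.tangent.Tangent e) (hi : e.1 ∈ (A.chart i).source) :
    coord i (P ⟨e, η⟩).2 =
      (dcoord i η).2 + Γ (A.chart i e.1) (dcoord i η).1 (coord i e.2) := hΓ.eq e η hi

/-- The coordinates, in the induced charts, of the second differential of a smooth map. -/
theorem IsSmooth.coord_dmap_tmap (hf : IsSmooth A B f) {i : A.ι} {j : B.ι} {e : A.TBundle}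
    (hi : e.1 ∈ (A.chart i).source) (hj : f e.1 ∈ (B.chart j).source) (η : A.tangent.Tangent e) :
    dcoord j (dmap A.tangent B.tangent (BanachManifold.tmap A B f) e η) =
      ((fderiv ℝ (rep A B i j f) (A.chart i e.1) (dcoord i η).1,
        fderiv ℝ (fderiv ℝ (rep A B i j f)) (A.chart i e.1) (dcoord i η).1
          (coord i e.2) +
        fderiv ℝ (rep A B i j f) (A.chart i e.1) (dcoord i η).2) :
        B.model j × B.model j) := by
  have h1 := hf.tmap.coord_dmap (i := i) (j := j) (x := e) hi hj η
  set ψ := rep A B i j f with hψ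
  have hz : A.chart i e.1 ∈ repDomain A B i j f := mem_repDomain hi hj
  let G : A.model i × A.model i → B.model j × B.model j :=
    rep A.tangent B.tangent i j (BanachManifold.tmap A B f)
  have h2 : fderiv ℝ G (A.chart i e.1, coord i e.2) = fderiv ℝ (fun z : A.model i × A.model i =>
        (ψ z.1, fderiv ℝ ψ z.1 z.2)) (A.chart i e.1, coord i e.2) := by
    refine Filter.EventuallyEq.fderiv_eq ?_
    have : IsOpen (repDomain A B i j f ×ˢ (Set.univ : Set (A.model i))) :=
      (hf.isOpen_repDomain i j).prod isOpen_univ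
    filter_upwards [this.mem_nhds (x := (A.chart i e.1, coord i e.2)) ⟨hz, trivial⟩] with z hz
    exact hf.rep_tmap hz.1 z.2
  have hψ1 : HasFDerivAt ψ (fderiv ℝ ψ (A.chart i e.1)) (A.chart i e.1) :=
    (hf.differentiableAt_rep hi hj).hasFDerivAt
  have hψ2 : HasFDerivAt (fderiv ℝ ψ) (fderiv ℝ (fderiv ℝ ψ) (A.chart i e.1)) (A.chart i e.1) :=
    (((hf.contDiffAt_rep hi hj).fderiv_right (m := 1) (by norm_cast)).differentiableAt
      (by simp)).hasFDerivAt
  have h31 : HasFDerivAt (fun z : A.model i × A.model i => ψ z.1) _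
      (A.chart i e.1, coord i e.2) :=
    HasFDerivAt.comp (g := ψ) (f := Prod.fst) (A.chart i e.1, coord i e.2) hψ1 hasFDerivAt_fst
  have h32 : HasFDerivAt (fun z : A.model i × A.model i => fderiv ℝ ψ z.1) _
      (A.chart i e.1, coord i e.2) :=
    HasFDerivAt.comp (g := fderiv ℝ ψ) (f := Prod.fst) (A.chart i e.1, coord i e.2) hψ2
      hasFDerivAt_fst
  have h3 := h31.prodMk (h32.clm_apply hasFDerivAt_snd)
  have h4 : fderiv ℝ (fun z : A.model i × A.model i =>
        (ψ z.1, fderiv ℝ ψ z.1 z.2)) (A.chart i e.1, coord i e.2) = _ := h3.fderiv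
  refine h1.trans ?_
  refine (congrArg (fun L => L (dcoord i η)) (h2.trans h4)).trans ?_
  refine Prod.ext rfl ?_
  exact add_comm _ _

end Maps

section Connections

variable {X : Type u₁} {A : BanachManifold.{u₁, v₁, w₁} X} {P : A.tangent.TBundle → A.TBundle}

theorem IsConnection.fst (hP : A.IsConnection P) (η : A.tangent.TBundle) : (P η).1 = η.1.1 := by
  obtain ⟨L, hL⟩ := hP.linear η.1
  rw [show P η = _ from hL η.2]

/-- The smoothness and the fibrewise linearity required of a connection follow from the existence of
Christoffel symbols, since `P` is in charts the map `((z, w), (a, b)) ↦ (z, b + Γ z a w)`. -/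
theorem isConnection_of_christoffel (h1 : ∀ η, (P η).1 = η.1.1)
    (h2 : ∀ i, ∃ Γ, A.IsChristoffel P i Γ) : A.IsConnection P := by
  refine ⟨?_, ?_, h2⟩
  · intro (i : A.ι) (j : A.ι)
    obtain ⟨Γ, hΓ⟩ := h2 i
    let S : Set ((A.model i × A.model i) × (A.model i × A.model i)) :=
      repDomain A.tangent.tangent A.tangent i j P
    let G : (A.model i × A.model i) × (A.model i × A.model i) → A.model j × A.model j :=
      rep A.tangent.tangent A.tangent i j P
    suffices h : IsOpen S ∧ ContDiffOn ℝ ∞ G S from h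
    have hdom : S =
        {z : (A.model i × A.model i) × (A.model i × A.model i) | z.1.1 ∈ A.overlap i j} := by
      ext ⟨⟨z, w⟩, a⟩
      change (((z ∈ (A.chart i).target ∧ w ∈ Set.univ) ∧ a ∈ Set.univ) ∧
        (P _).1 ∈ (A.chart j).source) ↔ (z ∈ (A.chart i).target ∧ _)
      rw [h1]
      exact ⟨fun h => ⟨h.1.1.1, h.2⟩, fun h => ⟨⟨⟨h.1, trivial⟩, trivial⟩, h.2⟩⟩
    rw [hdom]
    refine ⟨(A.isSmoothAtlas.isOpen_overlap i j).preimage (continuous_fst.comp continuous_fst), ?_⟩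
    let τ : A.model i × A.model i → A.model j × A.model j := A.tangentAtlas.trans i j
    have hs : ContDiffOn ℝ ∞ τ (A.overlap i j ×ˢ (Set.univ : Set (A.model i))) := by
      have := A.isSmoothAtlas_tangentAtlas.contDiffOn_trans i j
      rwa [A.tangentAtlas_overlap i j] at this
    have hloc : ContDiffOn ℝ ∞ (fun z : (A.model i × A.model i) × (A.model i × A.model i) =>
        (z.1.1, z.2.2 + Γ z.1.1 z.2.1 z.1.2)) {z | z.1.1 ∈ A.overlap i j} := by
      have h11 : ContDiff ℝ ∞ fun z : (A.model i × A.model i) × (A.model i × A.model i) => z.1.1 :=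
        contDiff_fst.comp contDiff_fst
      refine ContDiffOn.prodMk h11.contDiffOn (ContDiffOn.add
        (contDiff_snd.comp contDiff_snd).contDiffOn ?_)
      exact ((hΓ.smooth.comp h11.contDiffOn fun z hz => hz.1).clm_apply
        (contDiff_fst.comp contDiff_snd).contDiffOn).clm_apply
        (contDiff_snd.comp contDiff_fst).contDiffOn
    have h := hs.comp (s := {z : (A.model i × A.model i) × (A.model i × A.model i) |
      z.1.1 ∈ A.overlap i j}) hloc (fun z hz => ⟨hz, trivial⟩)
    refine ContDiffOn.congr h ?_
    rintro ⟨⟨z, w⟩, ⟨a, b⟩⟩ (hz : z ∈ A.overlap i j)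
    have hx := (A.chart i).map_target hz.1
    -- the point of the second tangent bundle with the given coordinates
    let e : A.TBundle := ⟨(A.chart i).symm z, A.ofCoord i _ w⟩
    let η : A.tangent.Tangent e := A.ofDcoord i e (a, b)
    have hη : dcoord i η = (a, b) := dcoord_ofDcoord (e := e) hx (a, b)
    have he : coord i e.2 = w := A.coord_ofCoord_self hx w
    have hp := hΓ.coord_eq e η hx
    rw [hη, he, (A.chart i).right_inv hz.1] at hp
    have hb := h1 ⟨e, η⟩
    change A.tangent.chart j (P ⟨e, η⟩) = A.tangent.chart j
      ((A.tangent.chart i).symm (z, b + Γ z a w))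
    congr 1
    refine TBundle.ext_coord (i := i) hb (by rw [hb]; exact hx) ?_
    rw [hp]
    exact (A.coord_ofCoord_self hx _).symm
  · intro e
    obtain ⟨i, hi⟩ := A.isSmoothAtlas.cover e.1
    obtain ⟨Γ, hΓ⟩ := h2 i
    refine ⟨{ toFun := fun η => A.ofCoord i e.1 (coord i (P ⟨e, η⟩).2)
              map_add' := fun η η' => ?_
              map_smul' := fun c η => ?_ }, fun η => ?_⟩
    · rw [hΓ.coord_eq e _ hi, hΓ.coord_eq e _ hi, hΓ.coord_eq e _ hi, dcoord_add, ← ofCoord_add]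
      congr 1
      rw [Prod.fst_add, Prod.snd_add, map_add, _root_.add_apply]
      abel
    · rw [hΓ.coord_eq e _ hi, hΓ.coord_eq e _ hi, dcoord_smul, RingHom.id_apply, ← ofCoord_smul]
      congr 1
      rw [Prod.smul_fst, Prod.smul_snd, map_smul, _root_.smul_apply, smul_add]
    · have hb := h1 ⟨e, η⟩
      refine TBundle.ext_coord (i := i) hb (by rw [hb]; exact hi) ?_
      exact (A.coord_ofCoord_self hi _).symm

variable {Y : Type u₂} {B : BanachManifold.{u₂, v₂, w₂} Y} {P' : B.tangent.TBundle → B.TBundle}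
  {f : X → Y}

/-- The condition for being affine, at a given vector tangent to the tangent bundle, is the
transformation law of the Christoffel symbols. The second component of the vector does not enter. -/
theorem affine_iff_christoffel (hf : IsSmooth A B f) (hP : A.IsConnection P)
    (hP' : B.IsConnection P') {i : A.ι} {j : B.ι} {Γ Γ'} (hΓ : A.IsChristoffel P i Γ)
    (hΓ' : B.IsChristoffel P' j Γ') (η : A.tangent.TBundle) (hi : η.1.1 ∈ (A.chart i).source)
    (hj : f η.1.1 ∈ (B.chart j).source) :
    P' (tmap A.tangent B.tangent (tmap A B f) η) = tmap A B f (P η) ↔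
      fderiv ℝ (fderiv ℝ (rep A B i j f)) (A.chart i η.1.1) (dcoord i η.2).1
          (coord i η.1.2) +
        Γ' (B.chart j (f η.1.1))
          (fderiv ℝ (rep A B i j f) (A.chart i η.1.1) (dcoord i η.2).1)
          (fderiv ℝ (rep A B i j f) (A.chart i η.1.1) (coord i η.1.2)) =
      fderiv ℝ (rep A B i j f) (A.chart i η.1.1)
        (Γ (A.chart i η.1.1) (dcoord i η.2).1 (coord i η.1.2)) := by
  obtain ⟨e, η⟩ := η
  have hb := hP.fst ⟨e, η⟩
  have hb' := hP'.fst (tmap A.tangent B.tangent (tmap A B f) ⟨e, η⟩)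
  have h1 : coord j (P' (tmap A.tangent B.tangent (tmap A B f) ⟨e, η⟩)).2 = _ :=
    hΓ'.coord_eq (tmap A B f e) (dmap A.tangent B.tangent (tmap A B f) e η) hj
  rw [hf.coord_dmap_tmap hi hj η] at h1
  have h1' : coord j (tmap A B f e).2 = _ := hf.coord_dmap hi hj e.2
  rw [h1'] at h1
  have hbi : (P ⟨e, η⟩).1 ∈ (A.chart i).source := by rw [hb]; exact hi
  have hbj : f (P ⟨e, η⟩).1 ∈ (B.chart j).source := by rw [hb]; exact hj
  have h2 : coord j (tmap A B f (P ⟨e, η⟩)).2 = _ := hf.coord_dmap hbi hbj (P ⟨e, η⟩).2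
  rw [hΓ.coord_eq e η hi, hb, map_add] at h2
  have h3 : P' (tmap A.tangent B.tangent (tmap A B f) ⟨e, η⟩) = tmap A B f (P ⟨e, η⟩) ↔
      coord j (P' (tmap A.tangent B.tangent (tmap A B f) ⟨e, η⟩)).2 =
        coord j (tmap A B f (P ⟨e, η⟩)).2 := by
    refine ⟨fun h => by rw [h], fun h => TBundle.ext_coord (i := j) ?_ ?_ h⟩
    · rw [hb']
      exact congrArg f hb.symm
    · rw [hb']
      exact hj
  rw [h3, h1, h2]
  constructor
  · intro h
    refine add_left_cancel (a := fderiv ℝ (rep A B i j f) (A.chart i e.1)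
      (dcoord i η).2) (Eq.trans ?_ h)
    rw [← add_assoc, add_comm (fderiv ℝ (rep A B i j f) (A.chart i e.1) _)]
    rfl
  · intro h
    refine Eq.trans ?_ (congrArg (fun y => fderiv ℝ (rep A B i j f) (A.chart i e.1)
      (dcoord i η).2 + y) h)
    rw [← add_assoc, add_comm (fderiv ℝ (rep A B i j f) (A.chart i e.1) _)]
    rfl

end Connections

end BanachManifold

/-! ### Isometries and Levi-Civita connections -/

namespace BanachManifold

universe u₁ v₁ w₁ u₂ v₂ w₂

variable {X : Type u₁} {A : BanachManifold.{u₁, v₁, w₁} X}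

namespace SemiRiemannianMetric

/-- The coefficients of a semi-Riemannian metric in a chart, as a bilinear form on the model
space. -/
noncomputable def coeff (g : A.SemiRiemannianMetric) (i : A.ι)
    [FiniteDimensional ℝ (A.model i)] (z : A.model i) :
    A.model i →L[ℝ] A.model i →L[ℝ] ℝ :=
  LinearMap.toContinuousLinearMap
    { toFun := fun v => LinearMap.toContinuousLinearMap
        { toFun := fun w => g.inner ((A.chart i).symm z) (A.ofCoord i _ v) (A.ofCoord i _ w)
          map_add' := fun w w' => by rw [ofCoord_add, map_add]
          map_smul' := fun c w => by rw [ofCoord_smul, map_smul]; rfl }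
      map_add' := fun v v' => by
        ext w
        simp [ofCoord_add]
      map_smul' := fun c v => by
        ext w
        simp [ofCoord_smul] }

theorem coeff_apply (g : A.SemiRiemannianMetric) (i : A.ι) [FiniteDimensional ℝ (A.model i)]
    (z v w : A.model i) :
    g.coeff i z v w = g.inner ((A.chart i).symm z) (A.ofCoord i _ v) (A.ofCoord i _ w) := rfl

theorem coeff_symm (g : A.SemiRiemannianMetric) (i : A.ι) [FiniteDimensional ℝ (A.model i)]
    (z v w : A.model i) : g.coeff i z v w = g.coeff i z w v := g.symm _ _ _

theorem contDiffOn_coeff (g : A.SemiRiemannianMetric) (i : A.ι) [FiniteDimensional ℝ (A.model i)] :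
    ContDiffOn ℝ ∞ (g.coeff i) (A.chart i).target :=
  contDiffOn_clm_apply.2 fun v => contDiffOn_clm_apply.2 fun w => g.smooth i v w

theorem coeff_nondegenerate (g : A.SemiRiemannianMetric) {i : A.ι}
    [FiniteDimensional ℝ (A.model i)] {z v : A.model i} (hz : z ∈ (A.chart i).target)
    (h : ∀ w, g.coeff i z v w = 0) : v = 0 := by
  have hx := (A.chart i).map_target hz
  have h1 : A.ofCoord i ((A.chart i).symm z) v = 0 := g.nondegenerate _ _ fun w => by
    rw [← A.ofCoord_coord hx w]
    exact h _
  rw [← A.coord_ofCoord_self hx v, h1, coord_zero]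

end SemiRiemannianMetric

/-- The braid argument behind the uniqueness of the Levi-Civita connection: an expression which is
symmetric in the first two and skew in the last two arguments vanishes. -/
theorem eq_zero_of_symm_of_skew {V : Type*} (T : V → V → V → ℝ) (h1 : ∀ u v w, T u v w = T v u w)
    (h2 : ∀ u v w, T u v w = -T u w v) (u v w : V) : T u v w = 0 := by
  have e1 := h2 u v w
  have e2 := h1 u w v
  have e3 := h2 w u v
  have e4 := h1 w v u
  have e5 := h2 v w u
  have e6 := h1 v u w
  linarith

variable {Y : Type u₂} {B : BanachManifold.{u₂, v₂, w₂} Y} {f : X → Y}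
  {P : A.tangent.TBundle → A.TBundle} {P' : B.tangent.TBundle → B.TBundle}

/-- The coefficients of a metric which is preserved by `f`, as a pull-back. -/
theorem PreservesMetric.coeff_eq {g : A.SemiRiemannianMetric} {g' : B.SemiRiemannianMetric}
    (hg : PreservesMetric g g' f) (hf : IsSmooth A B f) {i : A.ι} {j : B.ι}
    [FiniteDimensional ℝ (A.model i)] [FiniteDimensional ℝ (B.model j)] {z : A.model i}
    (hz : z ∈ repDomain A B i j f) (v w : A.model i) :
    g.coeff i z v w = g'.coeff j (rep A B i j f z) (fderiv ℝ (rep A B i j f) z v)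
      (fderiv ℝ (rep A B i j f) z w) := by
  have hx := (A.chart i).map_target hz.1
  have hd : ∀ v, dmap A B f ((A.chart i).symm z) (A.ofCoord i _ v) =
      B.ofCoord j (f ((A.chart i).symm z)) (fderiv ℝ (rep A B i j f) z v) := by
    intro v
    refine coord_injective hz.2 ?_
    rw [hf.coord_dmap hx hz.2, A.coord_ofCoord_self hx, (A.chart i).right_inv hz.1]
    exact (B.coord_ofCoord_self hz.2 _).symm
  have h1 := hg ((A.chart i).symm z) (A.ofCoord i _ v) (A.ofCoord i _ w)
  rw [hd, hd] at h1
  rw [g.coeff_apply, ← h1, g'.coeff_apply]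
  have key : ∀ y y' : Y, y = y' → ∀ a b, g'.inner y (B.ofCoord j y a) (B.ofCoord j y b) =
      g'.inner y' (B.ofCoord j y' a) (B.ofCoord j y' b) := by
    rintro y _ rfl a b
    rfl
  exact key _ _ ((B.chart j).left_inv hz.2).symm _ _

/-- Uniqueness of the Levi-Civita connection: a metric preserving submersion `f` maps the
Levi-Civita connection to the Levi-Civita connection. The defect `S` of the transformation law of
the Christoffel symbols is symmetric because both connections are torsion-free, and pairs to a form
which is skew in the last two arguments because both metrics are parallel. -/
theorem isAffine_of_preservesMetric [∀ i, FiniteDimensional ℝ (A.model i)]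
    [∀ j, FiniteDimensional ℝ (B.model j)] {g : A.SemiRiemannianMetric}
    {g' : B.SemiRiemannianMetric} (hP : A.IsLeviCivita g P) (hP' : B.IsLeviCivita g' P')
    (hf : IsSmooth A B f) (hsurj : ∀ x i j, x ∈ (A.chart i).source → f x ∈ (B.chart j).source →
      Function.Surjective (fderiv ℝ (rep A B i j f) (A.chart i x)))
    (hg : PreservesMetric g g' f) : IsAffine A B P P' f := by
  refine ⟨hf, fun η => ?_⟩
  obtain ⟨i, hi⟩ := A.isSmoothAtlas.cover η.1.1
  obtain ⟨j, hj⟩ := B.isSmoothAtlas.cover (f η.1.1)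
  obtain ⟨Γ, hΓ⟩ := hP.1.christoffel i
  obtain ⟨Γ', hΓ'⟩ := hP'.1.christoffel j
  rw [affine_iff_christoffel hf hP.1 hP'.1 hΓ hΓ' η hi hj]
  generalize (dcoord i η.2).1 = u₀
  generalize coord i η.1.2 = v₀
  have hz : A.chart i η.1.1 ∈ repDomain A B i j f := mem_repDomain hi hj
  have hD := hsurj _ i j hi hj
  rw [← rep_apply j hi]
  generalize A.chart i η.1.1 = z at hz hD ⊢
  set ψ := rep A B i j f with hψdef
  have ho := hf.isOpen_repDomain i j
  have hψ : ContDiffAt ℝ ∞ ψ z := (hf.contDiffOn_rep i j).contDiffAt (ho.mem_nhds hz)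
  have hψ1 : HasFDerivAt ψ (fderiv ℝ ψ z) z := (hψ.differentiableAt (by simp)).hasFDerivAt
  have hψ2 : HasFDerivAt (fderiv ℝ ψ) (fderiv ℝ (fderiv ℝ ψ) z) z :=
    ((hψ.fderiv_right (m := 1) (by norm_cast)).differentiableAt (by simp)).hasFDerivAt
  have hsymm : ∀ u v, fderiv ℝ (fderiv ℝ ψ) z u v = fderiv ℝ (fderiv ℝ ψ) z v u := fun u v =>
    (hψ.isSymmSndFDerivAt (by
      rw [minSmoothness_of_isRCLikeNormedField]
      norm_cast)).eq u v
  have hψz : ψ z ∈ (B.chart j).target := (B.chart j).map_source hz.2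
  obtain ⟨hsym, hpar⟩ := hP.2 i Γ hΓ z hz.1
  obtain ⟨hsym', hpar'⟩ := hP'.2 j Γ' hΓ' (ψ z) hψz
  set D := fderiv ℝ ψ z with hDdef
  set D₂ := fderiv ℝ (fderiv ℝ ψ) z with hD₂def
  let S : A.model i → A.model i → B.model j := fun u v =>
    D (Γ z u v) - Γ' (ψ z) (D u) (D v) - D₂ u v
  -- differentiating the relation between the coefficients of the metrics
  have hG' : HasFDerivAt (g'.coeff j) (fderiv ℝ (g'.coeff j) (ψ z)) (ψ z) :=
    (((g'.contDiffOn_coeff j).contDiffAt ((isOpen_target j).mem_nhds hψz)).differentiableAt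
      (by simp)).hasFDerivAt
  have hskew : ∀ u v w, g'.coeff j (ψ z) (S u v) (D w) = -g'.coeff j (ψ z) (S u w) (D v) := by
    intro u v w
    have h1 := hpar u v w
    have h2 := hpar' (D u) (D v) (D w)
    have h3 : fderiv ℝ (fun y => g.inner ((A.chart i).symm y) (A.ofCoord i _ v)
        (A.ofCoord i _ w)) z = fderiv ℝ (fun y => g'.coeff j (ψ y) (fderiv ℝ ψ y v)
          (fderiv ℝ ψ y w)) z := by
      refine Filter.EventuallyEq.fderiv_eq ?_
      filter_upwards [ho.mem_nhds hz] with y hy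
      exact hg.coeff_eq hf hy v w
    have h4 : fderiv ℝ (fun y => g'.inner ((B.chart j).symm y) (B.ofCoord j _ (D v))
        (B.ofCoord j _ (D w))) (ψ z) (D u) = fderiv ℝ (g'.coeff j) (ψ z) (D u) (D v) (D w) := by
      have := (hG'.clm_apply (hasFDerivAt_const (D v) (ψ z))).clm_apply
        (hasFDerivAt_const (D w) (ψ z))
      have h5 : fderiv ℝ (fun y => g'.coeff j y (D v) (D w)) (ψ z) (D u) =
          fderiv ℝ (g'.coeff j) (ψ z) (D u) (D v) (D w) := by
        rw [this.fderiv]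
        simp
      exact h5
    have h6 : fderiv ℝ (fun y => g'.coeff j (ψ y) (fderiv ℝ ψ y v) (fderiv ℝ ψ y w)) z u =
        fderiv ℝ (g'.coeff j) (ψ z) (D u) (D v) (D w) + g'.coeff j (ψ z) (D₂ u v) (D w) +
          g'.coeff j (ψ z) (D v) (D₂ u w) := by
      have hc : HasFDerivAt (fun y => g'.coeff j (ψ y)) _ z :=
        HasFDerivAt.comp (g := g'.coeff j) (f := ψ) z hG' hψ1
      have := (hc.clm_apply (hψ2.clm_apply (hasFDerivAt_const v z))).clm_apply
        (hψ2.clm_apply (hasFDerivAt_const w z))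
      rw [this.fderiv]
      simp
      ring
    rw [h3, h6, ← h4, h2, ← g.coeff_apply, ← g.coeff_apply, hg.coeff_eq hf hz,
      hg.coeff_eq hf hz, ← g'.coeff_apply, ← g'.coeff_apply] at h1
    simp only [S, map_sub, _root_.sub_apply]
    rw [g'.coeff_symm j (ψ z) (D v) (D₂ u w), g'.coeff_symm j (ψ z) (D v) (Γ' (ψ z) (D u) (D w))]
      at h1
    change _ = g'.coeff j (ψ z) (D (Γ z u v)) (D w) + g'.coeff j (ψ z) (D v) (D (Γ z u w)) at h1
    rw [g'.coeff_symm j (ψ z) (D v) (D (Γ z u w))] at h1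
    linarith
  have hS : ∀ u v, S u v = S v u := fun u v => by
    simp only [S]
    rw [hsym u v, hsym' (D u) (D v), hsymm u v]
  have hzero := eq_zero_of_symm_of_skew (fun u v w => g'.coeff j (ψ z) (S u v) (D w))
    (fun u v w => by simp only [hS u v]) hskew
  have h0 : S u₀ v₀ = 0 := g'.coeff_nondegenerate hψz fun w' => by
    obtain ⟨w, rfl⟩ := hD w'
    exact hzero u₀ v₀ w
  have h0' : D (Γ z u₀ v₀) - Γ' (ψ z) (D u₀) (D v₀) - D₂ u₀ v₀ = 0 := h0
  rw [sub_sub, sub_eq_zero, add_comm] at h0'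
  exact h0'.symm

end BanachManifold

/-! ### Charts of a manifold and of its tangent bundle -/

section Charts

variable {E : Type*} [NormedAddCommGroup E] [NormedSpace ℝ E]
  {M : Type*} [TopologicalSpace M] [ChartedSpace E M] [IsManifold 𝓘(ℝ, E) ∞ M]

/-- The coordinates of a tangent vector in the preferred trivialization at `m`, as the derivative
of the transition map of charts. -/
theorem trivializationAt_snd (m : M) (t : TangentBundle 𝓘(ℝ, E) M) :
    (trivializationAt E (TangentSpace 𝓘(ℝ, E)) m t).2 =
      fderiv ℝ (chartAt E m ∘ (chartAt E t.proj).symm) (chartAt E t.proj t.proj) t.2 := by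
  rw [TangentBundle.trivializationAt_apply]
  simp [OpenPartialHomeomorph.extend]

theorem extChartAt_tangent_apply (m : M) (t : TangentBundle 𝓘(ℝ, E) M) :
    extChartAt 𝓘(ℝ, E).tangent (⟨m, 0⟩ : TangentBundle 𝓘(ℝ, E) M) t =
      (chartAt E m t.proj, (trivializationAt E (TangentSpace 𝓘(ℝ, E)) m t).2) := by
  rw [ModelWithCorners.tangent, FiberBundle.extChartAt]
  simp

theorem mem_extChartAt_tangent_source {m : M} {t : TangentBundle 𝓘(ℝ, E) M} :
    t ∈ (extChartAt 𝓘(ℝ, E).tangent (⟨m, 0⟩ : TangentBundle 𝓘(ℝ, E) M)).source ↔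
      t.proj ∈ (chartAt E m).source := by
  rw [extChartAt_source]
  exact TangentBundle.mem_chart_source_iff t _

theorem contDiffOn_chart_trans (m m' : M) :
    ContDiffOn ℝ ∞ (chartAt E m' ∘ (chartAt E m).symm)
      ((chartAt E m).target ∩ (chartAt E m).symm ⁻¹' (chartAt E m').source) := by
  have h := ((contDiffGroupoid ∞ 𝓘(ℝ, E)).compatible (chart_mem_atlas E m)
    (chart_mem_atlas E m')).1
  simpa [contDiffPregroupoid] using h

theorem isOpen_chart_overlap (m m' : M) :
    IsOpen ((chartAt E m).target ∩ (chartAt E m).symm ⁻¹' (chartAt E m').source) :=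
  (chartAt E m).symm.isOpen_inter_preimage (chartAt E m').open_source

theorem contDiffAt_chart_trans {m m' y : M} (h : y ∈ (chartAt E m).source)
    (h' : y ∈ (chartAt E m').source) :
    ContDiffAt ℝ ∞ (chartAt E m' ∘ (chartAt E m).symm) (chartAt E m y) :=
  (contDiffOn_chart_trans m m').contDiffAt ((isOpen_chart_overlap m m').mem_nhds
    ⟨(chartAt E m).map_source h, by simpa [(chartAt E m).left_inv h] using h'⟩)

theorem fderiv_chart_trans_comp {m m' m'' y : M} (h : y ∈ (chartAt E m).source)
    (h' : y ∈ (chartAt E m').source) (h'' : y ∈ (chartAt E m'').source) :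
    fderiv ℝ (chartAt E m'' ∘ (chartAt E m).symm) (chartAt E m y) =
      (fderiv ℝ (chartAt E m'' ∘ (chartAt E m').symm) (chartAt E m' y)).comp
        (fderiv ℝ (chartAt E m' ∘ (chartAt E m).symm) (chartAt E m y)) := by
  have h1 := (contDiffAt_chart_trans h h').differentiableAt (by simp)
  have h2 := (contDiffAt_chart_trans h' h'').differentiableAt (by simp)
  have e : chartAt E m' y = (chartAt E m' ∘ (chartAt E m).symm) (chartAt E m y) := by
    simp [(chartAt E m).left_inv h]
  rw [e] at h2 ⊢
  rw [← fderiv_comp _ h2 h1]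
  refine Filter.EventuallyEq.fderiv_eq ?_
  filter_upwards [(isOpen_chart_overlap m m').mem_nhds
    ⟨(chartAt E m).map_source h, by simpa [(chartAt E m).left_inv h] using h'⟩] with z hz
  simp [(chartAt E m').left_inv hz.2]

theorem fderiv_chart_trans_self {m y : M} (h : y ∈ (chartAt E m).source) :
    fderiv ℝ (chartAt E m ∘ (chartAt E m).symm) (chartAt E m y) = ContinuousLinearMap.id ℝ E := by
  rw [← fderiv_id (x := chartAt E m y)]
  refine Filter.EventuallyEq.fderiv_eq ?_
  filter_upwards [(chartAt E m).open_target.mem_nhds ((chartAt E m).map_source h)] with z hz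
  simp [(chartAt E m).right_inv hz]

end Charts

section InverseFunction

/-- The inverse function theorem for smooth maps. The domain is shrunk to the points with invertible
derivative, so that the inverse is smooth on all of its domain and not only at the image of `a`. -/
theorem exists_openPartialHomeomorph_of_contDiffOn {E F : Type*} [NormedAddCommGroup E]
    [NormedSpace ℝ E] [CompleteSpace E] [NormedAddCommGroup F] [NormedSpace ℝ F] {G : E → F}
    {U : Set E} {a : E} (hG : ContDiffOn ℝ ∞ G U) (hU : U ∈ 𝓝 a) {L : E ≃L[ℝ] F}
    (hL : HasFDerivAt G (L : E →L[ℝ] F) a) :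
    ∃ R : OpenPartialHomeomorph E F, a ∈ R.source ∧ R.source ⊆ U ∧ (∀ x, R x = G x) ∧
      ContDiffOn ℝ ∞ R.symm R.target := by
  have hGa : ContDiffAt ℝ ∞ G a := hG.contDiffAt hU
  let R₀ := hGa.toOpenPartialHomeomorph G hL (by simp)
  have ha : a ∈ R₀.source := hGa.mem_toOpenPartialHomeomorph_source hL (by simp)
  have hinv : {x | fderiv ℝ G x ∈ Set.range ((↑) : (E ≃L[ℝ] F) → E →L[ℝ] F)} ∈ 𝓝 a := by
    have hc : ContinuousAt (fderiv ℝ G) a :=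
      (hGa.fderiv_right (m := 0) (by norm_cast)).continuousAt
    refine hc.preimage_mem_nhds (ContinuousLinearEquiv.isOpen.mem_nhds ⟨L, ?_⟩)
    exact hL.fderiv.symm
  let V := interior (U ∩ {x | fderiv ℝ G x ∈ Set.range ((↑) : (E ≃L[ℝ] F) → E →L[ℝ] F)})
  have hV : a ∈ V := mem_interior_iff_mem_nhds.2 (Filter.inter_mem hU hinv)
  refine ⟨R₀.restrOpen V isOpen_interior, ⟨ha, hV⟩, fun x hx => (interior_subset hx.2).1,
    fun x => rfl, fun y hy => ContDiffAt.contDiffWithinAt ?_⟩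
  have hx := (R₀.restrOpen V isOpen_interior).map_target hy
  obtain ⟨L', hL'⟩ := (interior_subset hx.2).2
  have hGx : ContDiffAt ℝ ∞ G ((R₀.restrOpen V isOpen_interior).symm y) :=
    hG.contDiffAt (Filter.mem_of_superset (isOpen_interior.mem_nhds hx.2)
      fun z hz => (interior_subset hz).1)
  refine (R₀.restrOpen V isOpen_interior).contDiffAt_symm hy (f₀' := L') ?_ hGx
  rw [hL']
  exact (hGx.differentiableAt (by simp)).hasFDerivAt

end InverseFunction

section LocalAddition

variable {E : Type*} [NormedAddCommGroup E] [NormedSpace ℝ E]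
  {M : Type*} [TopologicalSpace M] [ChartedSpace E M] [IsManifold 𝓘(ℝ, E) ∞ M]

/-- One summand of the inverse of a local addition, in the chart at `y₀`: the difference of two points
in the chart at `c`, mapped to the chart at `y₀` and weighted with `r`. Its derivative on the diagonal
is, up to the weight, independent of `c`. -/
theorem chart_difference_term {y₀ c : M} {r : M → ℝ} (hr : ContMDiff 𝓘(ℝ, E) 𝓘(ℝ, ℝ) ∞ r)
    (hc : tsupport r ⊆ (chartAt E c).source) :
    let g : E × E → E := fun z => r ((chartAt E y₀).symm z.1) •
      fderiv ℝ (chartAt E y₀ ∘ (chartAt E c).symm) (chartAt E c ((chartAt E y₀).symm z.1))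
        (chartAt E c ((chartAt E y₀).symm z.2) - chartAt E c ((chartAt E y₀).symm z.1))
    let z₀ : E × E := (chartAt E y₀ y₀, chartAt E y₀ y₀)
    (∀ᶠ z in 𝓝 z₀, ContDiffAt ℝ ∞ g z) ∧
      HasFDerivAt g (r y₀ • (ContinuousLinearMap.snd ℝ E E - ContinuousLinearMap.fst ℝ E E)) z₀ := by
  intro g z₀
  have hy₀ := mem_chart_source E y₀
  have hy₀' := mem_chart_target E y₀
  have hcont : ContinuousAt (chartAt E y₀).symm (chartAt E y₀ y₀) :=
    (chartAt E y₀).continuousAt_symm hy₀'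
  have hback : (chartAt E y₀).symm (chartAt E y₀ y₀) = y₀ := (chartAt E y₀).left_inv hy₀
  by_cases hyc : y₀ ∈ (chartAt E c).source
  · -- `τ` and `σ` are the transition maps between the two charts
    set τ : E → E := chartAt E c ∘ (chartAt E y₀).symm with hτ
    set σ : E → E := chartAt E y₀ ∘ (chartAt E c).symm with hσ
    have hO := isOpen_chart_overlap (E := E) y₀ c
    have hz₀ : chartAt E y₀ y₀ ∈ (chartAt E y₀).target ∩
        (chartAt E y₀).symm ⁻¹' (chartAt E c).source := ⟨hy₀', by simpa [hback] using hyc⟩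
    have hτs : ∀ a ∈ (chartAt E y₀).target ∩ (chartAt E y₀).symm ⁻¹' (chartAt E c).source,
        ContDiffAt ℝ ∞ τ a := fun a ha => (contDiffOn_chart_trans (E := E) y₀ c).contDiffAt (hO.mem_nhds ha)
    have hσs : ∀ a ∈ (chartAt E y₀).target ∩ (chartAt E y₀).symm ⁻¹' (chartAt E c).source,
        ContDiffAt ℝ ∞ (fun a => fderiv ℝ σ (τ a)) a := by
      intro a ha
      have h1 : ContDiffAt ℝ ∞ σ (τ a) :=
        contDiffAt_chart_trans (E := E) (M := M) (m := c) (m' := y₀)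
          (y := (chartAt E y₀).symm a) ha.2 ((chartAt E y₀).map_target ha.1)
      exact (h1.fderiv_right (m := ∞) (by simp)).comp a (hτs a ha)
    have hrs : ∀ a ∈ (chartAt E y₀).target, ContDiffAt ℝ ∞ (fun a => r ((chartAt E y₀).symm a)) a := by
      intro a ha
      have h1 : ContMDiffAt 𝓘(ℝ, E) 𝓘(ℝ, E) ∞ (chartAt E y₀).symm a :=
        (contMDiffOn_chart_symm (I := 𝓘(ℝ, E)) (x := y₀) (n := ∞)).contMDiffAt
          ((chartAt E y₀).open_target.mem_nhds ha)
      exact (hr.contMDiffAt.comp a h1).contDiffAt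
    have hgs : ∀ z : E × E, z.1 ∈ (chartAt E y₀).target ∩
        (chartAt E y₀).symm ⁻¹' (chartAt E c).source → z.2 ∈ (chartAt E y₀).target ∩
        (chartAt E y₀).symm ⁻¹' (chartAt E c).source → ContDiffAt ℝ ∞ g z := by
      intro z hz1 hz2
      refine ((hrs z.1 hz1.1).comp z contDiffAt_fst).smul
        (((hσs z.1 hz1).comp z contDiffAt_fst).clm_apply ?_)
      exact ((hτs z.2 hz2).comp z contDiffAt_snd).sub ((hτs z.1 hz1).comp z contDiffAt_fst)
    constructor
    · filter_upwards [(hO.prod hO).mem_nhds (x := z₀) ⟨hz₀, hz₀⟩] with z hz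
      exact hgs z hz.1 hz.2
    · have hd1 : HasFDerivAt (fun z : E × E => r ((chartAt E y₀).symm z.1)) _ z₀ :=
        ((ContDiffAt.comp (g := fun a => r ((chartAt E y₀).symm a)) (f := Prod.fst) z₀
          (hrs _ hy₀') contDiffAt_fst).differentiableAt (by simp)).hasFDerivAt
      have hd2 : HasFDerivAt (fun z : E × E => fderiv ℝ σ (τ z.1)) _ z₀ :=
        ((ContDiffAt.comp (g := fun a => fderiv ℝ σ (τ a)) (f := Prod.fst) z₀
          (hσs _ hz₀) contDiffAt_fst).differentiableAt (by simp)).hasFDerivAt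
      have hτd : HasFDerivAt τ (fderiv ℝ τ (chartAt E y₀ y₀)) (chartAt E y₀ y₀) :=
        ((hτs _ hz₀).differentiableAt (by simp)).hasFDerivAt
      have hd3 : HasFDerivAt (fun z : E × E => τ z.2) _ z₀ :=
        HasFDerivAt.comp (g := τ) (f := Prod.snd) z₀ hτd hasFDerivAt_snd
      have hd4 : HasFDerivAt (fun z : E × E => τ z.1) _ z₀ :=
        HasFDerivAt.comp (g := τ) (f := Prod.fst) z₀ hτd hasFDerivAt_fst
      have hd := hd1.smul (hd2.clm_apply (hd3.sub hd4))
      refine hd.congr_fderiv ?_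
      have hid : (fderiv ℝ σ (τ (chartAt E y₀ y₀))).comp (fderiv ℝ τ (chartAt E y₀ y₀)) =
          ContinuousLinearMap.id ℝ E := by
        have h1 := fderiv_chart_trans_comp (E := E) (m := y₀) (m' := c) (m'' := y₀) hy₀ hyc hy₀
        rw [fderiv_chart_trans_self hy₀] at h1
        have h2 : τ (chartAt E y₀ y₀) = chartAt E c y₀ := by simp [hτ, hback]
        rw [h2]
        exact h1.symm
      have hid' : ∀ e, fderiv ℝ σ (τ (chartAt E y₀ y₀)) (fderiv ℝ τ (chartAt E y₀ y₀) e) = e :=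
        fun e => congrArg (fun L => L e) hid
      ext e
      · simp [z₀, hback, hid']
      · simp [z₀, hback, hid']
  · -- the weight vanishes near `y₀`
    have hr0 : ∀ᶠ y in 𝓝 y₀, r y = 0 := by
      filter_upwards [(isClosed_tsupport r).isOpen_compl.mem_nhds (fun h => hyc (hc h))] with y hy
      exact image_eq_zero_of_notMem_tsupport hy
    have hr0' : ∀ᶠ z in 𝓝 z₀, g z = 0 := by
      have h1 : ContinuousAt (fun z : E × E => (chartAt E y₀).symm z.1) z₀ :=
        ContinuousAt.comp (f := Prod.fst) (x := z₀) hcont continuousAt_fst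
      have h2 : Filter.Tendsto (fun z : E × E => (chartAt E y₀).symm z.1) (𝓝 z₀) (𝓝 y₀) := by
        have h3 := h1.tendsto
        simp only [z₀, hback] at h3
        exact h3
      filter_upwards [h2.eventually hr0] with z hz
      simp only [g, hz, zero_smul]
    constructor
    · filter_upwards [hr0'.eventually_nhds] with z hz
      exact contDiffAt_const.congr_of_eventuallyEq (f := fun _ => (0 : E)) hz
    · rw [hr0.self_of_nhds, zero_smul]
      exact (hasFDerivAt_const (0 : E) z₀).congr_of_eventuallyEq hr0'

end LocalAddition

/-! ### Existence of local additions -/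

section LocalAddition

variable {E : Type*} [NormedAddCommGroup E] [NormedSpace ℝ E]
  {M : Type*} [TopologicalSpace M] [ChartedSpace E M] [IsManifold 𝓘(ℝ, E) ∞ M]

/-- For `p = (y, z)`, the tangent vector at `y` which is the sum, with weights `r c y`, of the
differences of `z` and `y` in the charts at the points `c ∈ t`. The weights
vanish for `y` outside of the chart domains; for `z` outside of them the value is junk, which does not
matter near the diagonal. -/
noncomputable def differenceVector (t : Finset M) (r : M → M → ℝ) (p : M × M) :
    TangentBundle 𝓘(ℝ, E) M :=
  ⟨p.1, ∑ c ∈ t, r c p.1 • fderiv ℝ (chartAt E p.1 ∘ (chartAt E c).symm) (chartAt E c p.1)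
    (chartAt E c p.2 - chartAt E c p.1)⟩

theorem trivializationAt_differenceVector {t : Finset M} {r : M → M → ℝ}
    (hr : ∀ c ∈ t, tsupport (r c) ⊆ (chartAt E c).source) {y₀ : M} {p : M × M}
    (hp : p.1 ∈ (chartAt E y₀).source) :
    (trivializationAt E (TangentSpace 𝓘(ℝ, E)) y₀ (differenceVector t r p)).2 =
      ∑ c ∈ t, r c p.1 • fderiv ℝ (chartAt E y₀ ∘ (chartAt E c).symm) (chartAt E c p.1)
        (chartAt E c p.2 - chartAt E c p.1) := by
  rw [trivializationAt_snd]
  change fderiv ℝ (chartAt E y₀ ∘ (chartAt E p.1).symm) (chartAt E p.1 p.1) (∑ c ∈ t, _) = _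
  rw [map_sum]
  refine Finset.sum_congr rfl fun c hc => ?_
  rw [map_smul]
  by_cases h : r c p.1 = 0
  · simp [h]
  · have hpc := hr c hc (subset_tsupport _ h)
    rw [fderiv_chart_trans_comp hpc (mem_chart_source E p.1) hp]
    rfl

/-- The map `(y, z) ↦ differenceVector t r (y, z)` is a local diffeomorphism at a point of the
diagonal where the sum of the weights is not zero. -/
theorem isLocalDiffeomorphAt_differenceVector [CompleteSpace E] {t : Finset M} {r : M → M → ℝ}
    (hrs : ∀ c ∈ t, ContMDiff 𝓘(ℝ, E) 𝓘(ℝ, ℝ) ∞ (r c))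
    (hr : ∀ c ∈ t, tsupport (r c) ⊆ (chartAt E c).source) {y₀ : M}
    (hy₀ : ∑ c ∈ t, r c y₀ ≠ 0) :
    IsLocalDiffeomorphAt (𝓘(ℝ, E).prod 𝓘(ℝ, E)) 𝓘(ℝ, E).tangent ∞
      (differenceVector t r : M × M → TangentBundle 𝓘(ℝ, E) M) (y₀, y₀) := by
  set φ := chartAt E y₀ with hφ
  let z₀ : E × E := (φ y₀, φ y₀)
  let g : M → E × E → E := fun c z => r c (φ.symm z.1) •
      fderiv ℝ (φ ∘ (chartAt E c).symm) (chartAt E c (φ.symm z.1))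
        (chartAt E c (φ.symm z.2) - chartAt E c (φ.symm z.1))
  let G : E × E → E × E := fun z => (z.1, ∑ c ∈ t, g c z)
  have hterm := fun c (hc : c ∈ t) => chart_difference_term (y₀ := y₀) (hrs c hc) (hr c hc)
  have hG1 : ∀ᶠ z in 𝓝 z₀, ContDiffAt ℝ ∞ G z := by
    have h1 : ∀ᶠ z in 𝓝 z₀, ∀ c ∈ t, ContDiffAt ℝ ∞ (g c) z :=
      (Filter.eventually_all_finset t).2 fun c hc => (hterm c hc).1
    filter_upwards [h1] with z hz
    exact contDiffAt_fst.prodMk (ContDiffAt.sum hz)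
  set R := ∑ c ∈ t, r c y₀ with hR
  have hG2 : HasFDerivAt G ((ContinuousLinearMap.fst ℝ E E).prod
      (R • (ContinuousLinearMap.snd ℝ E E - ContinuousLinearMap.fst ℝ E E))) z₀ := by
    refine hasFDerivAt_fst.prodMk ?_
    rw [hR, Finset.sum_smul]
    exact HasFDerivAt.fun_sum fun c hc => (hterm c hc).2
  let L : (E × E) ≃L[ℝ] (E × E) := ContinuousLinearEquiv.equivOfInverse
    ((ContinuousLinearMap.fst ℝ E E).prod
      (R • (ContinuousLinearMap.snd ℝ E E - ContinuousLinearMap.fst ℝ E E)))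
    ((ContinuousLinearMap.fst ℝ E E).prod
      (ContinuousLinearMap.fst ℝ E E + R⁻¹ • ContinuousLinearMap.snd ℝ E E))
    (fun z => by
      refine Prod.ext rfl ?_
      simp [smul_smul, inv_mul_cancel₀ hy₀])
    (fun z => by
      refine Prod.ext rfl ?_
      simp [smul_smul, mul_inv_cancel₀ hy₀])
  obtain ⟨Ψ, hΨ₀, -, hΨG, hΨs⟩ := exists_openPartialHomeomorph_of_contDiffOn (G := G) (a := z₀)
    (fun z hz => ContDiffAt.contDiffWithinAt hz) hG1 (L := L) hG2
  have hΨs' : ContDiffOn ℝ ∞ Ψ (Ψ.source ∩ {z | ContDiffAt ℝ ∞ G z}) := fun z hz => by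
    have : (Ψ : E × E → E × E) = G := funext hΨG
    rw [this]
    exact ContDiffAt.contDiffWithinAt hz.2
  have hmem : {z | ContDiffAt ℝ ∞ G z} ∈ 𝓝 z₀ := hG1
  let Ψ' := Ψ.restrOpen (interior {z | ContDiffAt ℝ ∞ G z}) isOpen_interior
  let c₁ := extChartAt (𝓘(ℝ, E).prod 𝓘(ℝ, E)) ((y₀, y₀) : M × M)
  let c₂ := extChartAt 𝓘(ℝ, E).tangent (⟨y₀, 0⟩ : TangentBundle 𝓘(ℝ, E) M)
  have hc₁ : ∀ p : M × M, c₁ p = (φ p.1, φ p.2) := fun p => by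
    simp [c₁, hφ]
  have hc₁s : ∀ p : M × M, p ∈ c₁.source ↔ p.1 ∈ φ.source ∧ p.2 ∈ φ.source := fun p => by
    simp [c₁, hφ]
  have hkey : ∀ p ∈ c₁.source, c₂ (differenceVector t r p) = G (c₁ p) := by
    intro p hp
    have hp' := (hc₁s p).1 hp
    rw [hc₁]
    refine (extChartAt_tangent_apply y₀ _).trans (Prod.ext rfl ?_)
    refine (trivializationAt_differenceVector hr hp'.1).trans ?_
    simp only [G, g, φ.left_inv hp'.1, φ.left_inv hp'.2, ← hφ]
  have hsrc₂ : ∀ p ∈ c₁.source, differenceVector t r p ∈ c₂.source := fun p hp =>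
    mem_extChartAt_tangent_source.2 ((hc₁s p).1 hp).1
  refine ⟨⟨(c₁.trans Ψ'.toPartialEquiv).trans c₂.symm, ?_, ?_, ?_, ?_⟩, ?_, ?_⟩
  · have h1 : IsOpen (Ψ'.source ∩ Ψ' ⁻¹' c₂.target) :=
      Ψ'.isOpen_inter_preimage (isOpen_extChartAt_target _)
    have h2 := (continuousOn_extChartAt (I := 𝓘(ℝ, E).prod 𝓘(ℝ, E))
      ((y₀, y₀) : M × M)).isOpen_inter_preimage (isOpen_extChartAt_source _) h1
    convert! h2 using 1
    ext p
    simp only [PartialEquiv.trans_source, Set.mem_inter_iff, Set.mem_preimage]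
    exact and_assoc
  · have h1 : IsOpen (Ψ'.symm.source ∩ Ψ'.symm ⁻¹' c₁.target) :=
      Ψ'.symm.isOpen_inter_preimage (isOpen_extChartAt_target _)
    have h2 := (continuousOn_extChartAt (I := 𝓘(ℝ, E).tangent)
      (⟨y₀, 0⟩ : TangentBundle 𝓘(ℝ, E) M)).isOpen_inter_preimage (isOpen_extChartAt_source _) h1
    exact h2
  · have h1 : ContMDiffOn 𝓘(ℝ, E × E) 𝓘(ℝ, E × E) ∞ Ψ' Ψ'.source :=
      (hΨs'.mono fun z hz => ⟨hz.1, interior_subset hz.2⟩).contMDiffOn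
    have h2 : ContMDiffOn (𝓘(ℝ, E).prod 𝓘(ℝ, E)) 𝓘(ℝ, E × E) ∞ c₁ c₁.source := by
      rw [extChartAt_source]
      exact contMDiffOn_extChartAt
    have h3 : ContMDiffOn 𝓘(ℝ, E × E) 𝓘(ℝ, E).tangent ∞ c₂.symm c₂.target :=
      contMDiffOn_extChartAt_symm _
    exact h3.comp (h1.comp (h2.mono fun p hp => hp.1.1) fun p hp => hp.1.2) fun p hp => hp.2
  · have h1 : ContMDiffOn 𝓘(ℝ, E × E) 𝓘(ℝ, E × E) ∞ Ψ'.symm Ψ'.target :=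
      (hΨs.mono fun z hz => hz.1).contMDiffOn
    have h2 : ContMDiffOn 𝓘(ℝ, E).tangent 𝓘(ℝ, E × E) ∞ c₂ c₂.source := by
      rw [extChartAt_source]
      exact contMDiffOn_extChartAt
    have h3 : ContMDiffOn 𝓘(ℝ, E × E) (𝓘(ℝ, E).prod 𝓘(ℝ, E)) ∞ c₁.symm c₁.target :=
      contMDiffOn_extChartAt_symm _
    exact (h3.comp (h1.mono fun z hz => hz.1) fun z hz => hz.2).comp
      (h2.mono fun z hz => hz.1) fun z hz => hz.2
  · have hp₀ : ((y₀, y₀) : M × M) ∈ c₁.source := mem_extChartAt_source _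
    refine ⟨⟨hp₀, ?_⟩, ?_⟩
    · change c₁ (y₀, y₀) ∈ Ψ'.source
      rw [hc₁]
      exact ⟨hΨ₀, mem_interior_iff_mem_nhds.2 hmem⟩
    · change Ψ (c₁ (y₀, y₀)) ∈ c₂.target
      rw [hΨG, ← hkey _ hp₀]
      exact c₂.map_source (hsrc₂ _ hp₀)
  · rintro p ⟨⟨hp, -⟩, -⟩
    change _ = c₂.symm (Ψ (c₁ p))
    rw [hΨG, ← hkey p hp, c₂.left_inv (hsrc₂ p hp)]

/-- An injective local diffeomorphism on an open set has an inverse which is smooth. (The map `d`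
only serves to define the inverse outside of the image.) -/
theorem exists_smooth_inverse {F H : Type*} [NormedAddCommGroup F] [NormedSpace ℝ F]
    [TopologicalSpace H] {I : ModelWithCorners ℝ F H} {N : Type*} [TopologicalSpace N]
    [ChartedSpace H N] {F' H' : Type*} [NormedAddCommGroup F'] [NormedSpace ℝ F']
    [TopologicalSpace H'] {I' : ModelWithCorners ℝ F' H'} {N' : Type*} [TopologicalSpace N']
    [ChartedSpace H' N'] {θ : N → N'} {U : Set N} (hU : IsOpen U)
    (hloc : ∀ p ∈ U, IsLocalDiffeomorphAt I I' ∞ θ p) (hinj : Set.InjOn θ U) (d : N' → N) :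
    ∃ Φ : OpenPartialHomeomorph N N', Φ.source = U ∧ (∀ p, Φ p = θ p) ∧
      ContMDiffOn I I' ∞ Φ Φ.source ∧ ContMDiffOn I' I ∞ Φ.symm Φ.target := by
  classical
  let inv : N' → N := fun q => if h : ∃ p ∈ U, θ p = q then h.choose else d q
  have hinv : ∀ p ∈ U, inv (θ p) = p := by
    intro p hp
    have h : ∃ p' ∈ U, θ p' = θ p := ⟨p, hp, rfl⟩
    simp only [inv, dif_pos h]
    exact hinj h.choose_spec.1 hp h.choose_spec.2
  have hsm : ContMDiffOn I I' ∞ θ U := fun p hp => (hloc p hp).contMDiffAt.contMDiffWithinAt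
  -- near a point of the image, the inverse agrees with the inverse of a local diffeomorphism
  have hnear : ∀ p ∈ U, ∃ V : Set N', IsOpen V ∧ θ p ∈ V ∧ V ⊆ θ '' U ∧
      ContMDiffAt I' I ∞ inv (θ p) := by
    intro p hp
    obtain ⟨Φ, hpΦ, hΦ⟩ := hloc p hp
    have hVo : IsOpen (Φ.target ∩ Φ.toPartialEquiv.symm ⁻¹' U) :=
      Φ.contMDiffOn_invFun.continuousOn.isOpen_inter_preimage Φ.open_target hU
    have hpV : θ p ∈ Φ.target ∩ Φ.toPartialEquiv.symm ⁻¹' U := by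
      rw [hΦ hpΦ]
      refine ⟨Φ.map_source hpΦ, ?_⟩
      change Φ.toPartialEquiv.symm (Φ.toPartialEquiv p) ∈ U
      rwa [Φ.left_inv hpΦ]
    have hθ : ∀ q ∈ Φ.target ∩ Φ.toPartialEquiv.symm ⁻¹' U, θ (Φ.toPartialEquiv.symm q) = q := by
      intro q hq
      rw [hΦ (Φ.map_target hq.1)]
      exact Φ.right_inv hq.1
    refine ⟨_, hVo, hpV, fun q hq => ⟨_, hq.2, hθ q hq⟩, ?_⟩
    have h1 : ContMDiffAt I' I ∞ Φ.toPartialEquiv.symm (θ p) :=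
      Φ.contMDiffOn_invFun.contMDiffAt (Φ.open_target.mem_nhds hpV.1)
    refine h1.congr_of_eventuallyEq ?_
    filter_upwards [hVo.mem_nhds hpV] with q hq
    conv_lhs => rw [← hθ q hq]
    exact hinv _ hq.2
  have hinvs : ContMDiffOn I' I ∞ inv (θ '' U) := by
    rintro _ ⟨p, hp, rfl⟩
    obtain ⟨-, -, -, -, h⟩ := hnear p hp
    exact h.contMDiffWithinAt
  have hto : IsOpen (θ '' U) := by
    rw [isOpen_iff_mem_nhds]
    rintro _ ⟨p, hp, rfl⟩
    obtain ⟨V, hV, hpV, hVU, -⟩ := hnear p hp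
    exact Filter.mem_of_superset (hV.mem_nhds hpV) hVU
  let e : PartialEquiv N N' :=
    { toFun := θ
      invFun := inv
      source := U
      target := θ '' U
      map_source' := fun p hp => ⟨p, hp, rfl⟩
      map_target' := by
        rintro _ ⟨p, hp, rfl⟩
        rwa [hinv p hp]
      left_inv' := hinv
      right_inv' := by
        rintro _ ⟨p, hp, rfl⟩
        rw [hinv p hp] }
  exact ⟨{ toPartialEquiv := e, open_source := hU, open_target := hto,
           continuousOn_toFun := hsm.continuousOn, continuousOn_invFun := hinvs.continuousOn },
    rfl, fun p => rfl, hsm, hinvs⟩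

/-- The tangent bundle of a Hausdorff manifold is Hausdorff: vectors with the same base point are
separated in a trivialization, other vectors by their base points. -/
theorem t2Space_tangentBundle [T2Space M] : T2Space (TangentBundle 𝓘(ℝ, E) M) := by
  refine ⟨fun v w hvw => ?_⟩
  by_cases h : v.proj = w.proj
  · let e := trivializationAt E (TangentSpace 𝓘(ℝ, E)) v.proj
    have hv : v ∈ e.source := by
      rw [e.mem_source]
      exact FiberBundle.mem_baseSet_trivializationAt' v.proj
    have hw : w ∈ e.source := by
      rw [e.mem_source, ← h]
      exact FiberBundle.mem_baseSet_trivializationAt' v.proj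
    have hne : e v ≠ e w := fun he => hvw (e.injOn hv hw he)
    obtain ⟨U, V, hU, hV, hvU, hwV, hUV⟩ := t2_separation hne
    refine ⟨e.source ∩ e ⁻¹' U, e.source ∩ e ⁻¹' V,
      e.continuousOn.isOpen_inter_preimage e.open_source hU,
      e.continuousOn.isOpen_inter_preimage e.open_source hV, ⟨hv, hvU⟩, ⟨hw, hwV⟩, ?_⟩
    exact (hUV.preimage e).mono Set.inter_subset_right Set.inter_subset_right
  · obtain ⟨U, V, hU, hV, hvU, hwV, hUV⟩ := t2_separation h
    have hc : Continuous (Bundle.TotalSpace.proj : TangentBundle 𝓘(ℝ, E) M → M) :=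
      FiberBundle.continuous_proj E (TangentSpace 𝓘(ℝ, E))
    exact ⟨_, _, hU.preimage hc, hV.preimage hc, hvU, hwV, hUV.preimage _⟩

/-- There is a local addition around every compact set. No geodesics are needed: its inverse is the
map `(y, z) ↦ differenceVector t r (y, z)` with bump functions `r c` as weights, which is a local
diffeomorphism near the diagonal of `K`, and is injective there by compactness. -/
theorem exists_localAddition [FiniteDimensional ℝ E] [T2Space M] {K : Set M} (hK : IsCompact K) :
    ∃ α : LocalAddition E M, ∀ y ∈ K, (⟨y, 0⟩ : TangentBundle 𝓘(ℝ, E) M) ∈ α.source := by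
  have : CompleteSpace E := FiniteDimensional.complete ℝ E
  let r : M → M → ℝ := fun c => (Classical.arbitrary (SmoothBumpFunction 𝓘(ℝ, E) c) : M → ℝ)
  have hrs : ∀ c, ContMDiff 𝓘(ℝ, E) 𝓘(ℝ, ℝ) ∞ (r c) := fun c => SmoothBumpFunction.contMDiff _
  have hr : ∀ c, tsupport (r c) ⊆ (chartAt E c).source := fun c =>
    SmoothBumpFunction.tsupport_subset_chartAt_source _
  have hrnn : ∀ c y, 0 ≤ r c y := fun c y => SmoothBumpFunction.nonneg _
  obtain ⟨t, ht⟩ := hK.elim_finite_subcover (fun c => Function.support (r c))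
    (fun c => SmoothBumpFunction.isOpen_support _)
    (fun y _ => Set.mem_iUnion.2 ⟨y, SmoothBumpFunction.c_mem_support _⟩)
  let θ : M × M → TangentBundle 𝓘(ℝ, E) M := differenceVector t r
  have hθ0 : ∀ y, θ (y, y) = ⟨y, 0⟩ := fun y => by
    refine congrArg (Bundle.TotalSpace.mk y) ?_
    refine Finset.sum_eq_zero fun c _ => ?_
    simp only [sub_self, map_zero, smul_zero]
    rfl
  have hdiag : ∀ y ∈ K, IsLocalDiffeomorphAt (𝓘(ℝ, E).prod 𝓘(ℝ, E)) 𝓘(ℝ, E).tangent ∞ θ (y, y) := by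
    intro y hy
    refine isLocalDiffeomorphAt_differenceVector (fun c _ => hrs c) (fun c _ => hr c) ?_
    obtain ⟨c, hc, hyc⟩ := Set.mem_iUnion₂.1 (ht hy)
    exact (Finset.sum_pos' (fun c _ => hrnn c y)
      ⟨c, hc, lt_of_le_of_ne (hrnn c y) (Ne.symm hyc)⟩).ne'
  let Δ : Set (M × M) := (fun y => (y, y)) '' K
  have hΔ : IsCompact Δ := hK.image (by fun_prop)
  have hT2 : T2Space (TangentBundle 𝓘(ℝ, E) M) := t2Space_tangentBundle
  obtain ⟨V, hVo, hΔV, hVinj⟩ := Set.InjOn.exists_isOpen_superset (f := θ) (s := Δ)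
    (by
      rintro _ ⟨y, hy, rfl⟩ _ ⟨z, hz, rfl⟩ h
      have : y = z := congrArg Bundle.TotalSpace.proj h
      rw [this])
    hΔ
    (by
      rintro _ ⟨y, hy, rfl⟩
      exact (hdiag y hy).contMDiffAt.continuousAt)
    (by
      rintro _ ⟨y, hy, rfl⟩
      obtain ⟨Φ, hpΦ, hΦ⟩ := hdiag y hy
      exact ⟨Φ.source, Φ.open_source.mem_nhds hpΦ,
        (Φ.toPartialEquiv.injOn).congr hΦ.symm⟩)
  let W : Set (M × M) :=
    {p | IsLocalDiffeomorphAt (𝓘(ℝ, E).prod 𝓘(ℝ, E)) 𝓘(ℝ, E).tangent ∞ θ p}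
  have hW : IsOpen W := by
    rw [isOpen_iff_mem_nhds]
    rintro p ⟨Φ, hpΦ, hΦ⟩
    exact Filter.mem_of_superset (Φ.open_source.mem_nhds hpΦ) fun q hq => ⟨Φ, hq, hΦ⟩
  -- the domain has to contain `(y, y)` along with `(y, z)`
  let U : Set (M × M) := (V ∩ W) ∩ (fun p => (p.1, p.1)) ⁻¹' (V ∩ W)
  have hU : IsOpen U :=
    (hVo.inter hW).inter ((hVo.inter hW).preimage (by fun_prop))
  obtain ⟨Φ, hΦU, hΦθ, hΦ1, hΦ2⟩ := exists_smooth_inverse (θ := θ) hU (fun p hp => hp.1.2)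
    (hVinj.mono fun p hp => hp.1.1) (fun q => (q.proj, q.proj))
  have hΦd : ∀ q ∈ Φ.target, ∃ p ∈ U, θ p = q := fun q hq =>
    ⟨Φ.symm q, by rw [← hΦU]; exact Φ.map_target hq, by rw [← hΦθ]; exact Φ.right_inv hq⟩
  have hΦθ' : ∀ p ∈ U, Φ.symm (θ p) = p := fun p hp => by
    rw [← hΦθ]
    exact Φ.left_inv (by rwa [hΦU])
  have hmt : ∀ p ∈ U, θ p ∈ Φ.target := fun p hp => by
    rw [← hΦθ]
    exact Φ.map_source (by rwa [hΦU])
  have hUd : ∀ p ∈ U, (p.1, p.1) ∈ U := fun p hp => ⟨hp.2, hp.2⟩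
  refine ⟨{ toOpenPartialHomeomorph := Φ.symm
            fst_apply := ?_
            zero_mem := ?_
            apply_zero := ?_
            contMDiffOn_toFun := hΦ2
            contMDiffOn_invFun := hΦ1 }, ?_⟩
  · intro v hv
    obtain ⟨p, hp, rfl⟩ := hΦd v hv
    exact congrArg Prod.fst (hΦθ' p hp)
  · intro v hv
    obtain ⟨p, hp, rfl⟩ := hΦd v hv
    have := hmt _ (hUd p hp)
    rw [hθ0] at this
    exact this
  · intro v hv
    obtain ⟨p, hp, rfl⟩ := hΦd v hv
    have := hΦθ' _ (hUd p hp)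
    rw [hθ0] at this
    exact this
  · intro y hy
    have hyU : (y, y) ∈ U := ⟨⟨hΔV ⟨y, hy, rfl⟩, hdiag y hy⟩, ⟨hΔV ⟨y, hy, rfl⟩, hdiag y hy⟩⟩
    have := hmt _ hyU
    rw [hθ0] at this
    exact this

end LocalAddition

/-! ### Jets of functions on a manifold with boundary -/

/-- The Leibniz bound for the derivatives within a set of the product of an operator valued and a
vector valued map, at a point. -/
theorem norm_iteratedFDerivWithin_clm_apply_at {V F G : Type*} [NormedAddCommGroup V]
    [NormedSpace ℝ V] [NormedAddCommGroup F] [NormedSpace ℝ F] [NormedAddCommGroup G]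
    [NormedSpace ℝ G] {f : V → F →L[ℝ] G} {g : V → F} {s : Set V} {x : V} {n : ℕ}
    (hf : ContDiffWithinAt ℝ n f s x) (hg : ContDiffWithinAt ℝ n g s x) (hs : UniqueDiffOn ℝ s)
    (hx : x ∈ s) :
    ‖iteratedFDerivWithin ℝ n (fun y => f y (g y)) s x‖ ≤
      ∑ i ∈ Finset.range (n + 1), n.choose i * ‖iteratedFDerivWithin ℝ i f s x‖ *
        ‖iteratedFDerivWithin ℝ (n - i) g s x‖ := by
  obtain ⟨u, hu, hxu, hfu⟩ := hf.contDiffOn' le_rfl (by simp)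
  obtain ⟨v, hv, hxv, hgv⟩ := hg.contDiffOn' le_rfl (by simp)
  rw [Set.insert_eq_of_mem hx] at hfu hgv
  have h := norm_iteratedFDerivWithin_clm_apply (x := x) (n := n) (s := s ∩ (u ∩ v))
    (hfu.mono fun y hy => ⟨hy.1, hy.2.1⟩) (hgv.mono fun y hy => ⟨hy.1, hy.2.2⟩)
    (hs.inter (hu.inter hv)) ⟨hx, hxu, hxv⟩ le_rfl
  simp only [iteratedFDerivWithin_inter_open (hu.inter hv) ⟨hxu, hxv⟩] at h
  exact h

section Jets

variable {ED : Type*} [NormedAddCommGroup ED] [NormedSpace ℝ ED] {HD : Type*} [TopologicalSpace HD]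
  (I : ModelWithCorners ℝ ED HD) {D : Type*} [TopologicalSpace D] [ChartedSpace HD D]
  {F : Type*} [NormedAddCommGroup F] [NormedSpace ℝ F]

/-- The `j`-th derivative at `q`, in the chart of `D` at `r`, of a function on `D`. The derivative is
taken within the range of the model with corners, so that boundary points are allowed. -/
noncomputable def jetAt (r : D) (j : ℕ) (h : D → F) (q : D) : ED [×j]→L[ℝ] F :=
  iteratedFDerivWithin ℝ j (h ∘ (extChartAt I r).symm) (Set.range I) (extChartAt I r q)

variable {I} [IsManifold I ∞ D] {r r' q q₀ : D} {k j : ℕ} {h g : D → F}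

theorem contDiffWithinAt_comp_extChartAt_symm (hq : q ∈ (chartAt HD r).source)
    (hh : ContMDiffAt I 𝓘(ℝ, F) k h q) :
    ContDiffWithinAt ℝ k (h ∘ (extChartAt I r).symm) (Set.range I) (extChartAt I r q) :=
  ((contMDiffAt_iff_source_of_mem_source hq).1 hh).contDiffWithinAt

theorem tendsto_extChartAt_nhdsWithin (hq : q ∈ (chartAt HD r).source) :
    Filter.Tendsto (extChartAt I r) (𝓝 q) (𝓝[Set.range I] (extChartAt I r q)) := by
  refine tendsto_nhdsWithin_iff.2 ⟨continuousAt_extChartAt' (by simpa using hq), ?_⟩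
  exact Filter.Eventually.of_forall fun y => Set.mem_range_self _

theorem tendsto_extChartAt_symm (hq : q ∈ (chartAt HD r).source) :
    Filter.Tendsto (extChartAt I r).symm (𝓝[Set.range I] (extChartAt I r q)) (𝓝 q) := by
  have h1 : ContinuousAt (extChartAt I r).symm (extChartAt I r q) :=
    continuousAt_extChartAt_symm' (by simpa using hq)
  have h2 := h1.tendsto.mono_left (nhdsWithin_le_nhds (s := Set.range I))
  rwa [(extChartAt I r).left_inv (by simpa using hq)] at h2

theorem jetAt_congr (hq : q ∈ (chartAt HD r).source) (hhg : h =ᶠ[𝓝 q] g) :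
    jetAt I r j h q = jetAt I r j g q := by
  have h1 : h ∘ (extChartAt I r).symm =ᶠ[𝓝[Set.range I] (extChartAt I r q)]
      g ∘ (extChartAt I r).symm := (tendsto_extChartAt_symm hq).eventually hhg
  exact h1.iteratedFDerivWithin_eq (h1.self_of_nhdsWithin (Set.mem_range_self _)) j

theorem jetAt_zero_apply (hq : q ∈ (chartAt HD r).source) (v : Fin 0 → ED) :
    jetAt I r 0 h q v = h q := by
  rw [jetAt, iteratedFDerivWithin_zero_apply, Function.comp_apply,
    (extChartAt I r).left_inv (by simpa using hq)]

theorem norm_jetAt_zero (hq : q ∈ (chartAt HD r).source) : ‖jetAt I r 0 h q‖ = ‖h q‖ := by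
  rw [jetAt, norm_iteratedFDerivWithin_zero, Function.comp_apply,
    (extChartAt I r).left_inv (by simpa using hq)]

theorem jetAt_add (hq : q ∈ (chartAt HD r).source) (hj : j ≤ k)
    (hh : ContMDiffAt I 𝓘(ℝ, F) k h q) (hg : ContMDiffAt I 𝓘(ℝ, F) k g q) :
    jetAt I r j (fun q => h q + g q) q = jetAt I r j h q + jetAt I r j g q := by
  have hj' : (j : WithTop ℕ∞) ≤ k := by exact_mod_cast hj
  exact iteratedFDerivWithin_add_apply
    ((contDiffWithinAt_comp_extChartAt_symm hq hh).of_le hj')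
    ((contDiffWithinAt_comp_extChartAt_symm hq hg).of_le hj') I.uniqueDiffOn (Set.mem_range_self _)

theorem jetAt_smul (hq : q ∈ (chartAt HD r).source) (hj : j ≤ k)
    (hh : ContMDiffAt I 𝓘(ℝ, F) k h q) (c : ℝ) :
    jetAt I r j (fun q => c • h q) q = c • jetAt I r j h q := by
  have hj' : (j : WithTop ℕ∞) ≤ k := by exact_mod_cast hj
  exact iteratedFDerivWithin_const_smul_apply
    ((contDiffWithinAt_comp_extChartAt_symm hq hh).of_le hj') I.uniqueDiffOn (Set.mem_range_self _)

theorem continuousAt_jetAt (hq : q ∈ (chartAt HD r).source) (hj : j ≤ k)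
    (hh : ContMDiffAt I 𝓘(ℝ, F) k h q) : ContinuousAt (jetAt I r j h) q :=
  ((contDiffWithinAt_comp_extChartAt_symm hq hh).continuousWithinAt_iteratedFDerivWithin
    I.uniqueDiffOn (by exact_mod_cast hj) (Set.mem_range_self _)).tendsto.comp
      (tendsto_extChartAt_nhdsWithin hq)

/-- The jets of a function in one chart are bounded by its jets in another chart, with a constant
that does not depend on the function. -/
theorem exists_jetAt_chart_change_le (hr : q₀ ∈ (chartAt HD r).source)
    (hr' : q₀ ∈ (chartAt HD r').source) (F : Type*) [NormedAddCommGroup F] [NormedSpace ℝ F]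
    (hj : j ≤ k) : ∃ C : ℝ, 0 ≤ C ∧ ∀ᶠ q in 𝓝 q₀, ∀ h : D → F, ContMDiffAt I 𝓘(ℝ, F) k h q →
      ‖jetAt I r' j h q‖ ≤ C * ∑ i ∈ Finset.range (j + 1), ‖jetAt I r i h q‖ := by
  have hsm : ∀ q ∈ (chartAt HD r).source, ContMDiffAt I 𝓘(ℝ, ED) k (extChartAt I r) q := by
    intro q hq
    exact (contMDiffAt_extChartAt' (n := ∞) hq).of_le (by exact_mod_cast le_top)
  let B : D → ℝ := fun q => ∑ c : OrderedFinpartition j,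
    ∏ m, ‖jetAt I r' (c.partSize m) (extChartAt I r) q‖
  have hB : ContinuousAt B q₀ := by
    refine tendsto_finsetSum _ fun c _ => tendsto_finsetProd _ fun m _ => ?_
    exact (continuousAt_jetAt hr' (le_trans (c.partSize_le m) hj) (hsm q₀ hr)).norm
  have hBnn : ∀ q, 0 ≤ B q := fun q => Finset.sum_nonneg fun c _ =>
    Finset.prod_nonneg fun m _ => norm_nonneg _
  refine ⟨B q₀ + 1, by have := hBnn q₀; linarith, ?_⟩
  filter_upwards [hB.eventually (eventually_le_nhds (lt_add_one (B q₀))),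
    (chartAt HD r).open_source.mem_nhds hr, (chartAt HD r').open_source.mem_nhds hr']
    with q hBq hq hq' h hh
  have hz : extChartAt I r' q ∈ Set.range I := Set.mem_range_self _
  have hback : (extChartAt I r').symm (extChartAt I r' q) = q :=
    (extChartAt I r').left_inv (by simpa using hq')
  set τ : ED → ED := extChartAt I r ∘ (extChartAt I r').symm with hτ
  have hτz : τ (extChartAt I r' q) = extChartAt I r q := by rw [hτ, Function.comp_apply, hback]
  have h1 : h ∘ (extChartAt I r').symm =ᶠ[𝓝[Set.range I] (extChartAt I r' q)]
      (h ∘ (extChartAt I r).symm) ∘ τ := by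
    filter_upwards [(tendsto_extChartAt_symm hq').eventually
      ((chartAt HD r).open_source.mem_nhds hq)] with z hz
    simp only [hτ, Function.comp_apply]
    have hz' : (extChartAt I r').symm z ∈ (extChartAt I r).source := by
      rw [extChartAt_source]; exact hz
    rw [(extChartAt I r).left_inv hz']
  have h2 : ContDiffWithinAt ℝ k (h ∘ (extChartAt I r).symm) (Set.range I)
      (τ (extChartAt I r' q)) := by
    rw [hτz]
    exact contDiffWithinAt_comp_extChartAt_symm hq hh
  have hτs : ContDiffWithinAt ℝ k τ (Set.range I) (extChartAt I r' q) :=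
    contDiffWithinAt_comp_extChartAt_symm hq' (hsm q hq)
  have h3 : jetAt I r' j h q = _ := (h1.iteratedFDerivWithin_eq (h1.self_of_nhdsWithin hz) j).trans
    (iteratedFDerivWithin_comp h2 hτs I.uniqueDiffOn I.uniqueDiffOn hz
      (fun y _ => Set.mem_range_self _) (by exact_mod_cast hj))
  rw [h3, hτz]
  have hS : ∀ i ≤ j, ‖jetAt I r i h q‖ ≤ ∑ i ∈ Finset.range (j + 1), ‖jetAt I r i h q‖ :=
    fun i hi => Finset.single_le_sum (f := fun i => ‖jetAt I r i h q‖)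
      (fun i _ => norm_nonneg _) (Finset.mem_range_succ_iff.2 hi)
  calc _ ≤ ∑ c : OrderedFinpartition j, ‖jetAt I r c.length h q‖ *
        ∏ m, ‖jetAt I r' (c.partSize m) (extChartAt I r) q‖ := by
        refine (norm_sum_le _ _).trans (Finset.sum_le_sum fun c _ => ?_)
        exact c.norm_compAlongOrderedFinpartition_le _ _
    _ ≤ ∑ c : OrderedFinpartition j, (∑ i ∈ Finset.range (j + 1), ‖jetAt I r i h q‖) *
        ∏ m, ‖jetAt I r' (c.partSize m) (extChartAt I r) q‖ := by
        refine Finset.sum_le_sum fun c _ => mul_le_mul_of_nonneg_right (hS _ c.length_le)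
          (Finset.prod_nonneg fun m _ => norm_nonneg _)
    _ = B q * ∑ i ∈ Finset.range (j + 1), ‖jetAt I r i h q‖ := by
        rw [← Finset.mul_sum, mul_comm]
    _ ≤ _ := mul_le_mul_of_nonneg_right hBq (Finset.sum_nonneg fun i _ => norm_nonneg _)

/-- The jets of a product with an operator valued function are bounded by the jets of the second
factor, with a constant that does not depend on the second factor. -/
theorem exists_jetAt_clm_apply_le {G : Type*} [NormedAddCommGroup G] [NormedSpace ℝ G]
    {a : D → F →L[ℝ] G} (hr : q₀ ∈ (chartAt HD r).source)
    (ha : ∀ᶠ q in 𝓝 q₀, ContMDiffAt I 𝓘(ℝ, F →L[ℝ] G) k a q) (hj : j ≤ k) :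
    ∃ C : ℝ, 0 ≤ C ∧ ∀ᶠ q in 𝓝 q₀, ∀ h : D → F, ContMDiffAt I 𝓘(ℝ, F) k h q →
      ‖jetAt I r j (fun q => a q (h q)) q‖ ≤
        C * ∑ i ∈ Finset.range (j + 1), ‖jetAt I r i h q‖ := by
  let B : D → ℝ := fun q => ∑ i ∈ Finset.range (j + 1), j.choose i * ‖jetAt I r i a q‖
  have hB : ContinuousAt B q₀ := by
    refine tendsto_finsetSum _ fun i hi => Filter.Tendsto.const_mul _ ?_
    exact (continuousAt_jetAt hr (le_trans (Finset.mem_range_succ_iff.1 hi) hj)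
      ha.self_of_nhds).norm
  have hBnn : ∀ q, 0 ≤ B q := fun q => Finset.sum_nonneg fun c _ => by positivity
  refine ⟨B q₀ + 1, by have := hBnn q₀; linarith, ?_⟩
  filter_upwards [hB.eventually (eventually_le_nhds (lt_add_one (B q₀))),
    (chartAt HD r).open_source.mem_nhds hr, ha] with q hBq hq haq h hh
  have hj' : (j : WithTop ℕ∞) ≤ k := by exact_mod_cast hj
  have hS : ∀ i ≤ j, ‖jetAt I r i h q‖ ≤ ∑ i ∈ Finset.range (j + 1), ‖jetAt I r i h q‖ :=
    fun i hi => Finset.single_le_sum (f := fun i => ‖jetAt I r i h q‖)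
      (fun i _ => norm_nonneg _) (Finset.mem_range_succ_iff.2 hi)
  calc ‖jetAt I r j (fun q => a q (h q)) q‖
      ≤ ∑ i ∈ Finset.range (j + 1), j.choose i * ‖jetAt I r i a q‖ * ‖jetAt I r (j - i) h q‖ :=
        norm_iteratedFDerivWithin_clm_apply_at
          ((contDiffWithinAt_comp_extChartAt_symm hq haq).of_le hj')
          ((contDiffWithinAt_comp_extChartAt_symm hq hh).of_le hj') I.uniqueDiffOn
          (Set.mem_range_self _)
    _ ≤ ∑ i ∈ Finset.range (j + 1), j.choose i * ‖jetAt I r i a q‖ *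
          ∑ i ∈ Finset.range (j + 1), ‖jetAt I r i h q‖ := by
        refine Finset.sum_le_sum fun i _ => ?_
        have := hS (j - i) (Nat.sub_le _ _)
        gcongr
    _ = B q * ∑ i ∈ Finset.range (j + 1), ‖jetAt I r i h q‖ := by rw [← Finset.sum_mul]
    _ ≤ _ := mul_le_mul_of_nonneg_right hBq (Finset.sum_nonneg fun i _ => norm_nonneg _)

variable {X : Type*} [NormedAddCommGroup X] [NormedSpace ℝ X]

variable (I) in
/-- A linear family `v ↦ (q ↦ w q v)` of functions on `D`, parametrized by a normed space, is
`C^k`-bounded near `q₀` if it consists of functions of class `C^k`, whose derivatives up to the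
order `k` in the chart at `r` are bounded by the norm of the parameter. -/
structure CkBounded (k : ℕ) (r q₀ : D) (w : D → X →L[ℝ] F) : Prop where
  mem : q₀ ∈ (chartAt HD r).source
  smooth : ∀ᶠ q in 𝓝 q₀, ∀ v, ContMDiffAt I 𝓘(ℝ, F) k (fun q => w q v) q
  bound : ∀ j ≤ k, ∃ C : ℝ, 0 ≤ C ∧ ∀ᶠ q in 𝓝 q₀, ∀ v,
    ‖jetAt I r j (fun q => w q v) q‖ ≤ C * ‖v‖

namespace CkBounded

variable {w w' : D → X →L[ℝ] F}

theorem bound_sum (hw : CkBounded I k r q₀ w) (hj : j ≤ k) : ∃ C : ℝ, 0 ≤ C ∧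
    ∀ᶠ q in 𝓝 q₀, ∀ v, ∑ i ∈ Finset.range (j + 1), ‖jetAt I r i (fun q => w q v) q‖ ≤
      C * ‖v‖ := by
  have h : ∀ i : ℕ, ∃ C : ℝ, 0 ≤ C ∧ (i ≤ k → ∀ᶠ q in 𝓝 q₀, ∀ v,
      ‖jetAt I r i (fun q => w q v) q‖ ≤ C * ‖v‖) := by
    intro i
    by_cases hi : i ≤ k
    · obtain ⟨C, hC, h⟩ := hw.bound i hi
      exact ⟨C, hC, fun _ => h⟩
    · exact ⟨0, le_rfl, fun h => absurd h hi⟩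
  choose C hC h using h
  refine ⟨∑ i ∈ Finset.range (j + 1), C i, Finset.sum_nonneg fun i _ => hC i, ?_⟩
  have h' : ∀ᶠ q in 𝓝 q₀, ∀ i ∈ Finset.range (j + 1), ∀ v,
      ‖jetAt I r i (fun q => w q v) q‖ ≤ C i * ‖v‖ :=
    (Filter.eventually_all_finset _).2 fun i hi =>
      h i (le_trans (Finset.mem_range_succ_iff.1 hi) hj)
  filter_upwards [h'] with q hq v
  rw [Finset.sum_mul]
  exact Finset.sum_le_sum fun i hi => hq i hi v

theorem chart_change (hw : CkBounded I k r q₀ w) (hr' : q₀ ∈ (chartAt HD r').source) :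
    CkBounded I k r' q₀ w := by
  refine ⟨hr', hw.smooth, fun j hj => ?_⟩
  obtain ⟨C, hC, h⟩ := exists_jetAt_chart_change_le (I := I) hw.mem hr' F hj
  obtain ⟨C', hC', h'⟩ := hw.bound_sum hj
  refine ⟨C * C', by positivity, ?_⟩
  filter_upwards [h, h', hw.smooth] with q hq hq' hs v
  refine (hq _ (hs v)).trans ?_
  rw [mul_assoc]
  exact mul_le_mul_of_nonneg_left (hq' v) hC

theorem congr (hw : CkBounded I k r q₀ w) (h : ∀ᶠ q in 𝓝 q₀, w' q = w q) :
    CkBounded I k r q₀ w' := by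
  have h1 : ∀ᶠ q in 𝓝 q₀, ∀ v, (fun q => w' q v) =ᶠ[𝓝 q] fun q => w q v := by
    filter_upwards [h.eventually_nhds] with q hq v
    filter_upwards [hq] with q' hq'
    rw [hq']
  refine ⟨hw.mem, ?_, fun j hj => ?_⟩
  · filter_upwards [h1, hw.smooth] with q hq hs v
    exact (hs v).congr_of_eventuallyEq (hq v)
  · obtain ⟨C, hC, hb⟩ := hw.bound j hj
    refine ⟨C, hC, ?_⟩
    filter_upwards [h1, hb, (chartAt HD r).open_source.mem_nhds hw.mem] with q hq hs hqr v
    rw [jetAt_congr hqr (hq v)]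
    exact hs v

theorem clm_comp {G : Type*} [NormedAddCommGroup G] [NormedSpace ℝ G]
    (hw : CkBounded I k r q₀ w) {a : D → F →L[ℝ] G}
    (ha : ∀ᶠ q in 𝓝 q₀, ContMDiffAt I 𝓘(ℝ, F →L[ℝ] G) k a q) :
    CkBounded I k r q₀ (fun q => (a q).comp (w q)) := by
  refine ⟨hw.mem, ?_, fun j hj => ?_⟩
  · filter_upwards [hw.smooth, ha] with q hq ha v
    have h : ContMDiffAt I 𝓘(ℝ, G) k (fun q => a q (w q v)) q := ContMDiffAt.clm_apply ha (hq v)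
    exact h
  · obtain ⟨C, hC, h⟩ := exists_jetAt_clm_apply_le (I := I) hw.mem ha hj
    obtain ⟨C', hC', h'⟩ := hw.bound_sum hj
    refine ⟨C * C', by positivity, ?_⟩
    filter_upwards [h, h', hw.smooth] with q hq hq' hs v
    refine (hq _ (hs v)).trans ?_
    rw [mul_assoc]
    exact mul_le_mul_of_nonneg_left (hq' v) hC

theorem comp_clm {X' : Type*} [NormedAddCommGroup X'] [NormedSpace ℝ X']
    (hw : CkBounded I k r q₀ w) (L : X' →L[ℝ] X) :
    CkBounded I k r q₀ (fun q => (w q).comp L) := by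
  refine ⟨hw.mem, ?_, fun j hj => ?_⟩
  · filter_upwards [hw.smooth] with q hq v
    exact hq (L v)
  · obtain ⟨C, hC, h⟩ := hw.bound j hj
    refine ⟨C * ‖L‖, by positivity, ?_⟩
    filter_upwards [h] with q hq v
    refine (hq (L v)).trans ?_
    rw [mul_assoc]
    exact mul_le_mul_of_nonneg_left (L.le_opNorm v) hC

theorem add (hw : CkBounded I k r q₀ w) (hw' : CkBounded I k r q₀ w') :
    CkBounded I k r q₀ (fun q => w q + w' q) := by
  refine ⟨hw.mem, ?_, fun j hj => ?_⟩
  · filter_upwards [hw.smooth, hw'.smooth] with q hq hq' v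
    exact (hq v).add (hq' v)
  · obtain ⟨C, hC, h⟩ := hw.bound j hj
    obtain ⟨C', hC', h'⟩ := hw'.bound j hj
    refine ⟨C + C', by positivity, ?_⟩
    filter_upwards [h, h', hw.smooth, hw'.smooth, (chartAt HD r).open_source.mem_nhds hw.mem]
      with q hq hq' hs hs' hqr v
    have h1 := jetAt_add hqr hj (hs v) (hs' v)
    change ‖jetAt I r j (fun q => w q v + w' q v) q‖ ≤ _
    rw [h1, add_mul]
    exact (norm_add_le _ _).trans (add_le_add (hq v) (hq' v))

theorem prod {G : Type*} [NormedAddCommGroup G] [NormedSpace ℝ G] {w'' : D → X →L[ℝ] G}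
    (hw : CkBounded I k r q₀ w) (hw'' : CkBounded I k r q₀ w'') :
    CkBounded I k r q₀ (fun q => (w q).prod (w'' q)) := by
  have h1 := hw.clm_comp (a := fun _ => ContinuousLinearMap.inl ℝ F G)
    (Filter.Eventually.of_forall fun _ => contMDiffAt_const)
  have h2 := hw''.clm_comp (a := fun _ => ContinuousLinearMap.inr ℝ F G)
    (Filter.Eventually.of_forall fun _ => contMDiffAt_const)
  refine (h1.add h2).congr (Filter.Eventually.of_forall fun q => ?_)
  ext v <;> simp

end CkBounded

end Jets

/-! ### Spaces of fields of class `C^k` -/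

section Fields

variable {ED : Type*} [NormedAddCommGroup ED] [NormedSpace ℝ ED] {HD : Type*} [TopologicalSpace HD]
  {I : ModelWithCorners ℝ ED HD} {D : Type*} [TopologicalSpace D] [ChartedSpace HD D]
  {E : Type*} [NormedAddCommGroup E] [NormedSpace ℝ E]
  {M : Type*} [TopologicalSpace M] [ChartedSpace E M] [IsManifold 𝓘(ℝ, E) ∞ M]
  {k : ℕ} [CompactSpace D] [T2Space D] [IsManifold I ∞ D]

theorem fieldTriv_apply (x : D → M) (p : D) (v : ∀ q, TangentSpace 𝓘(ℝ, E) (x q)) (q : D) :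
    fieldTriv x p v q =
      fderiv ℝ (chartAt E (x p) ∘ (chartAt E (x q)).symm) (chartAt E (x q) (x q)) (v q) :=
  trivializationAt_snd _ _

theorem fieldTriv_self (x : D → M) (v : ∀ q, TangentSpace 𝓘(ℝ, E) (x q)) (q : D) :
    fieldTriv x q v q = v q := by
  rw [fieldTriv_apply, fderiv_chart_trans_self (mem_chart_source E (x q))]
  rfl

theorem fieldTriv_change (x : D → M) {p p' q : D} (v : ∀ q, TangentSpace 𝓘(ℝ, E) (x q))
    (h : x q ∈ (chartAt E (x p)).source) (h' : x q ∈ (chartAt E (x p')).source) :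
    fieldTriv x p' v q =
      fderiv ℝ (chartAt E (x p') ∘ (chartAt E (x p)).symm) (chartAt E (x p) (x q))
        (fieldTriv x p v q) := by
  rw [fieldTriv_apply, fieldTriv_apply, fderiv_chart_trans_comp (mem_chart_source E (x q)) h h']
  rfl

variable {x : C^k⟮I, D; 𝓘(ℝ, E), M⟯}

theorem contMDiffAt_fieldTriv {p q : D} (hq : x q ∈ (chartAt E (x p)).source) (v : CkField x) :
    ContMDiffAt I 𝓘(ℝ, E) k (fieldTriv x p v.val) q :=
  (contMDiffAt_fieldMap_iff x hq v.val).1 (v.contMDiff q)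

theorem jetNorm_eq (p : D) (j : ℕ) (v : CkField x) (q : D) :
    jetNorm p j v q = ‖jetAt I p j (fieldTriv x p v.val) q‖ := rfl

/-- The norm of a field dominates its derivatives at all points of the compact sets of the cover. -/
theorem jetNorm_le_norm {p q : D} (hp : p ∈ (chartCover x).pts) {j : ℕ} (hj : j ≤ k)
    (hq : q ∈ (chartCover x).cpt p) (v : CkField x) : jetNorm p j v q ≤ ‖v‖ := by
  have hnn : ∀ (p : D) (j : ℕ), 0 ≤ ⨆ q : (chartCover x).cpt p, jetNorm p j v q := fun p j =>
    Real.iSup_nonneg fun q => jetNorm_nonneg p j v q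
  rw [norm_def]
  refine (le_ciSup (bddAbove_jetNorm v hp hj) (⟨q, hq⟩ : (chartCover x).cpt p)).trans ?_
  refine (Finset.single_le_sum (f := fun j => ⨆ q : (chartCover x).cpt p, jetNorm p j v q)
    (fun j _ => hnn p j) (Finset.mem_range_succ_iff.2 hj)).trans ?_
  exact Finset.single_le_sum (f := fun p => ∑ j ∈ Finset.range (k + 1),
    ⨆ q : (chartCover x).cpt p, jetNorm p j v q)
    (fun p _ => Finset.sum_nonneg fun j _ => hnn p j) hp

variable (x) in
/-- The number of pairs of a chart of the cover and an order of differentiation, as a real number. -/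
noncomputable def coverCard : ℝ := ∑ _p ∈ (chartCover x).pts, ∑ _j ∈ Finset.range (k + 1), (1 : ℝ)

theorem coverCard_nonneg : 0 ≤ coverCard x :=
  Finset.sum_nonneg fun _ _ => Finset.sum_nonneg fun _ _ => zero_le_one

/-- The norm of a field is bounded by its derivatives, i.e. these form a norming family. -/
theorem norm_le_of_jetNorm_le {v : CkField x} {r : ℝ} (hr : 0 ≤ r)
    (h : ∀ p ∈ (chartCover x).pts, ∀ j ≤ k, ∀ q ∈ (chartCover x).cpt p, jetNorm p j v q ≤ r) :
    ‖v‖ ≤ coverCard x * r := by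
  rw [norm_def, coverCard, Finset.sum_mul]
  refine Finset.sum_le_sum fun p hp => ?_
  rw [Finset.sum_mul]
  refine Finset.sum_le_sum fun j hj => ?_
  rw [one_mul]
  exact Real.iSup_le (fun q => h p hp j (Finset.mem_range_succ_iff.1 hj) q q.2) hr

theorem exists_norm_fieldTriv_le (p q : D) :
    ∃ C : ℝ, ∀ v : CkField x, ‖fieldTriv x p v.val q‖ ≤ C * ‖v‖ := by
  obtain ⟨p₀, hp₀, hq⟩ := (chartCover x).cover q
  have hq := interior_subset hq
  have hs := (chartCover x).subset p₀ hp₀ hq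
  refine ⟨‖fderiv ℝ (chartAt E (x p) ∘ (chartAt E (x q)).symm) (chartAt E (x q) (x q))‖ *
    ‖fderiv ℝ (chartAt E (x q) ∘ (chartAt E (x p₀)).symm) (chartAt E (x p₀) (x q))‖,
    fun v => ?_⟩
  have h1 : v.val q = fderiv ℝ (chartAt E (x q) ∘ (chartAt E (x p₀)).symm)
      (chartAt E (x p₀) (x q)) (fieldTriv x p₀ v.val q) := by
    rw [← fieldTriv_change x v.val hs.2 (mem_chart_source E (x q)), fieldTriv_self]
  have h2 : ‖fieldTriv x p₀ v.val q‖ ≤ ‖v‖ := by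
    have := jetNorm_le_norm hp₀ (Nat.zero_le k) hq v
    rwa [jetNorm_eq, norm_jetAt_zero hs.1] at this
  rw [fieldTriv_apply, h1, mul_assoc]
  refine (ContinuousLinearMap.le_opNorm _ _).trans (mul_le_mul_of_nonneg_left ?_ (norm_nonneg _))
  exact (ContinuousLinearMap.le_opNorm _ _).trans
    (mul_le_mul_of_nonneg_left h2 (norm_nonneg _))

variable (x) in
/-- The value at `q` of a field along `x`, in the trivialization of the tangent bundle at `x p`, as
a continuous linear map. -/
noncomputable def evTriv (p q : D) : CkField x →L[ℝ] E :=
  LinearMap.mkContinuousOfExistsBound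
    { toFun := fun v => fieldTriv x p v.val q
      map_add' := fun v w => by
        simp only [fieldTriv_apply]
        exact map_add (fderiv ℝ (chartAt E (x p) ∘ (chartAt E (x q)).symm) (chartAt E (x q) (x q)))
          (v.val q) (w.val q)
      map_smul' := fun c v => by
        simp only [fieldTriv_apply]
        exact map_smul (fderiv ℝ (chartAt E (x p) ∘ (chartAt E (x q)).symm)
          (chartAt E (x q) (x q))) c (v.val q) }
    (exists_norm_fieldTriv_le p q)

@[simp]
theorem evTriv_apply (p q : D) (v : CkField x) : evTriv x p q v = fieldTriv x p v.val q := rfl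

theorem evTriv_change {p p' q : D} (h : x q ∈ (chartAt E (x p)).source)
    (h' : x q ∈ (chartAt E (x p')).source) :
    evTriv x p' q = (fderiv ℝ (chartAt E (x p') ∘ (chartAt E (x p)).symm)
      (chartAt E (x p) (x q))).comp (evTriv x p q) := by
  ext v
  exact fieldTriv_change x v.val h h'

theorem eventually_mem_chartAt_source {p q : D} (h : x q ∈ (chartAt E (x p)).source) :
    ∀ᶠ q' in 𝓝 q, x q' ∈ (chartAt E (x p)).source :=
  x.contMDiff.continuous.continuousAt.eventually ((chartAt E (x p)).open_source.mem_nhds h)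

theorem contMDiffAt_chartAt_comp {m : M} {q : D} (h : x q ∈ (chartAt E m).source) :
    ContMDiffAt I 𝓘(ℝ, E) k (fun q => chartAt E m (x q)) q := by
  have h1 : ContMDiffAt 𝓘(ℝ, E) 𝓘(ℝ, E) k (chartAt E m) (x q) :=
    (contMDiffAt_of_mem_maximalAtlas (I := 𝓘(ℝ, E)) (n := ∞)
      (IsManifold.chart_mem_maximalAtlas m) h).of_le (by exact_mod_cast le_top)
  exact h1.comp q (x.contMDiff q)

theorem contMDiffAt_fderiv_chart_trans {p p' q : D} (h : x q ∈ (chartAt E (x p)).source)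
    (h' : x q ∈ (chartAt E (x p')).source) :
    ContMDiffAt I 𝓘(ℝ, E →L[ℝ] E) k (fun q => fderiv ℝ (chartAt E (x p') ∘ (chartAt E (x p)).symm)
      (chartAt E (x p) (x q))) q := by
  have h1 : ContDiffAt ℝ k (fderiv ℝ (chartAt E (x p') ∘ (chartAt E (x p)).symm))
      (chartAt E (x p) (x q)) :=
    ((contDiffAt_chart_trans h h').fderiv_right (m := ∞) (by simp)).of_le
      (by exact_mod_cast le_top)
  exact h1.contMDiffAt.comp q (contMDiffAt_chartAt_comp h)

/-- The evaluations of fields along `x`, in any trivialization, are `C^k`-bounded in any chart. -/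
theorem ckBounded_evTriv {p r q₀ : D} (hr : q₀ ∈ (chartAt HD r).source)
    (hp : x q₀ ∈ (chartAt E (x p)).source) : CkBounded I k r q₀ (evTriv x p) := by
  obtain ⟨p₀, hp₀, hq⟩ := (chartCover x).cover q₀
  have hs := (chartCover x).subset p₀ hp₀ (interior_subset hq)
  have h0 : CkBounded I k p₀ q₀ (evTriv x p₀) := by
    refine ⟨hs.1, ?_, fun j hj => ⟨1, zero_le_one, ?_⟩⟩
    · filter_upwards [eventually_mem_chartAt_source hs.2] with q hq v
      exact contMDiffAt_fieldTriv hq v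
    · filter_upwards [mem_interior_iff_mem_nhds.1 hq] with q hq v
      rw [one_mul]
      exact jetNorm_le_norm hp₀ hj hq v
  have h1 := h0.clm_comp (a := fun q => fderiv ℝ (chartAt E (x p) ∘ (chartAt E (x p₀)).symm)
      (chartAt E (x p₀) (x q))) (by
    filter_upwards [eventually_mem_chartAt_source hs.2, eventually_mem_chartAt_source hp]
      with q hq hq'
    exact contMDiffAt_fderiv_chart_trans hq hq')
  refine (h1.congr ?_).chart_change hr
  filter_upwards [eventually_mem_chartAt_source hs.2, eventually_mem_chartAt_source hp]
    with q hq hq'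
  exact evTriv_change hq hq'

end Fields

section Complete

variable {V G : Type*} [NormedAddCommGroup V] [NormedSpace ℝ V] [NormedAddCommGroup G]
  [NormedSpace ℝ G]

/-- If the derivatives of order at most `k` of a sequence of functions converge uniformly on a
convex set, then the limit is of class `C^k`, and its derivatives are the limits. -/
theorem contDiffOn_of_tendstoUniformlyOn_iteratedFDerivWithin {s : Set V} (hs : Convex ℝ s)
    (hu : UniqueDiffOn ℝ s) {k : ℕ} {f : ℕ → V → G} {g : V → G} (hf : ∀ n, ContDiffOn ℝ k (f n) s)
    {J : ∀ j : ℕ, V → V [×j]→L[ℝ] G}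
    (hJ : ∀ j ≤ k, TendstoUniformlyOn (fun n => iteratedFDerivWithin ℝ j (f n) s) (J j)
      Filter.atTop s)
    (hg : ∀ z ∈ s, Filter.Tendsto (fun n => f n z) Filter.atTop (𝓝 (g z))) :
    ContDiffOn ℝ k g s ∧ ∀ j ≤ k, ∀ z ∈ s, iteratedFDerivWithin ℝ j g s z = J j z := by
  have hp : HasFTaylorSeriesUpToOn (k : ℕ) g (fun z j => J j z) s := by
    refine ⟨fun z hz => ?_, fun m hm z hz => ?_, fun m hm => ?_⟩
    · have h0 := ((hJ 0 (Nat.zero_le k)).tendsto_at hz)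
      have h1 : Filter.Tendsto (fun n => (iteratedFDerivWithin ℝ 0 (f n) s z).curry0)
          Filter.atTop (𝓝 (J 0 z).curry0) :=
        ((ContinuousMultilinearMap.apply ℝ (fun _ : Fin 0 => V) G 0).continuous.tendsto _).comp h0
      exact tendsto_nhds_unique h1 (hg z hz)
    · have hm' : m + 1 ≤ k := by
        have hm1 : m < k := by exact_mod_cast hm
        exact hm1
      have hmk : m ≤ k := (Nat.le_succ m).trans hm'
      have h1 : ∀ n, ∀ z ∈ s, HasFDerivWithinAt (iteratedFDerivWithin ℝ m (f n) s)
          (iteratedFDerivWithin ℝ (m + 1) (f n) s z).curryLeft s z := by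
        intro n z hz
        exact ((hf n).ftaylorSeriesWithin hu).fderivWithin m hm z hz
      have h2 : TendstoUniformlyOn
          (fun n z => (iteratedFDerivWithin ℝ (m + 1) (f n) s z).curryLeft)
          (fun z => (J (m + 1) z).curryLeft) Filter.atTop s :=
        (continuousMultilinearCurryLeftEquiv ℝ (fun _ : Fin (m + 1) => V) G
          |>.isometry.uniformContinuous).comp_tendstoUniformlyOn (hJ (m + 1) hm')
      exact hasFDerivWithinAt_of_tendstoUniformlyOn hs h1
        (fun z hz => (hJ m hmk).tendsto_at hz) h2 hz
    · have hmk : m ≤ k := by exact_mod_cast hm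
      refine (hJ m hmk).continuousOn (Filter.Eventually.frequently (Filter.Eventually.of_forall
        fun n => (hf n).continuousOn_iteratedFDerivWithin (by exact_mod_cast hmk) hu))
  refine ⟨fun z hz => hp.contDiffOn z hz, fun j hj z hz => ?_⟩
  exact (hp.eq_iteratedFDerivWithin_of_uniqueDiffOn (by exact_mod_cast hj) hu hz).symm

end Complete

section Fields

variable {ED : Type*} [NormedAddCommGroup ED] [NormedSpace ℝ ED] {HD : Type*} [TopologicalSpace HD]
  {I : ModelWithCorners ℝ ED HD} {D : Type*} [TopologicalSpace D] [ChartedSpace HD D]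
  [IsManifold I ∞ D] {k : ℕ}

/-- The jet at a point, as a continuous linear map of the parameter of a linear family. -/
theorem exists_jet_clm {F X : Type*} [NormedAddCommGroup F] [NormedSpace ℝ F]
    [NormedAddCommGroup X] [NormedSpace ℝ X] {w : D → X →L[ℝ] F} {r q : D} {j : ℕ}
    (hq : q ∈ (chartAt HD r).source) (hj : j ≤ k)
    (hs : ∀ v, ContMDiffAt I 𝓘(ℝ, F) k (fun q => w q v) q) {C : ℝ} (hC : 0 ≤ C)
    (hb : ∀ v, ‖jetAt I r j (fun q => w q v) q‖ ≤ C * ‖v‖) :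
    ∃ L : X →L[ℝ] ED [×j]→L[ℝ] F, (∀ v, L v = jetAt I r j (fun q => w q v) q) ∧ ‖L‖ ≤ C := by
  let L : X →ₗ[ℝ] ED [×j]→L[ℝ] F :=
    { toFun := fun v => jetAt I r j (fun q => w q v) q
      map_add' := fun v v' => by
        rw [← jetAt_add hq hj (hs v) (hs v')]
        simp only [map_add]
      map_smul' := fun c v => by
        rw [RingHom.id_apply, ← jetAt_smul hq hj (hs v)]
        simp only [map_smul] }
  exact ⟨L.mkContinuous C hb, fun v => rfl, L.mkContinuous_norm_le hC hb⟩

variable {E : Type*} [NormedAddCommGroup E] [NormedSpace ℝ E]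
  {M : Type*} [TopologicalSpace M] [ChartedSpace E M] [IsManifold 𝓘(ℝ, E) ∞ M]
  [CompactSpace D] [T2Space D] {x : C^k⟮I, D; 𝓘(ℝ, E), M⟯}

theorem exists_jet_clm_evTriv {p q : D} (hp : p ∈ (chartCover x).pts) {j : ℕ} (hj : j ≤ k)
    (hq : q ∈ (chartCover x).cpt p) : ∃ L : CkField x →L[ℝ] ED [×j]→L[ℝ] E,
      (∀ v, L v = jetAt I p j (fieldTriv x p v.val) q) ∧ ‖L‖ ≤ 1 := by
  have hs := (chartCover x).subset p hp hq
  exact exists_jet_clm (w := evTriv x p) hs.1 hj (fun v => contMDiffAt_fieldTriv hs.2 v)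
    zero_le_one fun v => by
      rw [one_mul]
      exact jetNorm_le_norm hp hj hq v

/-- At a fixed point, the derivatives of a field in one chart are bounded by those in another. -/
theorem exists_jetNorm_change_le {p p' q : D}
    (hq : q ∈ (chartAt HD p).source ∩ x ⁻¹' (chartAt E (x p)).source)
    (hq' : q ∈ (chartAt HD p').source ∩ x ⁻¹' (chartAt E (x p')).source) {j : ℕ} (hj : j ≤ k) :
    ∃ C : ℝ, ∀ v : CkField x,
      jetNorm p' j v q ≤ C * ∑ i ∈ Finset.range (k + 1), jetNorm p i v q := by
  let a : D → E →L[ℝ] E := fun q => fderiv ℝ (chartAt E (x p') ∘ (chartAt E (x p)).symm)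
    (chartAt E (x p) (x q))
  have ha : ∀ᶠ q in 𝓝 q, ContMDiffAt I 𝓘(ℝ, E →L[ℝ] E) k a q := by
    filter_upwards [eventually_mem_chartAt_source hq.2, eventually_mem_chartAt_source hq'.2]
      with q hq hq'
    exact contMDiffAt_fderiv_chart_trans hq hq'
  obtain ⟨C, hC, h⟩ := exists_jetAt_chart_change_le (I := I) hq.1 hq'.1 E hj
  have h' : ∀ i : ℕ, ∃ C' : ℝ, 0 ≤ C' ∧ (i ≤ k → ∀ h : D → E, ContMDiffAt I 𝓘(ℝ, E) k h q →
      ‖jetAt I p i (fun q => a q (h q)) q‖ ≤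
        C' * ∑ i ∈ Finset.range (i + 1), ‖jetAt I p i h q‖) := by
    intro i
    by_cases hi : i ≤ k
    · obtain ⟨C', hC', h'⟩ := exists_jetAt_clm_apply_le (I := I) hq.1 ha hi
      exact ⟨C', hC', fun _ => h'.self_of_nhds⟩
    · exact ⟨0, le_rfl, fun h => absurd h hi⟩
  choose C' hC' h' using h'
  refine ⟨C * ∑ i ∈ Finset.range (j + 1), C' i, fun v => ?_⟩
  have hv := contMDiffAt_fieldTriv hq.2 v
  have h1 : fieldTriv x p' v.val =ᶠ[𝓝 q] fun q => a q (fieldTriv x p v.val q) := by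
    filter_upwards [eventually_mem_chartAt_source hq.2, eventually_mem_chartAt_source hq'.2]
      with q hq hq'
    exact fieldTriv_change x v.val hq hq'
  rw [jetNorm_eq, mul_assoc]
  refine (h.self_of_nhds _ (contMDiffAt_fieldTriv hq'.2 v)).trans
    (mul_le_mul_of_nonneg_left ?_ hC)
  rw [Finset.sum_mul]
  refine Finset.sum_le_sum fun i hi => ?_
  have hi' : i ≤ k := (Finset.mem_range_succ_iff.1 hi).trans hj
  rw [jetAt_congr hq.1 h1]
  refine (h' i hi' _ hv).trans (mul_le_mul_of_nonneg_left ?_ (hC' i))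
  exact Finset.sum_le_sum_of_subset_of_nonneg (Finset.range_mono (by omega))
    fun i _ _ => norm_nonneg _

/-- The limit of the values of a Cauchy sequence of fields is of class `C^k`, and the jets converge
in the interiors of the compact sets of the cover. -/
theorem contMDiffAt_limit_fieldTriv [CompleteSpace E] {u : ℕ → CkField x} (hu : CauchySeq u)
    {w : ∀ q, TangentSpace 𝓘(ℝ, E) (x q)}
    (hw : ∀ p q, Filter.Tendsto (fun n => fieldTriv x p (u n).val q) Filter.atTop
      (𝓝 (fieldTriv x p w q)))
    {p q : D} (hp : p ∈ (chartCover x).pts) (hq : q ∈ interior ((chartCover x).cpt p)) :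
    ContMDiffAt I 𝓘(ℝ, E) k (fieldTriv x p w) q ∧ ∀ j ≤ k,
      Filter.Tendsto (fun n => jetAt I p j (fieldTriv x p (u n).val) q) Filter.atTop
        (𝓝 (jetAt I p j (fieldTriv x p w) q)) := by
  have hsq := (chartCover x).subset p hp (interior_subset hq)
  have h1 : ∀ᶠ z in 𝓝[Set.range I] (extChartAt I p q),
      (extChartAt I p).symm z ∈ (chartCover x).cpt p ∧ z ∈ (extChartAt I p).target :=
    ((tendsto_extChartAt_symm hsq.1).eventually (mem_interior_iff_mem_nhds.1 hq)).and
      (extChartAt_target_mem_nhdsWithin' (by simpa using hsq.1))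
  obtain ⟨ε, hε, hball⟩ := Metric.mem_nhdsWithin_iff.1 h1
  set z₀ := extChartAt I p q
  let s : Set ED := Set.range I ∩ Metric.ball z₀ ε
  have hz₀ : z₀ ∈ s := ⟨Set.mem_range_self _, Metric.mem_ball_self hε⟩
  have hcv : Convex ℝ s := I.convex_range.inter (convex_ball z₀ ε)
  have hud : UniqueDiffOn ℝ s := I.uniqueDiffOn.inter Metric.isOpen_ball
  let f : ℕ → ED → E := fun n => fieldTriv x p (u n).val ∘ (extChartAt I p).symm
  have hcpt : ∀ z ∈ s, (extChartAt I p).symm z ∈ (chartCover x).cpt p := fun z hz =>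
    (hball ⟨hz.2, hz.1⟩).1
  have hinv : ∀ z ∈ s, extChartAt I p ((extChartAt I p).symm z) = z := fun z hz =>
    (extChartAt I p).right_inv (hball ⟨hz.2, hz.1⟩).2
  have hf : ∀ n, ContDiffOn ℝ k (f n) s := by
    intro n z hz
    have := contDiffWithinAt_fieldTriv ((chartCover x).subset p hp (hcpt z hz)) (u n)
    rw [hinv z hz] at this
    exact this.mono Set.inter_subset_left
  have hjet : ∀ (g : D → E) (j : ℕ), ∀ z ∈ s,
      iteratedFDerivWithin ℝ j (g ∘ (extChartAt I p).symm) s z =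
        jetAt I p j g ((extChartAt I p).symm z) := by
    intro g j z hz
    rw [jetAt, hinv z hz]
    exact iteratedFDerivWithin_inter_open Metric.isOpen_ball hz.2
  have hdist : ∀ j ≤ k, ∀ z ∈ s, ∀ m n, dist (iteratedFDerivWithin ℝ j (f m) s z)
      (iteratedFDerivWithin ℝ j (f n) s z) ≤ dist (u m) (u n) := by
    intro j hj z hz m n
    obtain ⟨L, hL, hL1⟩ := exists_jet_clm_evTriv hp hj (hcpt z hz)
    rw [hjet _ j z hz, hjet _ j z hz, ← hL, ← hL, dist_eq_norm, dist_eq_norm, ← map_sub]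
    simpa using L.le_of_opNorm_le hL1 (u m - u n)
  have hcau : ∀ j ≤ k, ∀ z ∈ s, CauchySeq fun n => iteratedFDerivWithin ℝ j (f n) s z := by
    intro j hj z hz
    refine Metric.cauchySeq_iff.2 fun ε hε => ?_
    obtain ⟨N, hN⟩ := Metric.cauchySeq_iff.1 hu ε hε
    exact ⟨N, fun m hm n hn => (hdist j hj z hz m n).trans_lt (hN m hm n hn)⟩
  let J : ∀ j : ℕ, ED → ED [×j]→L[ℝ] E := fun j z =>
    Filter.atTop.limUnder fun n => iteratedFDerivWithin ℝ j (f n) s z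
  have hJ : ∀ j ≤ k, ∀ z ∈ s, Filter.Tendsto (fun n => iteratedFDerivWithin ℝ j (f n) s z)
      Filter.atTop (𝓝 (J j z)) := fun j hj z hz => (hcau j hj z hz).tendsto_limUnder
  have hJu : ∀ j ≤ k, TendstoUniformlyOn (fun n => iteratedFDerivWithin ℝ j (f n) s) (J j)
      Filter.atTop s := by
    intro j hj
    refine UniformCauchySeqOn.tendstoUniformlyOn_of_tendsto ?_ (hJ j hj)
    refine Metric.uniformCauchySeqOn_iff.2 fun ε hε => ?_
    obtain ⟨N, hN⟩ := Metric.cauchySeq_iff.1 hu ε hε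
    exact ⟨N, fun m hm n hn z hz => (hdist j hj z hz m n).trans_lt (hN m hm n hn)⟩
  obtain ⟨hg, hgJ⟩ := contDiffOn_of_tendstoUniformlyOn_iteratedFDerivWithin hcv hud hf hJu
    (g := fieldTriv x p w ∘ (extChartAt I p).symm) fun z _ => hw p _
  have hback : (extChartAt I p).symm z₀ = q := (extChartAt I p).left_inv (by simpa using hsq.1)
  constructor
  · refine (contMDiffAt_iff_source_of_mem_source hsq.1).2 ?_
    refine ContDiffWithinAt.contMDiffWithinAt ?_
    exact (hg z₀ hz₀).mono_of_mem_nhdsWithin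
      (Filter.inter_mem self_mem_nhdsWithin (mem_nhdsWithin_of_mem_nhds
        (Metric.ball_mem_nhds z₀ hε)))
  · intro j hj
    have h2 := hJ j hj z₀ hz₀
    rw [← hgJ j hj z₀ hz₀, hjet _ j z₀ hz₀, hback] at h2
    refine h2.congr fun n => ?_
    rw [hjet _ j z₀ hz₀, hback]

/-- The fields along `x` form a Banach space. The limit of a Cauchy sequence is constructed pointwise,
and its derivatives are the limits of the derivatives in the charts of the cover. -/
instance [CompleteSpace E] : CompleteSpace (CkField x) := by
  refine Metric.complete_of_cauchySeq_tendsto fun u hu => ?_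
  have hev : ∀ q, ∃ c : E, Filter.Tendsto (fun n => evTriv x q q (u n)) Filter.atTop (𝓝 c) :=
    fun q => cauchySeq_tendsto_of_complete ((evTriv x q q).uniformContinuous.comp_cauchySeq hu)
  choose w₀ hw₀ using hev
  let w : ∀ q, TangentSpace 𝓘(ℝ, E) (x q) := fun q => w₀ q
  have hw : ∀ p q, Filter.Tendsto (fun n => fieldTriv x p (u n).val q) Filter.atTop
      (𝓝 (fieldTriv x p w q)) := by
    intro p q
    have h := ((fderiv ℝ (chartAt E (x p) ∘ (chartAt E (x q)).symm)
      (chartAt E (x q) (x q))).continuous.tendsto (w₀ q)).comp (hw₀ q)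
    rw [fieldTriv_apply]
    refine h.congr fun n => ?_
    rw [fieldTriv_apply, Function.comp_apply, evTriv_apply, fieldTriv_self]
  have hwk : ContMDiff I 𝓘(ℝ, E).tangent k (fieldMap x w) := by
    intro q
    obtain ⟨p, hp, hq⟩ := (chartCover x).cover q
    have hs := (chartCover x).subset p hp (interior_subset hq)
    exact (contMDiffAt_fieldMap_iff x hs.2 w).2 (contMDiffAt_limit_fieldTriv hu hw hp hq).1
  let v : CkField x := CkField.mk w hwk
  -- the jets converge at all points of the compact sets, not just at interior points
  have hconv : ∀ p ∈ (chartCover x).pts, ∀ j ≤ k, ∀ q ∈ (chartCover x).cpt p,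
      Filter.Tendsto (fun n => jetNorm p j (u n - v) q) Filter.atTop (𝓝 0) := by
    intro p hp j hj q hq
    obtain ⟨p₁, hp₁, hq₁⟩ := (chartCover x).cover q
    obtain ⟨C, hC⟩ := exists_jetNorm_change_le ((chartCover x).subset p₁ hp₁ (interior_subset hq₁))
      ((chartCover x).subset p hp hq) hj
    have h0 : Filter.Tendsto (fun n => C * ∑ i ∈ Finset.range (k + 1), jetNorm p₁ i (u n - v) q)
        Filter.atTop (𝓝 (C * ∑ _i ∈ Finset.range (k + 1), (0 : ℝ))) := by
      refine Filter.Tendsto.const_mul _ (tendsto_finsetSum _ fun i hi => ?_)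
      have hi := Finset.mem_range_succ_iff.1 hi
      obtain ⟨L, hL, -⟩ := exists_jet_clm_evTriv hp₁ hi (interior_subset hq₁)
      have h1 := (contMDiffAt_limit_fieldTriv hu hw hp₁ hq₁).2 i hi
      have h2 : ∀ z, jetNorm p₁ i z q = ‖L z‖ := fun z => by rw [hL, jetNorm_eq]
      simp only [h2, map_sub]
      rw [← tendsto_zero_iff_norm_tendsto_zero, tendsto_sub_nhds_zero_iff]
      simp only [hL]
      exact h1
    simp only [Finset.sum_const_zero, mul_zero] at h0
    exact squeeze_zero (fun n => jetNorm_nonneg _ _ _ _) (fun n => hC _) h0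
  refine ⟨v, Metric.tendsto_atTop'.2 fun ε hε => ?_⟩
  have hc := coverCard_nonneg (x := x)
  obtain ⟨N, hN⟩ := Metric.cauchySeq_iff.1 hu (ε / (coverCard x + 1)) (by positivity)
  refine ⟨N, fun n hn => ?_⟩
  have hδ : 0 < ε / (coverCard x + 1) := by positivity
  have hle : ‖u n - v‖ ≤ coverCard x * (ε / (coverCard x + 1)) := by
    refine norm_le_of_jetNorm_le hδ.le fun p hp j hj q hq => ?_
    obtain ⟨L, hL, hL1⟩ := exists_jet_clm_evTriv hp hj hq
    have h2 : ∀ z, jetNorm p j z q = ‖L z‖ := fun z => by rw [hL, jetNorm_eq]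
    have h3 := hconv p hp j hj q hq
    simp only [h2, map_sub] at h3 ⊢
    rw [← tendsto_zero_iff_norm_tendsto_zero, tendsto_sub_nhds_zero_iff] at h3
    refine le_of_tendsto (tendsto_const_nhds.sub h3).norm ?_
    filter_upwards [Filter.eventually_ge_atTop N] with m hm
    rw [← map_sub]
    have h4 := hN n hn.le m hm
    rw [dist_eq_norm] at h4
    have h5 := L.le_of_opNorm_le hL1 (u n - u m)
    rw [one_mul] at h5
    exact h5.trans h4.le
  rw [dist_eq_norm]
  refine hle.trans_lt ?_
  rw [mul_div_assoc', div_lt_iff₀ (by positivity)]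
  nlinarith

end Fields

/-! ### Smoothness of pushforwards -/

/-- A bound for the derivatives of the composition of a smooth function with an affine map. -/
theorem norm_iteratedFDeriv_comp_affine_le {X V G : Type*} [NormedAddCommGroup X] [NormedSpace ℝ X]
    [NormedAddCommGroup V] [NormedSpace ℝ V] [NormedAddCommGroup G] [NormedSpace ℝ G]
    {f : V → G} {Ω : Set V} (hΩ : IsOpen Ω) (hf : ContDiffOn ℝ ∞ f Ω) (a : V) (L : X →L[ℝ] V)
    {u : X} (hu : a + L u ∈ Ω) (n : ℕ) :
    ‖iteratedFDeriv ℝ n (fun u => f (a + L u)) u‖ ≤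
      ‖iteratedFDeriv ℝ n f (a + L u)‖ * ‖L‖ ^ n := by
  let s : Set V := (fun y => a + y) ⁻¹' Ω
  have hs : IsOpen s := hΩ.preimage (by fun_prop)
  have hLs : IsOpen (L ⁻¹' s) := hs.preimage L.continuous
  have hg : ContDiffOn ℝ ∞ (fun y => f (a + y)) s :=
    hf.comp (contDiff_const.add contDiff_id).contDiffOn fun y hy => hy
  have h1 := L.iteratedFDerivWithin_comp_right hg hs.uniqueDiffOn hLs.uniqueDiffOn (x := u) hu
    (i := n) (by exact_mod_cast le_top)
  rw [iteratedFDerivWithin_of_isOpen n hLs hu, iteratedFDerivWithin_of_isOpen n hs hu,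
    iteratedFDeriv_comp_add_left] at h1
  change ‖iteratedFDeriv ℝ n ((fun y => f (a + y)) ∘ L) u‖ ≤ _
  rw [h1]
  refine (ContinuousMultilinearMap.norm_compContinuousLinearMap_le _ _).trans_eq ?_
  simp

/-- The value of a multilinear map that depends linearly on a parameter is a smooth function of the
parameter and of the arguments. -/
theorem _root_.ContDiffOn.multilinear_apply {ι : Type*} [Fintype ι] {A : ι → Type*}
    [∀ i, NormedAddCommGroup (A i)] [∀ i, NormedSpace ℝ (A i)] {X G H : Type*}
    [NormedAddCommGroup X] [NormedSpace ℝ X] [NormedAddCommGroup G] [NormedSpace ℝ G]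
    [NormedAddCommGroup H] [NormedSpace ℝ H] (L : G →L[ℝ] ContinuousMultilinearMap ℝ A H)
    {f : X → G} {p : X → ∀ i, A i} {s : Set X} (hf : ContDiffOn ℝ ∞ f s)
    (hp : ∀ i, ContDiffOn ℝ ∞ (fun x => p x i) s) : ContDiffOn ℝ ∞ (fun x => L (f x) (p x)) s := by
  have h : ContDiffOn ℝ ∞ (fun x => L.flipMultilinear (p x)) s :=
    L.flipMultilinear.contDiff.comp_contDiffOn (contDiffOn_pi.2 hp)
  exact h.clm_apply hf

theorem continuousAt_norm_iteratedFDeriv {X G : Type*} [NormedAddCommGroup X] [NormedSpace ℝ X]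
    [NormedAddCommGroup G] [NormedSpace ℝ G] {f : X → G} {x : X} (hf : ContDiffAt ℝ ∞ f x) (n : ℕ) :
    ContinuousAt (fun y => ‖iteratedFDeriv ℝ n f y‖) x :=
  (hf.continuousAt_iteratedFDeriv (by exact_mod_cast le_top)).norm

section JetComp

variable {V F G : Type*} [NormedAddCommGroup V] [NormedSpace ℝ V] [NormedAddCommGroup F]
  [NormedSpace ℝ F] [NormedAddCommGroup G] [NormedSpace ℝ G]

/-- The `j`-th derivative of `f ∘ h`, as a function of the derivatives of `h` of order at most `j`
(the formula of Faà di Bruno). -/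
noncomputable def jetComp (f : F → G) (j : ℕ) (t : ∀ m : Fin (j + 1), V [×(m : ℕ)]→L[ℝ] F) :
    V [×j]→L[ℝ] G :=
  ∑ c : OrderedFinpartition j, c.compAlongOrderedFinpartitionL ℝ V F G
    (iteratedFDeriv ℝ c.length f (t 0 0)) fun i => t ⟨c.partSize i, Nat.lt_succ_of_le (c.partSize_le i)⟩

theorem isOpen_jetComp_domain {Ω : Set F} (hΩ : IsOpen Ω) (j : ℕ) :
    IsOpen {t : ∀ m : Fin (j + 1), V [×(m : ℕ)]→L[ℝ] F | t 0 0 ∈ Ω} :=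
  hΩ.preimage ((ContinuousMultilinearMap.apply ℝ (fun _ : Fin 0 => V) F 0).continuous.comp
    (continuous_apply (0 : Fin (j + 1))))

theorem contDiffOn_jetComp {f : F → G} {Ω : Set F} (hΩ : IsOpen Ω) (hf : ContDiffOn ℝ ∞ f Ω)
    (j : ℕ) : ContDiffOn ℝ ∞ (jetComp (V := V) f j) {t | t 0 0 ∈ Ω} := by
  have h0 : ContDiff ℝ ∞ (fun t : ∀ m : Fin (j + 1), V [×(m : ℕ)]→L[ℝ] F => t 0 0) :=
    (ContinuousMultilinearMap.apply ℝ (fun _ : Fin 0 => V) F 0).contDiff.comp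
      (ContinuousLinearMap.proj (R := ℝ) (φ := fun m : Fin (j + 1) => V [×(m : ℕ)]→L[ℝ] F)
        0).contDiff
  refine ContDiffOn.sum fun c _ => ?_
  have h1 : ContDiffOn ℝ ∞ (iteratedFDeriv ℝ c.length f) Ω := by
    intro y hy
    exact ((hf.contDiffAt (hΩ.mem_nhds hy)).iteratedFDeriv_right (m := ∞) (i := c.length)
      (by exact_mod_cast le_rfl)).contDiffWithinAt
  have h2 : ContDiffOn ℝ ∞ (fun t : ∀ m : Fin (j + 1), V [×(m : ℕ)]→L[ℝ] F =>
      iteratedFDeriv ℝ c.length f (t 0 0)) {t | t 0 0 ∈ Ω} :=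
    h1.comp h0.contDiffOn fun t ht => ht
  refine ContDiffOn.multilinear_apply (c.compAlongOrderedFinpartitionL ℝ V F G) h2 fun i => ?_
  exact (ContinuousLinearMap.proj (R := ℝ) (φ := fun m : Fin (j + 1) => V [×(m : ℕ)]→L[ℝ] F)
    ⟨c.partSize i, Nat.lt_succ_of_le (c.partSize_le i)⟩).contDiff.contDiffOn

variable {HD : Type*} [TopologicalSpace HD]
  {I : ModelWithCorners ℝ V HD} {D : Type*} [TopologicalSpace D] [ChartedSpace HD D]
  [IsManifold I ∞ D] {k : ℕ}

/-- The formula of Faà di Bruno, for jets of functions on a manifold. -/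
theorem jetAt_comp {f : F → G} {Ω : Set F} (hΩ : IsOpen Ω) (hf : ContDiffOn ℝ ∞ f Ω) {h : D → F}
    {r q : D} (hq : q ∈ (chartAt HD r).source) (hh : ContMDiffAt I 𝓘(ℝ, F) k h q) (hhq : h q ∈ Ω)
    {j : ℕ} (hj : j ≤ k) :
    jetAt I r j (fun q => f (h q)) q = jetComp f j fun m => jetAt I r m h q := by
  have hz : (h ∘ (extChartAt I r).symm) (extChartAt I r q) = h q := by
    rw [Function.comp_apply, (extChartAt I r).left_inv (by simpa using hq)]
  have h1 : ContDiffWithinAt ℝ k f Set.univ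
      ((h ∘ (extChartAt I r).symm) (extChartAt I r q)) := by
    rw [hz]
    exact ((hf.contDiffAt (hΩ.mem_nhds hhq)).of_le (by exact_mod_cast le_top)).contDiffWithinAt
  have h2 := iteratedFDerivWithin_comp (i := j) h1 (contDiffWithinAt_comp_extChartAt_symm hq hh)
    uniqueDiffOn_univ I.uniqueDiffOn (Set.mem_range_self _)
    (Set.mapsTo_univ _ _) (by exact_mod_cast hj)
  rw [hz] at h2
  have h3 : (jetAt I r ((0 : Fin (j + 1)) : ℕ) h q) 0 = h q := jetAt_zero_apply hq 0
  refine h2.trans ?_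
  rw [ftaylorSeriesWithin_univ, ← h3]
  rfl

variable {X : Type*} [NormedAddCommGroup X] [NormedSpace ℝ X]

/-- The jets at `q` of the functions `q ↦ f (ξ q + w q u)`, where `w` is a `C^k`-bounded linear
family and `f` is smooth, are smooth functions of `u`, with derivatives bounded locally uniformly
in `(u, q)`. -/
theorem CkBounded.eventually_jetAt_comp {w : D → X →L[ℝ] F} {r q₀ : D}
    (hw : CkBounded I k r q₀ w) {ξ : D → F} (hξ : ∀ᶠ q in 𝓝 q₀, ContMDiffAt I 𝓘(ℝ, F) k ξ q)
    {f : F → G} {Ω : Set F} (hΩ : IsOpen Ω) (hf : ContDiffOn ℝ ∞ f Ω) {u₀ : X}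
    (hu₀ : ξ q₀ + w q₀ u₀ ∈ Ω) {j : ℕ} (hj : j ≤ k) (n : ℕ) :
    ∃ C : ℝ, ∀ᶠ z : X × D in 𝓝 (u₀, q₀),
      ContDiffAt ℝ ∞ (fun u => jetAt I r j (fun q => f (ξ q + w q u)) z.2) z.1 ∧
      ‖iteratedFDeriv ℝ n (fun u => jetAt I r j (fun q => f (ξ q + w q u)) z.2) z.1‖ ≤ C := by
  -- the jets of `q ↦ w q u` at `q`, as a linear function of `u`
  have hjet : ∀ m : Fin (j + 1), ∃ C : ℝ, 0 ≤ C ∧ ∀ᶠ q in 𝓝 q₀,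
      ∃ L : X →L[ℝ] V [×(m : ℕ)]→L[ℝ] F,
        (∀ v, L v = jetAt I r m (fun q => w q v) q) ∧ ‖L‖ ≤ C := by
    intro m
    have hm : (m : ℕ) ≤ k := (Nat.lt_succ_iff.1 m.2).trans hj
    obtain ⟨C, hC, h⟩ := hw.bound m hm
    refine ⟨C, hC, ?_⟩
    filter_upwards [h, hw.smooth, (chartAt HD r).open_source.mem_nhds hw.mem] with q hq hs hqr
    exact exists_jet_clm hqr hm hs hC hq
  choose C hC hL using hjet
  choose L hL using fun m => (hL m).choice
  have hL' : ∀ᶠ q in 𝓝 q₀, ∀ m, (∀ v, L m q v = jetAt I r m (fun q => w q v) q) ∧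
      ‖L m q‖ ≤ C m := Filter.eventually_all.2 hL
  let Λ : D → X →L[ℝ] (∀ m : Fin (j + 1), V [×(m : ℕ)]→L[ℝ] F) := fun q =>
    ContinuousLinearMap.pi fun m => L m q
  let a : D → ∀ m : Fin (j + 1), V [×(m : ℕ)]→L[ℝ] F := fun q m => jetAt I r m ξ q
  let K : ℝ := ∑ m, C m
  have hK : 0 ≤ K := Finset.sum_nonneg fun m _ => hC m
  have hΛ : ∀ᶠ q in 𝓝 q₀, ‖Λ q‖ ≤ K := by
    filter_upwards [hL'] with q hq
    refine ContinuousLinearMap.opNorm_le_bound _ hK fun v => ?_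
    refine (pi_norm_le_iff_of_nonneg (by positivity)).2 fun m => ?_
    refine ((L m q).le_of_opNorm_le (hq m).2 v).trans
      (mul_le_mul_of_nonneg_right ?_ (norm_nonneg v))
    exact Finset.single_le_sum (f := C) (fun m _ => hC m) (Finset.mem_univ m)
  have hsum : ∀ᶠ q in 𝓝 q₀, ∀ u, a q + Λ q u = fun m : Fin (j + 1) =>
      jetAt I r m (fun q => ξ q + w q u) q := by
    filter_upwards [hL', hξ, hw.smooth, (chartAt HD r).open_source.mem_nhds hw.mem]
      with q hq hξq hs hqr u
    funext m
    have hm : (m : ℕ) ≤ k := (Nat.lt_succ_iff.1 m.2).trans hj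
    rw [jetAt_add hqr hm hξq (hs u), ← (hq m).1 u]
    rfl
  have htend : Filter.Tendsto (fun z : X × D => a z.2 + Λ z.2 z.1) (𝓝 (u₀, q₀))
      (𝓝 (a q₀ + Λ q₀ u₀)) := by
    have h1 : Filter.Tendsto (fun q => a q + Λ q u₀) (𝓝 q₀) (𝓝 (a q₀ + Λ q₀ u₀)) := by
      have h2 : Filter.Tendsto (fun q => fun m : Fin (j + 1) =>
          jetAt I r m (fun q => ξ q + w q u₀) q) (𝓝 q₀)
          (𝓝 fun m : Fin (j + 1) => jetAt I r m (fun q => ξ q + w q u₀) q₀) := by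
        refine tendsto_pi_nhds.2 fun m => ?_
        have hm : (m : ℕ) ≤ k := (Nat.lt_succ_iff.1 m.2).trans hj
        exact (continuousAt_jetAt hw.mem hm
          (hξ.self_of_nhds.add (hw.smooth.self_of_nhds u₀))).tendsto
      rw [← hsum.self_of_nhds u₀] at h2
      refine h2.congr' ?_
      filter_upwards [hsum] with q hq
      exact (hq u₀).symm
    have h3 : Filter.Tendsto (fun z : X × D => Λ z.2 (z.1 - u₀)) (𝓝 (u₀, q₀)) (𝓝 0) := by
      have h4 : Filter.Tendsto (fun z : X × D => K * ‖z.1 - u₀‖) (𝓝 (u₀, q₀)) (𝓝 0) := by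
        have : Continuous fun z : X × D => K * ‖z.1 - u₀‖ := by fun_prop
        simpa using this.tendsto (u₀, q₀)
      refine squeeze_zero_norm' ?_ h4
      filter_upwards [(continuous_snd.continuousAt (x := (u₀, q₀))).eventually hΛ] with z hz
      exact (Λ z.2).le_of_opNorm_le hz _
    have h5 := (h1.comp (continuous_snd.tendsto (u₀, q₀))).add h3
    rw [add_zero] at h5
    refine h5.congr fun z => ?_
    simp only [Function.comp_apply, map_sub]
    abel
  have hΩ' := isOpen_jetComp_domain (V := V) hΩ j
  have hfs := contDiffOn_jetComp (V := V) hΩ hf j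
  have hval : ∀ᶠ q in 𝓝 q₀, ∀ u, (a q + Λ q u) 0 0 = ξ q + w q u := by
    filter_upwards [hsum, (chartAt HD r).open_source.mem_nhds hw.mem] with q hq hqr u
    rw [hq u]
    exact jetAt_zero_apply hqr _
  have hmem₀ : a q₀ + Λ q₀ u₀ ∈ {t : ∀ m : Fin (j + 1), V [×(m : ℕ)]→L[ℝ] F | t 0 0 ∈ Ω} := by
    change (a q₀ + Λ q₀ u₀) 0 0 ∈ Ω
    rw [hval.self_of_nhds]
    exact hu₀
  have hcont := continuousAt_norm_iteratedFDeriv (hfs.contDiffAt (hΩ'.mem_nhds hmem₀)) n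
  set B := ‖iteratedFDeriv ℝ n (jetComp (V := V) f j) (a q₀ + Λ q₀ u₀)‖ + 1
  have hbd : ∀ᶠ z : X × D in 𝓝 (u₀, q₀),
      ‖iteratedFDeriv ℝ n (jetComp (V := V) f j) (a z.2 + Λ z.2 z.1)‖ ≤ B := by
    exact (hcont.tendsto.comp htend).eventually (eventually_le_nhds (lt_add_one _))
  have hsnd := continuous_snd.continuousAt (x := (u₀, q₀))
  refine ⟨B * K ^ n, ?_⟩
  filter_upwards [hbd, htend.eventually (hΩ'.mem_nhds hmem₀), hsnd.eventually hΛ,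
    hsnd.eventually hval, hsnd.eventually hsum, hsnd.eventually hξ, hsnd.eventually hw.smooth,
    hsnd.eventually ((chartAt HD r).open_source.mem_nhds hw.mem)]
    with z hz hzΩ hzΛ hzv hzs hzξ hzw hzr
  obtain ⟨u, q⟩ := z
  have heq : (fun u => jetAt I r j (fun q => f (ξ q + w q u)) q) =ᶠ[𝓝 u]
      fun u => jetComp f j (a q + Λ q u) := by
    have hop : IsOpen {u : X | a q + Λ q u ∈
        {t : ∀ m : Fin (j + 1), V [×(m : ℕ)]→L[ℝ] F | t 0 0 ∈ Ω}} :=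
      hΩ'.preimage (by fun_prop)
    filter_upwards [hop.mem_nhds hzΩ] with u' hu'
    change (a q + Λ q u') 0 0 ∈ Ω at hu'
    rw [hzv u'] at hu'
    exact (jetAt_comp (h := fun q => ξ q + w q u') hΩ hf hzr (hzξ.add (hzw u')) hu' hj).trans
      (congrArg (jetComp f j) (hzs u').symm)
  constructor
  · refine ContDiffAt.congr_of_eventuallyEq ?_ heq
    exact ContDiffAt.comp (g := jetComp (V := V) f j) u (hfs.contDiffAt (hΩ'.mem_nhds hzΩ))
      (contDiff_const.add (Λ q).contDiff).contDiffAt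
  · change ‖iteratedFDeriv ℝ n (fun u => jetAt I r j (fun q => f (ξ q + w q u)) q) u‖ ≤ _
    rw [(Filter.EventuallyEq.iteratedFDeriv ℝ heq n).eq_of_nhds]
    refine (norm_iteratedFDeriv_comp_affine_le hΩ' hfs (a q) (Λ q) hzΩ n).trans ?_
    refine mul_le_mul hz (pow_le_pow_left₀ (norm_nonneg _) hzΛ n) (by positivity) ?_
    positivity

end JetComp

section Pushforward

variable {ED : Type*} [NormedAddCommGroup ED] [NormedSpace ℝ ED] {HD : Type*} [TopologicalSpace HD]
  {I : ModelWithCorners ℝ ED HD} {D : Type*} [TopologicalSpace D] [ChartedSpace HD D]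
  [IsManifold I ∞ D] {k : ℕ} {E : Type*} [NormedAddCommGroup E] [NormedSpace ℝ E]
  {M : Type*} [TopologicalSpace M] [ChartedSpace E M] [IsManifold 𝓘(ℝ, E) ∞ M]
  [CompactSpace D] [T2Space D] {y : C^k⟮I, D; 𝓘(ℝ, E), M⟯}
  {X F : Type*} [NormedAddCommGroup X] [NormedSpace ℝ X] [NormedAddCommGroup F] [NormedSpace ℝ F]

/-- The local form of a pushforward: near `(u₀, q₀)`, the field `T u` is, in the trivialization at
`y r`, of the form `q ↦ f (ξ q + w q u)`, where `f` is smooth, `ξ` is of class `C^k`, and `w` is a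
linear and `C^k`-bounded family. -/
def HasPushforwardForm (F : Type*) [NormedAddCommGroup F] [NormedSpace ℝ F]
    (T : X → CkField y) (u₀ : X) (r q₀ : D) : Prop :=
  ∃ (ξ : D → F) (w : D → X →L[ℝ] F) (f : F → E) (Ω : Set F), IsOpen Ω ∧ ContDiffOn ℝ ∞ f Ω ∧
    (∀ᶠ q in 𝓝 q₀, ContMDiffAt I 𝓘(ℝ, F) k ξ q) ∧ CkBounded I k r q₀ w ∧
    ∀ᶠ z : X × D in 𝓝 (u₀, q₀), ξ z.2 + w z.2 z.1 ∈ Ω ∧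
      fieldTriv y r (T z.1).val z.2 = f (ξ z.2 + w z.2 z.1)

/-- The jets of a map of the form of a pushforward are smooth functions of the parameter, with locally
uniform bounds. -/
theorem HasPushforwardForm.eventually_jetAt {T : X → CkField y} {u₀ : X} {r q₀ : D}
    (h : HasPushforwardForm F T u₀ r q₀) {j : ℕ} (hj : j ≤ k) (n : ℕ) :
    ∃ C : ℝ, ∀ᶠ z : X × D in 𝓝 (u₀, q₀),
      ContDiffAt ℝ ∞ (fun u => jetAt I r j (fieldTriv y r (T u).val) z.2) z.1 ∧
      ‖iteratedFDeriv ℝ n (fun u => jetAt I r j (fieldTriv y r (T u).val) z.2) z.1‖ ≤ C := by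
  obtain ⟨ξ, w, f, Ω, hΩ, hf, hξ, hw, hT⟩ := h
  obtain ⟨C, hC⟩ := hw.eventually_jetAt_comp hξ hΩ hf hT.self_of_nhds.1 hj n
  refine ⟨C, ?_⟩
  filter_upwards [hC, hT.eventually_nhds, (continuous_snd.continuousAt (x := (u₀, q₀))).eventually
    ((chartAt HD r).open_source.mem_nhds hw.mem)] with z hz hTz hzr
  obtain ⟨u, q⟩ := z
  rw [nhds_prod_eq] at hTz
  have heq : (fun u => jetAt I r j (fieldTriv y r (T u).val) q) =ᶠ[𝓝 u]
      fun u => jetAt I r j (fun q => f (ξ q + w q u)) q := by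
    filter_upwards [hTz.curry] with u' hu'
    refine jetAt_congr hzr ?_
    filter_upwards [hu'] with q' hq'
    exact hq'.2
  refine ⟨hz.1.congr_of_eventuallyEq heq, ?_⟩
  change ‖iteratedFDeriv ℝ n (fun u => jetAt I r j (fieldTriv y r (T u).val) q) u‖ ≤ _
  rw [(Filter.EventuallyEq.iteratedFDeriv ℝ heq n).eq_of_nhds]
  exact hz.2

/-- A map into a space of fields which locally has the form of a pushforward is smooth. The jets at the
points of the compact sets of the cover form a norming family, along which the map is smooth; the
locally uniform bounds of the derivatives extend to the compact sets. -/
theorem contDiffOn_of_hasPushforwardForm [CompleteSpace E] {T : X → CkField y} {U : Set X}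
    (hU : IsOpen U) (h : ∀ u₀ ∈ U, ∀ r q₀ : D, q₀ ∈ (chartAt HD r).source →
      y q₀ ∈ (chartAt E (y r)).source → HasPushforwardForm F T u₀ r q₀) :
    ContDiffOn ℝ ∞ T U := by
  let Q := {t : D × ℕ × D // t.1 ∈ (chartCover y).pts ∧ t.2.1 ≤ k ∧ t.2.2 ∈ (chartCover y).cpt t.1}
  have hex : ∀ t : Q, ∃ L : CkField y →L[ℝ] ED [×t.1.2.1]→L[ℝ] E,
      ∀ v, L v = jetAt I t.1.1 t.1.2.1 (fieldTriv y t.1.1 v.val) t.1.2.2 := fun t =>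
    (exists_jet_clm_evTriv t.2.1 t.2.2.1 t.2.2.2).imp fun L hL => hL.1
  choose e he using hex
  have hnorm : IsNorming e (coverCard y) := by
    refine ⟨coverCard_nonneg, fun v r hr hv => norm_le_of_jetNorm_le hr fun p hp j hj q hq => ?_⟩
    have := hv ⟨(p, j, q), hp, hj, hq⟩
    rwa [he] at this
  have hloc : ∀ u₀ ∈ U, ∀ p ∈ (chartCover y).pts, ∀ q ∈ (chartCover y).cpt p, ∀ j ≤ k, ∀ n : ℕ,
      ∃ C : ℝ, ∀ᶠ z : X × D in 𝓝 (u₀, q),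
        ContDiffAt ℝ ∞ (fun u => jetAt I p j (fieldTriv y p (T u).val) z.2) z.1 ∧
        ‖iteratedFDeriv ℝ n (fun u => jetAt I p j (fieldTriv y p (T u).val) z.2) z.1‖ ≤ C := by
    intro u₀ hu₀ p hp q hq j hj n
    have hs := (chartCover y).subset p hp hq
    exact (h u₀ hu₀ p q hs.1 hs.2).eventually_jetAt hj n
  refine hnorm.contDiffOn hU (fun t u₀ hu₀ => ?_) fun u₀ hu₀ n => ?_
  · obtain ⟨⟨p, j, q⟩, hp, hj, hq⟩ := t
    obtain ⟨C, hC⟩ := hloc u₀ hu₀ p hp q hq j hj 0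
    simp only [he]
    exact hC.self_of_nhds.1.contDiffWithinAt
  · have hcpt : ∀ p ∈ (chartCover y).pts, ∀ j ≤ k, ∃ C : ℝ, ∀ᶠ u in 𝓝 u₀,
        ∀ q ∈ (chartCover y).cpt p,
          ‖iteratedFDeriv ℝ n (fun u => jetAt I p j (fieldTriv y p (T u).val) q) u‖ ≤ C := by
      intro p hp j hj
      refine ((chartCover y).isCompact p hp).induction_on
        (p := fun S => ∃ C : ℝ, ∀ᶠ u in 𝓝 u₀, ∀ q ∈ S,
          ‖iteratedFDeriv ℝ n (fun u => jetAt I p j (fieldTriv y p (T u).val) q) u‖ ≤ C)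
        ⟨0, by simp⟩ ?_ ?_ ?_
      · rintro S S' hSS' ⟨C, hC⟩
        exact ⟨C, hC.mono fun u hu q hq => hu q (hSS' hq)⟩
      · rintro S S' ⟨C, hC⟩ ⟨C', hC'⟩
        refine ⟨max C C', ?_⟩
        filter_upwards [hC, hC'] with u hu hu' q hq
        exact hq.elim (fun hq => (hu q hq).trans (le_max_left _ _))
          fun hq => (hu' q hq).trans (le_max_right _ _)
      · intro q hq
        obtain ⟨C, hC⟩ := hloc u₀ hu₀ p hp q hq j hj n
        rw [nhds_prod_eq, Filter.eventually_prod_iff] at hC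
        obtain ⟨P, hP, R, hR, hPR⟩ := hC
        exact ⟨{q | R q}, mem_nhdsWithin_of_mem_nhds hR, C,
          hP.mono fun u hu q hq => (hPR hu hq).2⟩
    have hcpt' : ∀ p : D, ∀ j : ℕ, ∃ C : ℝ, p ∈ (chartCover y).pts → j ≤ k → ∀ᶠ u in 𝓝 u₀,
        ∀ q ∈ (chartCover y).cpt p,
          ‖iteratedFDeriv ℝ n (fun u => jetAt I p j (fieldTriv y p (T u).val) q) u‖ ≤ C := by
      intro p j
      by_cases hp : p ∈ (chartCover y).pts ∧ j ≤ k
      · obtain ⟨C, hC⟩ := hcpt p hp.1 j hp.2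
        exact ⟨C, fun _ _ => hC⟩
      · exact ⟨0, fun h1 h2 => absurd ⟨h1, h2⟩ hp⟩
    choose C hC using hcpt'
    refine ⟨∑ p ∈ (chartCover y).pts, ∑ j ∈ Finset.range (k + 1), |C p j|, ?_⟩
    have hall : ∀ᶠ u in 𝓝 u₀, ∀ p ∈ (chartCover y).pts, ∀ j ∈ Finset.range (k + 1),
        ∀ q ∈ (chartCover y).cpt p,
          ‖iteratedFDeriv ℝ n (fun u => jetAt I p j (fieldTriv y p (T u).val) q) u‖ ≤ C p j :=
      (Filter.eventually_all_finset _).2 fun p hp => (Filter.eventually_all_finset _).2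
        fun j hj => hC p j hp (Finset.mem_range_succ_iff.1 hj)
    filter_upwards [hall] with u hu t
    obtain ⟨⟨p, j, q⟩, hp, hj, hq⟩ := t
    simp only [he]
    have hj' := Finset.mem_range_succ_iff.2 hj
    refine (hu p hp j hj' q hq).trans ((le_abs_self _).trans ?_)
    refine (Finset.single_le_sum (f := fun j => |C p j|) (fun j _ => abs_nonneg _) hj').trans ?_
    exact Finset.single_le_sum (f := fun p => ∑ j ∈ Finset.range (k + 1), |C p j|)
      (fun p _ => Finset.sum_nonneg fun j _ => abs_nonneg _) hp

end Pushforward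

/-! ### Local additions in charts -/

section TangentChart

variable {E : Type*} [NormedAddCommGroup E] [NormedSpace ℝ E]
  {M : Type*} [TopologicalSpace M] [ChartedSpace E M] [IsManifold 𝓘(ℝ, E) ∞ M]

variable (E) in
/-- The chart of `TM` induced by the chart of `M` at `m`. -/
noncomputable def tangentChart (m : M) : PartialEquiv (TangentBundle 𝓘(ℝ, E) M) (E × E) :=
  extChartAt 𝓘(ℝ, E).tangent (⟨m, 0⟩ : TangentBundle 𝓘(ℝ, E) M)

theorem tangentChart_apply (m : M) (t : TangentBundle 𝓘(ℝ, E) M) : tangentChart E m t =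
    (chartAt E m t.proj, (trivializationAt E (TangentSpace 𝓘(ℝ, E)) m t).2) :=
  extChartAt_tangent_apply m t

theorem mem_tangentChart_source {m : M} {t : TangentBundle 𝓘(ℝ, E) M} :
    t ∈ (tangentChart E m).source ↔ t.proj ∈ (chartAt E m).source :=
  mem_extChartAt_tangent_source

theorem mem_tangentChart_target {m : M} {z : E × E} :
    z ∈ (tangentChart E m).target ↔ z.1 ∈ (chartAt E m).target := by
  rw [tangentChart, extChartAt_target]
  have h := TangentBundle.mem_chart_target_iff (I := 𝓘(ℝ, E)) (H := E) z
    (⟨m, 0⟩ : TangentBundle 𝓘(ℝ, E) M)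
  constructor
  · exact fun hz => h.1 hz.1
  · exact fun hz => ⟨h.2 hz, z, rfl⟩

theorem isOpen_tangentChart_target (m : M) : IsOpen (tangentChart E m).target := by
  have : (tangentChart E m).target = Prod.fst ⁻¹' (chartAt E m).target := by
    ext z
    exact mem_tangentChart_target
  rw [this]
  exact (chartAt E m).open_target.preimage continuous_fst

theorem proj_tangentChart_symm {m : M} {z : E × E} (hz : z.1 ∈ (chartAt E m).target) :
    ((tangentChart E m).symm z).proj = (chartAt E m).symm z.1 := by
  have h := (tangentChart E m).right_inv (mem_tangentChart_target.2 hz)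
  have h1 := (tangentChart E m).map_target (mem_tangentChart_target.2 hz)
  rw [tangentChart_apply] at h
  rw [← congrArg Prod.fst h, (chartAt E m).left_inv (mem_tangentChart_source.1 h1)]

theorem contMDiffOn_tangentChart_symm (m : M) : ContMDiffOn 𝓘(ℝ, E × E) 𝓘(ℝ, E).tangent ∞
    (tangentChart E m).symm (tangentChart E m).target :=
  contMDiffOn_extChartAt_symm _

theorem contMDiffOn_tangentChart (m : M) : ContMDiffOn 𝓘(ℝ, E).tangent 𝓘(ℝ, E × E) ∞
    (tangentChart E m) (tangentChart E m).source := by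
  rw [tangentChart, extChartAt_source]
  exact contMDiffOn_extChartAt

end TangentChart

namespace LocalAddition

variable {E : Type*} [NormedAddCommGroup E] [NormedSpace ℝ E]
  {M : Type*} [TopologicalSpace M] [ChartedSpace E M] [IsManifold 𝓘(ℝ, E) ∞ M]
  (α : LocalAddition E M)

/-- The end point of a vector under a local addition. -/
noncomputable def endpoint (t : TangentBundle 𝓘(ℝ, E) M) : M := (α.toOpenPartialHomeomorph t).2

theorem apply_eq {t : TangentBundle 𝓘(ℝ, E) M} (ht : t ∈ α.source) :
    α.toOpenPartialHomeomorph t = (t.proj, α.endpoint t) :=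
  Prod.ext (α.fst_apply t ht) rfl

theorem contMDiffOn_endpoint : ContMDiffOn 𝓘(ℝ, E).tangent 𝓘(ℝ, E) ∞ α.endpoint α.source :=
  contMDiff_snd.comp_contMDiffOn α.contMDiffOn_toFun

/-- The domain of `expRep`. -/
noncomputable def expDomain (m : M) (φ : OpenPartialHomeomorph M E) : Set (E × E) :=
  {z | z ∈ (tangentChart E m).target ∧ (tangentChart E m).symm z ∈ α.source ∧
    α.endpoint ((tangentChart E m).symm z) ∈ φ.source}

/-- A local addition in charts: `(a, ζ)` is sent to the coordinates, in the chart `φ`, of the end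
point of the vector with coordinates `(a, ζ)` in the chart of `TM` at `m`. -/
noncomputable def expRep (m : M) (φ : OpenPartialHomeomorph M E) (z : E × E) : E :=
  φ (α.endpoint ((tangentChart E m).symm z))

/-- The domain of `logRep`. -/
def logDomain (m : M) (φ : OpenPartialHomeomorph M E) : Set (E × E) :=
  {z | z.1 ∈ (chartAt E m).target ∧ z.2 ∈ φ.target ∧
    ((chartAt E m).symm z.1, φ.symm z.2) ∈ α.target}

/-- The inverse of a local addition in charts: `(a, b)` is sent to the coordinates of the vector
based at the point with coordinates `a` in the chart at `m`, whose end point has coordinates `b` in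
the chart `φ`. -/
noncomputable def logRep (m : M) (φ : OpenPartialHomeomorph M E) (z : E × E) : E :=
  (trivializationAt E (TangentSpace 𝓘(ℝ, E)) m
    (α.toOpenPartialHomeomorph.symm ((chartAt E m).symm z.1, φ.symm z.2))).2

variable {m : M} {φ : OpenPartialHomeomorph M E}

theorem isOpen_expDomain : IsOpen (α.expDomain m φ) := by
  have h1 : IsOpen (α.source ∩ α.endpoint ⁻¹' φ.source) :=
    α.contMDiffOn_endpoint.continuousOn.isOpen_inter_preimage α.open_source φ.open_source
  exact (contMDiffOn_tangentChart_symm m).continuousOn.isOpen_inter_preimage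
    (isOpen_tangentChart_target m) h1

theorem contDiffOn_expRep (hφ : φ ∈ atlas E M) : ContDiffOn ℝ ∞ (α.expRep m φ) (α.expDomain m φ) := by
  have h1 : ContMDiffOn 𝓘(ℝ, E) 𝓘(ℝ, E) ∞ φ φ.source :=
    contMDiffOn_of_mem_maximalAtlas (IsManifold.subset_maximalAtlas hφ)
  rw [← contMDiffOn_iff_contDiffOn]
  exact h1.comp (α.contMDiffOn_endpoint.comp ((contMDiffOn_tangentChart_symm m).mono
    fun z hz => hz.1) fun z hz => hz.2.1) fun z hz => hz.2.2

theorem continuousOn_log_prod : ContinuousOn (fun z : E × E => ((chartAt E m).symm z.1, φ.symm z.2))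
    ((chartAt E m).target ×ˢ φ.target) :=
  ((chartAt E m).continuousOn_symm.comp continuousOn_fst fun _ hz => hz.1).prodMk
    (φ.continuousOn_symm.comp continuousOn_snd fun _ hz => hz.2)

theorem isOpen_logDomain : IsOpen (α.logDomain m φ) := by
  have h := (continuousOn_log_prod (m := m) (φ := φ)).isOpen_inter_preimage
    ((chartAt E m).open_target.prod φ.open_target) α.open_target
  convert h using 1
  ext z
  exact and_assoc.symm

theorem contDiffOn_logRep (hφ : φ ∈ atlas E M) : ContDiffOn ℝ ∞ (α.logRep m φ) (α.logDomain m φ) := by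
  have h1 : ContMDiffOn 𝓘(ℝ, E) 𝓘(ℝ, E) ∞ φ.symm φ.target :=
    contMDiffOn_symm_of_mem_maximalAtlas (IsManifold.subset_maximalAtlas hφ)
  have h2 : ContMDiffOn 𝓘(ℝ, E) 𝓘(ℝ, E) ∞ (chartAt E m).symm (chartAt E m).target :=
    contMDiffOn_chart_symm
  have h3 : ContMDiffOn 𝓘(ℝ, E × E) (𝓘(ℝ, E).prod 𝓘(ℝ, E)) ∞
      (fun z : E × E => ((chartAt E m).symm z.1, φ.symm z.2)) (α.logDomain m φ) :=
    (h2.comp contDiff_fst.contMDiff.contMDiffOn fun z hz => hz.1).prodMk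
      (h1.comp contDiff_snd.contMDiff.contMDiffOn fun z hz => hz.2.1)
  have h4 := α.contMDiffOn_invFun.comp h3 fun z hz => hz.2.2
  have h5 := (contMDiffOn_tangentChart (E := E) m).comp h4 fun z hz => by
    rw [Set.mem_preimage, mem_tangentChart_source]
    change (α.toOpenPartialHomeomorph.symm _).proj ∈ _
    rw [α.proj_symm hz.2.2]
    exact (chartAt E m).map_target hz.1
  have h6 := contDiff_snd.comp_contDiffOn (contMDiffOn_iff_contDiffOn.1 h5)
  refine h6.congr fun z hz => ?_
  simp only [Function.comp_apply, tangentChart_apply]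
  rfl

theorem tangentChart_mem_expDomain {t : TangentBundle 𝓘(ℝ, E) M} (ht : t ∈ α.source)
    (hm : t.proj ∈ (chartAt E m).source) (hφ : α.endpoint t ∈ φ.source) :
    tangentChart E m t ∈ α.expDomain m φ := by
  have h := mem_tangentChart_source.2 hm
  refine ⟨(tangentChart E m).map_source h, ?_⟩
  rw [(tangentChart E m).left_inv h]
  exact ⟨ht, hφ⟩

theorem expRep_tangentChart {t : TangentBundle 𝓘(ℝ, E) M} (hm : t.proj ∈ (chartAt E m).source) :
    α.expRep m φ (tangentChart E m t) = φ (α.endpoint t) := by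
  rw [expRep, (tangentChart E m).left_inv (mem_tangentChart_source.2 hm)]

theorem mk_expRep_mem_logDomain {z : E × E} (hz : z ∈ α.expDomain m φ) :
    (z.1, α.expRep m φ z) ∈ α.logDomain m φ := by
  have hz1 := mem_tangentChart_target.1 hz.1
  refine ⟨hz1, φ.map_source hz.2.2, ?_⟩
  simp only [expRep]
  rw [φ.left_inv hz.2.2, ← proj_tangentChart_symm hz1, ← α.apply_eq hz.2.1]
  exact α.toOpenPartialHomeomorph.map_source hz.2.1

theorem logRep_expRep {z : E × E} (hz : z ∈ α.expDomain m φ) :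
    α.logRep m φ (z.1, α.expRep m φ z) = z.2 := by
  have hz1 := mem_tangentChart_target.1 hz.1
  simp only [expRep, logRep]
  rw [φ.left_inv hz.2.2, ← proj_tangentChart_symm hz1, ← α.apply_eq hz.2.1,
    α.toOpenPartialHomeomorph.left_inv hz.2.1]
  have h := (tangentChart E m).right_inv hz.1
  rw [tangentChart_apply] at h
  exact congrArg Prod.snd h

theorem tangentChart_symm_log {z : E × E} (hz : z ∈ α.logDomain m φ) :
    tangentChart E m (α.toOpenPartialHomeomorph.symm ((chartAt E m).symm z.1, φ.symm z.2)) =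
      (z.1, α.logRep m φ z) := by
  rw [tangentChart_apply, α.proj_symm hz.2.2, (chartAt E m).right_inv hz.1]
  rfl

theorem expRep_logRep {z : E × E} (hz : z ∈ α.logDomain m φ) :
    α.expRep m φ (z.1, α.logRep m φ z) = z.2 := by
  rw [← α.tangentChart_symm_log hz, α.expRep_tangentChart, endpoint,
    α.toOpenPartialHomeomorph.right_inv hz.2.2, φ.right_inv hz.2.1]
  rw [α.proj_symm hz.2.2]
  exact (chartAt E m).map_target hz.1

end LocalAddition

section JointContinuity

variable {ED : Type*} [NormedAddCommGroup ED] [NormedSpace ℝ ED] {HD : Type*} [TopologicalSpace HD]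
  {I : ModelWithCorners ℝ ED HD} {D : Type*} [TopologicalSpace D] [ChartedSpace HD D]
  [IsManifold I ∞ D] {k : ℕ} {X F : Type*} [NormedAddCommGroup X] [NormedSpace ℝ X]
  [NormedAddCommGroup F] [NormedSpace ℝ F]

/-- A `C^k`-bounded family is jointly continuous in the parameter and the point. -/
theorem CkBounded.continuousAt {w : D → X →L[ℝ] F} {r q₀ : D} (hw : CkBounded I k r q₀ w) (u₀ : X) :
    ContinuousAt (fun z : X × D => w z.2 z.1) (u₀, q₀) := by
  have h1 : ContinuousAt (fun q => w q u₀) q₀ := (hw.smooth.self_of_nhds u₀).continuousAt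
  obtain ⟨C, hC, hb⟩ := hw.bound 0 (Nat.zero_le k)
  have h3 : Filter.Tendsto (fun z : X × D => w z.2 (z.1 - u₀)) (𝓝 (u₀, q₀)) (𝓝 0) := by
    have h4 : Filter.Tendsto (fun z : X × D => C * ‖z.1 - u₀‖) (𝓝 (u₀, q₀)) (𝓝 0) := by
      have : Continuous fun z : X × D => C * ‖z.1 - u₀‖ := by fun_prop
      simpa using this.tendsto (u₀, q₀)
    refine squeeze_zero_norm' ?_ h4
    filter_upwards [(continuous_snd.continuousAt (x := (u₀, q₀))).eventually hb,
      (continuous_snd.continuousAt (x := (u₀, q₀))).eventually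
        ((chartAt HD r).open_source.mem_nhds hw.mem)] with z hz hzr
    have := hz (z.1 - u₀)
    rwa [norm_jetAt_zero hzr] at this
  have h5 := (h1.tendsto.comp (continuous_snd.tendsto (u₀, q₀))).add h3
  rw [add_zero] at h5
  refine h5.congr fun z => ?_
  simp

variable {E : Type*} [NormedAddCommGroup E] [NormedSpace ℝ E]
  {M : Type*} [TopologicalSpace M] [ChartedSpace E M] [IsManifold 𝓘(ℝ, E) ∞ M]
  [CompactSpace D] [T2Space D] {x : C^k⟮I, D; 𝓘(ℝ, E), M⟯}

theorem tangentChart_fieldMap (p q : D) (v : ∀ q, TangentSpace 𝓘(ℝ, E) (x q)) :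
    tangentChart E (x p) (fieldMap x v q) = (chartAt E (x p) (x q), fieldTriv x p v q) :=
  tangentChart_apply _ _

theorem continuousAt_fieldMap (v₀ : CkField x) (q₀ : D) :
    ContinuousAt (fun z : CkField x × D => fieldMap x z.1.val z.2) (v₀, q₀) := by
  have hs := mem_chart_source E (x q₀)
  have h1 : ContinuousAt (fun z : CkField x × D => evTriv x q₀ z.2 z.1) (v₀, q₀) :=
    (ckBounded_evTriv (mem_chart_source HD q₀) hs).continuousAt v₀
  have h2 : ContinuousAt (fun z : CkField x × D => chartAt E (x q₀) (x z.2)) (v₀, q₀) :=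
    ContinuousAt.comp (g := fun q => chartAt E (x q₀) (x q)) (f := Prod.snd)
      (contMDiffAt_chartAt_comp (k := k) hs).continuousAt continuousAt_snd
  have h3 : ContinuousAt (tangentChart E (x q₀)).symm
      (chartAt E (x q₀) (x q₀), evTriv x q₀ q₀ v₀) :=
    (contMDiffOn_tangentChart_symm (x q₀)).continuousOn.continuousAt
      ((isOpen_tangentChart_target _).mem_nhds (mem_tangentChart_target.2
        ((chartAt E (x q₀)).map_source hs)))
  have h4 : ContinuousAt (fun z : CkField x × D => (tangentChart E (x q₀)).symm
      (chartAt E (x q₀) (x z.2), evTriv x q₀ z.2 z.1)) (v₀, q₀) :=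
    ContinuousAt.comp (g := (tangentChart E (x q₀)).symm) h3 (h2.prodMk h1)
  refine h4.congr ?_
  filter_upwards [(continuous_snd.continuousAt (x := (v₀, q₀))).eventually
    (eventually_mem_chartAt_source hs)] with z hz
  rw [evTriv_apply, ← tangentChart_fieldMap, (tangentChart E (x q₀)).left_inv]
  exact mem_tangentChart_source.2 hz

/-- Pointwise open conditions on the values of a field define open sets of fields, because `D` is
compact. The map `b` allows the condition to depend on the point. -/
theorem isOpen_setOf_forall_fieldMap {Y : Type*} [TopologicalSpace Y] {b : D → Y}
    (hb : Continuous b) {S : Set (TangentBundle 𝓘(ℝ, E) M × Y)} (hS : IsOpen S) :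
    IsOpen {v : CkField x | ∀ q, (fieldMap x v.val q, b q) ∈ S} := by
  refine isOpen_iff_mem_nhds.2 fun v₀ hv₀ => ?_
  have h : ∀ q ∈ (Set.univ : Set D), ∀ᶠ z : CkField x × D in 𝓝 (v₀, q),
      (fieldMap x z.1.val z.2, b z.2) ∈ S := by
    intro q _
    exact ((continuousAt_fieldMap v₀ q).prodMk (hb.continuousAt.comp continuousAt_snd)).eventually
      (hS.mem_nhds (hv₀ q))
  have h2 := isCompact_univ.eventually_forall_of_forall_eventually
    (P := fun (v : CkField x) q => (fieldMap x v.val q, b q) ∈ S) h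
  filter_upwards [h2] with v hv q
  exact hv q trivial

end JointContinuity

/-! ### The Banach manifold of maps, left-compositions and evaluations -/

open BanachManifold

section Charts

variable {ED : Type*} [NormedAddCommGroup ED] [NormedSpace ℝ ED] {HD : Type*} [TopologicalSpace HD]
  {I : ModelWithCorners ℝ ED HD} {D : Type*} [TopologicalSpace D] [ChartedSpace HD D]
  [IsManifold I ∞ D] [CompactSpace D] [T2Space D] {k : ℕ}
  {E : Type*} [NormedAddCommGroup E] [NormedSpace ℝ E]
  {M : Type*} [TopologicalSpace M] [ChartedSpace E M] [IsManifold 𝓘(ℝ, E) ∞ M]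
  {E' : Type*} [NormedAddCommGroup E'] [NormedSpace ℝ E']
  {M' : Type*} [TopologicalSpace M'] [ChartedSpace E' M'] [IsManifold 𝓘(ℝ, E') ∞ M']

namespace MapChartIndex

variable (i : MapChartIndex I D E M k)

theorem chart_symm_apply {v : CkField i.center} (hv : v ∈ i.chart.target) (p : D) :
    i.chart.symm v p = i.add.endpoint (fieldMap i.center v.val p) := by
  have h : i.chart.symm v = i.ofField v hv := dif_pos hv
  rw [h]
  rfl

theorem fieldMap_chart {y : C^k⟮I, D; 𝓘(ℝ, E), M⟯} (hy : y ∈ i.chart.source) (p : D) :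
    fieldMap i.center (i.chart y).val p =
      i.add.toOpenPartialHomeomorph.symm (i.center p, y p) := by
  have h : i.chart y = i.toField y hy := dif_pos hy
  rw [h]
  exact i.fieldMap_toField y hy p

/-- The chart of `C^k(D, M)`, in charts of `M`. -/
theorem fieldTriv_chart {y : C^k⟮I, D; 𝓘(ℝ, E), M⟯} (hy : y ∈ i.chart.source) {r q : D}
    (hq : i.center q ∈ (chartAt E (i.center r)).source) {φ : OpenPartialHomeomorph M E}
    (hφ : y q ∈ φ.source) :
    fieldTriv i.center r (i.chart y).val q =
      i.add.logRep (i.center r) φ (chartAt E (i.center r) (i.center q), φ (y q)) := by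
  rw [LocalAddition.logRep, (chartAt E (i.center r)).left_inv hq, φ.left_inv hφ,
    ← i.fieldMap_chart hy]
  rfl

theorem mk_mem_logDomain {y : C^k⟮I, D; 𝓘(ℝ, E), M⟯} (hy : y ∈ i.chart.source) {r q : D}
    (hq : i.center q ∈ (chartAt E (i.center r)).source) {φ : OpenPartialHomeomorph M E}
    (hφ : y q ∈ φ.source) :
    (chartAt E (i.center r) (i.center q), φ (y q)) ∈ i.add.logDomain (i.center r) φ := by
  refine ⟨(chartAt E (i.center r)).map_source hq, φ.map_source hφ, ?_⟩
  simp only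
  rw [(chartAt E (i.center r)).left_inv hq, φ.left_inv hφ]
  exact hy q

/-- The inverse of the chart of `C^k(D, M)`, in charts of `M`. -/
theorem chart_symm_rep {v : CkField i.center} (hv : v ∈ i.chart.target) {r q : D}
    (hq : i.center q ∈ (chartAt E (i.center r)).source) (φ : OpenPartialHomeomorph M E) :
    φ (i.chart.symm v q) = i.add.expRep (i.center r) φ
      (chartAt E (i.center r) (i.center q), evTriv i.center r q v) := by
  rw [i.chart_symm_apply hv, evTriv_apply, ← tangentChart_fieldMap, LocalAddition.expRep_tangentChart]
  exact hq

theorem mk_mem_expDomain {v : CkField i.center} (hv : v ∈ i.chart.target) {r q : D}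
    (hq : i.center q ∈ (chartAt E (i.center r)).source) {φ : OpenPartialHomeomorph M E}
    (hφ : i.chart.symm v q ∈ φ.source) :
    (chartAt E (i.center r) (i.center q), evTriv i.center r q v) ∈
      i.add.expDomain (i.center r) φ := by
  rw [evTriv_apply, ← tangentChart_fieldMap]
  rw [i.chart_symm_apply hv] at hφ
  exact i.add.tangentChart_mem_expDomain (hv q) hq hφ

theorem isOpen_chart_target : IsOpen i.chart.target := by
  have h := isOpen_setOf_forall_fieldMap (x := i.center) (b := i.center)
    i.center.contMDiff.continuous (i.add.open_source.prod isOpen_univ)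
  convert h using 1
  ext v
  exact forall_congr' fun p => (and_iff_left trivial).symm

theorem continuousAt_chart_symm {v₀ : CkField i.center} (hv₀ : v₀ ∈ i.chart.target) (q₀ : D) :
    ContinuousAt (fun z : CkField i.center × D => i.chart.symm z.1 z.2) (v₀, q₀) := by
  have h1 : ContinuousAt i.add.endpoint (fieldMap i.center v₀.val q₀) :=
    i.add.contMDiffOn_endpoint.continuousOn.continuousAt (i.add.open_source.mem_nhds (hv₀ q₀))
  have h2 := ContinuousAt.comp (g := i.add.endpoint)
    (f := fun z : CkField i.center × D => fieldMap i.center z.1.val z.2) (x := (v₀, q₀)) h1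
    (continuousAt_fieldMap v₀ q₀)
  refine h2.congr ?_
  filter_upwards [(continuous_fst.continuousAt (x := (v₀, q₀))).eventually
    (i.isOpen_chart_target.mem_nhds hv₀)] with z hz
  exact (i.chart_symm_apply hz z.2).symm

variable (j : MapChartIndex I D E' M' k) (f : C^∞⟮𝓘(ℝ, E), M; 𝓘(ℝ, E'), M'⟯)

theorem isOpen_leftComp_domain :
    IsOpen (i.chart.target ∩ i.chart.symm ⁻¹' (leftComp I D k f ⁻¹' j.chart.source)) := by
  let S : Set (TangentBundle 𝓘(ℝ, E) M × M') := (i.add.source ×ˢ Set.univ) ∩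
    (fun z => (z.2, f (i.add.endpoint z.1))) ⁻¹' j.add.target
  have hc : ContinuousOn (fun z : TangentBundle 𝓘(ℝ, E) M × M' => (z.2, f (i.add.endpoint z.1)))
      (i.add.source ×ˢ Set.univ) :=
    continuousOn_snd.prodMk (f.contMDiff.continuous.comp_continuousOn
      (i.add.contMDiffOn_endpoint.continuousOn.comp continuousOn_fst fun z hz => hz.1))
  have hS : IsOpen S := hc.isOpen_inter_preimage (i.add.open_source.prod isOpen_univ)
    j.add.open_target
  convert isOpen_setOf_forall_fieldMap (x := i.center) (b := j.center)
    j.center.contMDiff.continuous hS using 1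
  ext v
  constructor
  · rintro ⟨hv, hv'⟩ q
    refine ⟨⟨hv q, trivial⟩, ?_⟩
    have := hv' q
    change (j.center q, f (i.chart.symm v q)) ∈ _ at this
    rwa [i.chart_symm_apply hv] at this
  · intro hv
    have hv1 : v ∈ i.chart.target := fun q => (hv q).1.1
    refine ⟨hv1, fun q => ?_⟩
    change (j.center q, f (i.chart.symm v q)) ∈ _
    rw [i.chart_symm_apply hv1]
    exact (hv q).2

/-- In the charts of the spaces of maps, the left-composition with a smooth map is smooth: it is a
pushforward by `log ∘ f ∘ exp`, where `exp` and `log` stand for the local addition at the centre of `i`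
and the inverse of the one at the centre of `j`. -/
theorem contDiffOn_leftComp [CompleteSpace E'] :
    ContDiffOn ℝ ∞ (j.chart ∘ leftComp I D k f ∘ i.chart.symm)
      (i.chart.target ∩ i.chart.symm ⁻¹' (leftComp I D k f ⁻¹' j.chart.source)) := by
  refine contDiffOn_of_hasPushforwardForm (F := (E × E) × E') (i.isOpen_leftComp_domain j f)
    fun u₀ hu₀ r q₀ hq₀ hyq₀ => ?_
  have hU := i.isOpen_leftComp_domain j f
  let x := i.center
  let y := j.center
  let φ := chartAt E (i.chart.symm u₀ q₀)
  let φ' := chartAt E' (f (i.chart.symm u₀ q₀))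
  have hxq₀ := ChartedSpace.mem_chart_source (H := E) (x q₀)
  let fφ : E → E' := φ' ∘ f ∘ φ.symm
  have hfφ : ContDiffOn ℝ ∞ fφ (φ.target ∩ φ.symm ⁻¹' (f ⁻¹' φ'.source)) := by
    rw [← contMDiffOn_iff_contDiffOn]
    have h1 : ContMDiffOn 𝓘(ℝ, E) 𝓘(ℝ, E) ∞ φ.symm φ.target := contMDiffOn_chart_symm
    have h2 : ContMDiffOn 𝓘(ℝ, E') 𝓘(ℝ, E') ∞ φ' φ'.source := contMDiffOn_chart
    exact h2.comp (f.contMDiff.comp_contMDiffOn (h1.mono Set.inter_subset_left)) fun z hz => hz.2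
  have hDφ : IsOpen (φ.target ∩ φ.symm ⁻¹' (f ⁻¹' φ'.source)) :=
    φ.symm.isOpen_inter_preimage (φ'.open_source.preimage f.contMDiff.continuous)
  let g₁ : (E × E) × E' → E := fun z => i.add.expRep (x q₀) φ z.1
  let Ω₁ : Set ((E × E) × E') := Prod.fst ⁻¹' i.add.expDomain (x q₀) φ
  have hΩ₁ : IsOpen Ω₁ := i.add.isOpen_expDomain.preimage continuous_fst
  have hg₁ : ContDiffOn ℝ ∞ g₁ Ω₁ :=
    (i.add.contDiffOn_expRep (chart_mem_atlas E _)).comp contDiff_fst.contDiffOn fun z hz => hz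
  let Ω₂ : Set ((E × E) × E') := Ω₁ ∩ g₁ ⁻¹' (φ.target ∩ φ.symm ⁻¹' (f ⁻¹' φ'.source))
  have hΩ₂ : IsOpen Ω₂ := hg₁.continuousOn.isOpen_inter_preimage hΩ₁ hDφ
  have hg₂ : ContDiffOn ℝ ∞ (fun z => (z.2, fφ (g₁ z))) Ω₂ :=
    contDiff_snd.contDiffOn.prodMk (hfφ.comp (hg₁.mono Set.inter_subset_left) fun z hz => hz.2)
  let Ω : Set ((E × E) × E') := Ω₂ ∩ (fun z => (z.2, fφ (g₁ z))) ⁻¹' j.add.logDomain (y r) φ'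
  have hΩ : IsOpen Ω := hg₂.continuousOn.isOpen_inter_preimage hΩ₂ j.add.isOpen_logDomain
  have hg₃ : ContDiffOn ℝ ∞ (fun z => j.add.logRep (y r) φ' (z.2, fφ (g₁ z))) Ω :=
    (j.add.contDiffOn_logRep (chart_mem_atlas E' _)).comp (hg₂.mono Set.inter_subset_left)
      fun z hz => hz.2
  let ι : E →L[ℝ] (E × E) × E' :=
    (ContinuousLinearMap.inl ℝ (E × E) E').comp (ContinuousLinearMap.inr ℝ E E)
  refine ⟨fun q => ((chartAt E (x q₀) (x q), 0), chartAt E' (y r) (y q)),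
    fun q => ι.comp (evTriv x q₀ q), fun z => j.add.logRep (y r) φ' (z.2, fφ (g₁ z)), Ω, hΩ, hg₃,
    ?_, (ckBounded_evTriv hq₀ hxq₀).clm_comp (Filter.Eventually.of_forall fun _ => contMDiffAt_const),
    ?_⟩
  · filter_upwards [eventually_mem_chartAt_source hxq₀, eventually_mem_chartAt_source hyq₀]
      with q hq hq'
    exact ((contMDiffAt_chartAt_comp hq).prodMk_space contMDiffAt_const).prodMk_space
      (contMDiffAt_chartAt_comp hq')
  · have hsnd := continuous_snd.continuousAt (x := (u₀, q₀))
    have hend := i.continuousAt_chart_symm hu₀.1 q₀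
    filter_upwards [(continuous_fst.continuousAt (x := (u₀, q₀))).eventually (hU.mem_nhds hu₀),
      hsnd.eventually (eventually_mem_chartAt_source hxq₀),
      hsnd.eventually (eventually_mem_chartAt_source hyq₀),
      hend.eventually (φ.open_source.mem_nhds (ChartedSpace.mem_chart_source _)),
      (f.contMDiff.continuous.continuousAt.comp hend).eventually
        (φ'.open_source.mem_nhds (_root_.mem_chart_source E' (f (i.chart.symm u₀ q₀))))]
      with z hzU hzx hzy hzφ hzφ'
    obtain ⟨v, q⟩ := z
    have hsum : (((chartAt E (x q₀) (x q), (0 : E)), chartAt E' (y r) (y q)) : (E × E) × E') +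
        ι.comp (evTriv x q₀ q) v =
        ((chartAt E (x q₀) (x q), evTriv x q₀ q v), chartAt E' (y r) (y q)) := by
      simp [ι]
    have hg₁v : i.add.expRep (x q₀) φ (chartAt E (x q₀) (x q), evTriv x q₀ q v) =
        φ (i.chart.symm v q) := (i.chart_symm_rep hzU.1 hzx φ).symm
    have hfv : fφ (φ (i.chart.symm v q)) = φ' (f (i.chart.symm v q)) := by
      simp only [fφ, Function.comp_apply]
      rw [φ.left_inv hzφ]
    change _ + ι.comp (evTriv x q₀ q) v ∈ Ω ∧ fieldTriv y r (j.chart _).val q =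
      j.add.logRep (y r) φ' ((_ + ι.comp (evTriv x q₀ q) v).2, fφ (g₁ (_ + _)))
    rw [hsum]
    have hg₁v' : g₁ ((chartAt E (x q₀) (x q), evTriv x q₀ q v), chartAt E' (y r) (y q)) =
      φ (i.chart.symm v q) := hg₁v
    refine ⟨⟨⟨i.mk_mem_expDomain hzU.1 hzx hzφ, ?_⟩, ?_⟩, ?_⟩
    · rw [Set.mem_preimage, hg₁v']
      refine ⟨φ.map_source hzφ, ?_⟩
      rw [Set.mem_preimage, φ.left_inv hzφ]
      exact hzφ'
    · rw [Set.mem_preimage, hg₁v', hfv]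
      exact j.mk_mem_logDomain hzU.2 hzy hzφ'
    · rw [hg₁v', hfv]
      exact j.fieldTriv_chart hzU.2 hzy hzφ'

end MapChartIndex

theorem leftComp_id (y : C^k⟮I, D; 𝓘(ℝ, E), M⟯) : leftComp I D k ContMDiffMap.id y = y := by
  ext p
  rfl

/-- The charts cover because there are local additions around the compact images, and the transition
maps are the representations of the left-composition with the identity. -/
theorem isSmoothAtlas_mapAtlas [FiniteDimensional ℝ E] [T2Space M] :
    (mapAtlas I D E M k).IsSmoothAtlas where
  complete i := by
    have : CompleteSpace E := FiniteDimensional.complete ℝ E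
    exact inferInstanceAs (CompleteSpace (CkField (MapChartIndex.center i)))
  cover x := by
    obtain ⟨α, hα⟩ := exists_localAddition (E := E) (M := M)
      (isCompact_range x.contMDiff.continuous)
    refine ⟨⟨x, α, fun p => hα _ (Set.mem_range_self p)⟩, fun p => ?_⟩
    have h := hα (x p) (Set.mem_range_self p)
    have h2 := α.toOpenPartialHomeomorph.map_source h
    have h3 : α.toOpenPartialHomeomorph (⟨x p, 0⟩ : TangentBundle 𝓘(ℝ, E) M) = (x p, x p) :=
      α.apply_zero _ h
    rwa [h3] at h2
  isOpen_overlap i j := by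
    have := MapChartIndex.isOpen_leftComp_domain i j ContMDiffMap.id
    rwa [show leftComp I D k (ContMDiffMap.id : C^∞⟮𝓘(ℝ, E), M; 𝓘(ℝ, E), M⟯) = id from
      funext leftComp_id] at this
  contDiffOn_trans i j := by
    have : CompleteSpace E := FiniteDimensional.complete ℝ E
    have := MapChartIndex.contDiffOn_leftComp i j ContMDiffMap.id
    rwa [show leftComp I D k (ContMDiffMap.id : C^∞⟮𝓘(ℝ, E), M; 𝓘(ℝ, E), M⟯) = id from
      funext leftComp_id] at this

theorem isSmooth_leftComp [CompleteSpace E'] (h : (mapAtlas I D E M k).IsSmoothAtlas)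
    (h' : (mapAtlas I D E' M' k).IsSmoothAtlas) (f : C^∞⟮𝓘(ℝ, E), M; 𝓘(ℝ, E'), M'⟯) :
    IsSmooth (mapManifold h) (mapManifold h') (leftComp I D k f) := fun i j =>
  ⟨MapChartIndex.isOpen_leftComp_domain i j f, MapChartIndex.contDiffOn_leftComp i j f⟩

theorem isSmooth_eval [FiniteDimensional ℝ E] (h : (mapAtlas I D E M k).IsSmoothAtlas) (p : D) :
    IsSmooth (mapManifold h) (ofManifold E M) (fun x => x p) := by
  intro (i : MapChartIndex I D E M k) (e : atlas E M)
  have ho : IsOpen (i.chart.target ∩ (fun v => i.chart.symm v p) ⁻¹' e.1.source) := by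
    refine ContinuousOn.isOpen_inter_preimage (fun v hv => ?_) i.isOpen_chart_target e.1.open_source
    exact ((i.continuousAt_chart_symm hv p).comp (f := fun v => (v, p))
      (by fun_prop)).continuousWithinAt
  refine ⟨ho, ?_⟩
  have hp := ChartedSpace.mem_chart_source (H := E) (i.center p)
  have h1 : ContDiffOn ℝ ∞ (fun v : CkField i.center => i.add.expRep (i.center p) e.1
      (chartAt E (i.center p) (i.center p), evTriv i.center p p v))
      (i.chart.target ∩ (fun v => i.chart.symm v p) ⁻¹' e.1.source) :=
    (i.add.contDiffOn_expRep e.2).comp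
      (contDiff_const.prodMk (evTriv i.center p p).contDiff).contDiffOn
      fun v hv => i.mk_mem_expDomain hv.1 hp hv.2
  exact h1.congr fun v hv => i.chart_symm_rep hv.1 hp e.1

end Charts

/-! ### Second derivatives, and fibre derivatives of local additions -/

section Calculus

variable {X Y V G : Type*} [NormedAddCommGroup X] [NormedSpace ℝ X] [NormedAddCommGroup Y]
  [NormedSpace ℝ Y] [NormedAddCommGroup V] [NormedSpace ℝ V] [NormedAddCommGroup G]
  [NormedSpace ℝ G]

/-- The first two derivatives of the composition of a smooth function with an affine map. -/
theorem fderiv_fderiv_comp_affine {f : V → G} {Ω : Set V} (hΩ : IsOpen Ω)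
    (hf : ContDiffOn ℝ ∞ f Ω) (a : V) (L : X →L[ℝ] V) {g : X → G} {x : X} (hx : a + L x ∈ Ω)
    (hg : g =ᶠ[𝓝 x] fun y => f (a + L y)) :
    (∀ u, fderiv ℝ g x u = fderiv ℝ f (a + L x) (L u)) ∧
      ∀ u v, fderiv ℝ (fderiv ℝ g) x u v = fderiv ℝ (fderiv ℝ f) (a + L x) (L u) (L v) := by
  have hA : ∀ y, HasFDerivAt (fun y => a + L y) L y := fun y => L.hasFDerivAt.const_add a
  have h1 : ∀ y, a + L y ∈ Ω →
      fderiv ℝ (fun y => f (a + L y)) y = (fderiv ℝ f (a + L y)).comp L := by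
    intro y hy
    have hd := ((hf.contDiffAt (hΩ.mem_nhds hy)).differentiableAt (by simp)).hasFDerivAt
    exact (HasFDerivAt.comp (g := f) (f := fun y => a + L y) y hd (hA y)).fderiv
  have hop : IsOpen {y | a + L y ∈ Ω} := hΩ.preimage (by fun_prop)
  have h2 : fderiv ℝ g =ᶠ[𝓝 x] fun y => (fderiv ℝ f (a + L y)).comp L := by
    filter_upwards [hg.eventuallyEq_nhds, hop.mem_nhds hx] with y hy hyΩ
    rw [hy.fderiv_eq, h1 y hyΩ]
  refine ⟨fun u => by rw [h2.self_of_nhds]; rfl, fun u v => ?_⟩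
  have hd := (((hf.fderiv_of_isOpen (m := ∞) hΩ (by simp)).contDiffAt
    (hΩ.mem_nhds hx)).differentiableAt (by simp)).hasFDerivAt
  have h3 := (HasFDerivAt.comp (g := fderiv ℝ f) (f := fun y => a + L y) x hd (hA x)).clm_comp
    (hasFDerivAt_const L x)
  rw [h2.fderiv_eq]
  refine (congrArg (fun T => T u v) h3.fderiv).trans ?_
  simp

/-- A smooth map `Ψ (z, u, v)` that is homogeneous in `u` and in `v` is a smooth family of bounded
bilinear maps: these are the mixed second derivatives at `(z, 0, 0)`. -/
theorem exists_contDiffOn_bilinear {Ψ : X × V × G → Y} {U : Set X} (hU : IsOpen U)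
    (hΨ : ContDiffOn ℝ ∞ Ψ (U ×ˢ Set.univ))
    (h1 : ∀ z ∈ U, ∀ (c : ℝ) u v, Ψ (z, c • u, v) = c • Ψ (z, u, v))
    (h2 : ∀ z ∈ U, ∀ (c : ℝ) u v, Ψ (z, u, c • v) = c • Ψ (z, u, v)) :
    ∃ Γ : X → V →L[ℝ] G →L[ℝ] Y, ContDiffOn ℝ ∞ Γ U ∧ ∀ z ∈ U, ∀ u v, Γ z u v = Ψ (z, u, v) := by
  have hop : IsOpen (U ×ˢ (Set.univ : Set (V × G))) := hU.prod isOpen_univ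
  let ιu : V →L[ℝ] X × V × G :=
    (ContinuousLinearMap.inr ℝ X (V × G)).comp (ContinuousLinearMap.inl ℝ V G)
  let ιv : G →L[ℝ] X × V × G :=
    (ContinuousLinearMap.inr ℝ X (V × G)).comp (ContinuousLinearMap.inr ℝ V G)
  have hline : ∀ {W Z : Type _} [NormedAddCommGroup W] [NormedSpace ℝ W] [NormedAddCommGroup Z]
      [NormedSpace ℝ Z] (f : W → Z) (w d : W) (y : Z), DifferentiableAt ℝ f w →
      (∀ t : ℝ, f (w + t • d) = f w + t • y) → fderiv ℝ f w d = y := by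
    intro W Z _ _ _ _ f w d y hf h
    have hd := hf.hasFDerivAt
    have h3 : HasDerivAt (fun t : ℝ => w + t • d) d 0 := by
      simpa using ((hasDerivAt_id (0 : ℝ)).smul_const d).const_add w
    have h4 : HasDerivAt (fun t : ℝ => f (w + t • d)) (fderiv ℝ f w d) 0 :=
      HasFDerivAt.comp_hasDerivAt (l := f) (f := fun t : ℝ => w + t • d) 0 (by simpa using hd) h3
    have h5 : HasDerivAt (fun t : ℝ => f (w + t • d)) y 0 := by
      rw [funext h]
      simpa using ((hasDerivAt_id (0 : ℝ)).smul_const y).const_add (f w)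
    exact h4.unique h5
  have hsm := hΨ.fderiv_of_isOpen (m := ∞) hop (by simp)
  have hsm2 := hsm.fderiv_of_isOpen (m := ∞) hop (by simp)
  have hΨ1 : ∀ z ∈ U, ∀ u v, fderiv ℝ Ψ (z, u, 0) (ιv v) = Ψ (z, u, v) := by
    intro z hz u v
    have hmem : (z, u, (0 : G)) ∈ U ×ˢ (Set.univ : Set (V × G)) := ⟨hz, trivial⟩
    have h0 : Ψ (z, u, 0) = 0 := by simpa using h2 z hz 0 u 0
    refine hline Ψ (z, u, 0) (ιv v) _
      ((hΨ.contDiffAt (hop.mem_nhds hmem)).differentiableAt (by simp)) fun t => ?_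
    rw [h0, zero_add, ← h2 z hz]
    simp [ιv]
  have hΨ2 : ∀ z ∈ U, ∀ u v, fderiv ℝ (fderiv ℝ Ψ) (z, 0, 0) (ιu u) (ιv v) = Ψ (z, u, v) := by
    intro z hz u v
    have hmem : (z, (0 : V), (0 : G)) ∈ U ×ˢ (Set.univ : Set (V × G)) := ⟨hz, trivial⟩
    have hd := (hsm.contDiffAt (hop.mem_nhds hmem)).differentiableAt (by simp)
    have h3 : fderiv ℝ (fun w => fderiv ℝ Ψ w (ιv v)) (z, 0, 0) (ιu u) = Ψ (z, u, v) := by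
      refine hline (fun w => fderiv ℝ Ψ w (ιv v)) (z, 0, 0) (ιu u) _
        (hd.clm_apply (differentiableAt_const _)) fun t => ?_
      have e1 : ((z, 0, 0) : X × V × G) + t • ιu u = (z, t • u, 0) := by simp [ιu]
      have h0 : Ψ (z, 0, v) = 0 := by simpa using h1 z hz 0 0 v
      rw [e1, hΨ1 z hz, hΨ1 z hz, h0, zero_add, h1 z hz]
    rw [← h3]
    have h4 := hd.hasFDerivAt.clm_apply (hasFDerivAt_const (ιv v) (z, (0 : V), (0 : G)))
    rw [h4.fderiv]
    simp
  refine ⟨fun z => ((ContinuousLinearMap.compL ℝ G (X × V × G) Y).flip ιv).comp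
    ((fderiv ℝ (fderiv ℝ Ψ) (z, 0, 0)).comp ιu), ?_, fun z hz u v => ?_⟩
  · have h3 : ContDiffOn ℝ ∞ (fun z => fderiv ℝ (fderiv ℝ Ψ) (z, 0, 0)) U :=
      hsm2.comp (contDiff_id.prodMk contDiff_const).contDiffOn fun z hz => ⟨hz, trivial⟩
    exact contDiffOn_const.clm_comp (h3.clm_comp contDiffOn_const)
  · rw [← hΨ2 z hz u v]
    rfl

end Calculus

namespace LocalAddition

variable {E : Type*} [NormedAddCommGroup E] [NormedSpace ℝ E]
  {M : Type*} [TopologicalSpace M] [ChartedSpace E M] [IsManifold 𝓘(ℝ, E) ∞ M]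
  (α : LocalAddition E M) {m : M} {φ : OpenPartialHomeomorph M E}

/-- The partial derivative of `expRep` along the fibre is injective. -/
theorem fderiv_logRep_expRep (hφ : φ ∈ atlas E M) {z : E × E} (hz : z ∈ α.expDomain m φ) (w : E) :
    fderiv ℝ (α.logRep m φ) (z.1, α.expRep m φ z) (0, fderiv ℝ (α.expRep m φ) z (0, w)) = w := by
  have hW := (((α.contDiffOn_expRep hφ).contDiffAt
    (α.isOpen_expDomain.mem_nhds hz)).differentiableAt (by simp)).hasFDerivAt
  have hL := (((α.contDiffOn_logRep hφ).contDiffAt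
    (α.isOpen_logDomain.mem_nhds (α.mk_expRep_mem_logDomain hz))).differentiableAt
      (by simp)).hasFDerivAt
  have h1 : HasFDerivAt (fun z : E × E => (z.1, α.expRep m φ z)) _ z := hasFDerivAt_fst.prodMk hW
  have h2 := HasFDerivAt.comp (g := α.logRep m φ) (f := fun z : E × E => (z.1, α.expRep m φ z)) z
    hL h1
  have h3 : (α.logRep m φ ∘ fun z : E × E => (z.1, α.expRep m φ z)) =ᶠ[𝓝 z] Prod.snd := by
    filter_upwards [α.isOpen_expDomain.mem_nhds hz] with z hz
    exact α.logRep_expRep hz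
  have h4 := (h2.congr_of_eventuallyEq h3.symm).unique hasFDerivAt_snd
  simpa using congrArg (fun T => T ((0 : E), w)) h4

/-- The partial derivative of `expRep` along the fibre is surjective, with inverse the partial
derivative of `logRep`. -/
theorem fderiv_expRep_logRep (hφ : φ ∈ atlas E M) {z : E × E} (hz : z ∈ α.expDomain m φ) (n : E) :
    fderiv ℝ (α.expRep m φ) z (0, fderiv ℝ (α.logRep m φ) (z.1, α.expRep m φ z) (0, n)) = n := by
  have hz' := α.mk_expRep_mem_logDomain hz
  have hL := (((α.contDiffOn_logRep hφ).contDiffAt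
    (α.isOpen_logDomain.mem_nhds hz')).differentiableAt (by simp)).hasFDerivAt
  have hW : HasFDerivAt (α.expRep m φ) (fderiv ℝ (α.expRep m φ) z)
      (z.1, α.logRep m φ (z.1, α.expRep m φ z)) := by
    rw [α.logRep_expRep hz]
    exact (((α.contDiffOn_expRep hφ).contDiffAt
      (α.isOpen_expDomain.mem_nhds hz)).differentiableAt (by simp)).hasFDerivAt
  have h1 : HasFDerivAt (fun y : E × E => (y.1, α.logRep m φ y)) _ (z.1, α.expRep m φ z) :=
    hasFDerivAt_fst.prodMk hL
  have h2 := HasFDerivAt.comp (g := α.expRep m φ) (f := fun y : E × E => (y.1, α.logRep m φ y))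
    (z.1, α.expRep m φ z) hW h1
  have h3 : (α.expRep m φ ∘ fun y : E × E => (y.1, α.logRep m φ y)) =ᶠ[𝓝 (z.1, α.expRep m φ z)]
      Prod.snd := by
    filter_upwards [α.isOpen_logDomain.mem_nhds hz'] with y hy
    exact α.expRep_logRep hy
  have h4 := (h2.congr_of_eventuallyEq h3.symm).unique hasFDerivAt_snd
  simpa using congrArg (fun T => T ((0 : E), n)) h4

/-- Independence of charts of the fibre derivative of the inverse of a local addition. -/
theorem fderiv_logRep_change {m' y₀ y : M} {φ' : OpenPartialHomeomorph M E} (hφ : φ ∈ atlas E M)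
    (hφ' : φ' ∈ atlas E M) (h : (y₀, y) ∈ α.target) (hm : y₀ ∈ (chartAt E m).source)
    (hm' : y₀ ∈ (chartAt E m').source) (hy : y ∈ φ.source) (hy' : y ∈ φ'.source) (w : E) :
    fderiv ℝ (chartAt E m' ∘ (chartAt E m).symm) (chartAt E m y₀)
        (fderiv ℝ (α.logRep m φ) (chartAt E m y₀, φ y) (0, w)) =
      fderiv ℝ (α.logRep m' φ') (chartAt E m' y₀, φ' y)
        (0, fderiv ℝ (φ' ∘ φ.symm) (φ y) w) := by
  have hmem : ∀ (m : M) (φ : OpenPartialHomeomorph M E), y₀ ∈ (chartAt E m).source →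
      ∀ y, y ∈ φ.source → (y₀, y) ∈ α.target → (chartAt E m y₀, φ y) ∈ α.logDomain m φ := by
    intro m φ hm y hy h
    refine ⟨(chartAt E m).map_source hm, φ.map_source hy, ?_⟩
    simp only
    rwa [(chartAt E m).left_inv hm, φ.left_inv hy]
  have hL : ∀ (m : M) (φ : OpenPartialHomeomorph M E), φ ∈ atlas E M →
      y₀ ∈ (chartAt E m).source → y ∈ φ.source → HasFDerivAt (fun b => α.logRep m φ
        (chartAt E m y₀, b)) ((fderiv ℝ (α.logRep m φ) (chartAt E m y₀, φ y)).comp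
          (ContinuousLinearMap.inr ℝ E E)) (φ y) := by
    intro m φ hφ hm hy
    have h1 := (((α.contDiffOn_logRep hφ).contDiffAt
      (α.isOpen_logDomain.mem_nhds (hmem m φ hm y hy h))).differentiableAt (by simp)).hasFDerivAt
    exact HasFDerivAt.comp (g := α.logRep m φ) (f := fun b => (chartAt E m y₀, b)) (φ y) h1
      (hasFDerivAt_prodMk_right _ _)
  have hτ : HasFDerivAt (φ' ∘ φ.symm) (fderiv ℝ (φ' ∘ φ.symm) (φ y)) (φ y) := by
    have h1 := ((contDiffGroupoid ∞ 𝓘(ℝ, E)).compatible hφ hφ').1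
    have h2 : ContDiffOn ℝ ∞ (φ' ∘ φ.symm) (φ.target ∩ φ.symm ⁻¹' φ'.source) := by
      simpa [contDiffPregroupoid] using h1
    have h3 : IsOpen (φ.target ∩ φ.symm ⁻¹' φ'.source) :=
      φ.symm.isOpen_inter_preimage φ'.open_source
    refine ((h2.contDiffAt (h3.mem_nhds ⟨φ.map_source hy, ?_⟩)).differentiableAt
      (by simp)).hasFDerivAt
    rwa [Set.mem_preimage, φ.left_inv hy]
  have hτy : (φ' ∘ φ.symm) (φ y) = φ' y := by rw [Function.comp_apply, φ.left_inv hy]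
  have h1 := hL m' φ' hφ' hm' hy'
  rw [← hτy] at h1
  have h2 := HasFDerivAt.comp (g := fun b => α.logRep m' φ' (chartAt E m' y₀, b)) (φ y) h1 hτ
  have h3 := (fderiv ℝ (chartAt E m' ∘ (chartAt E m).symm)
    (chartAt E m y₀)).hasFDerivAt.comp (φ y) (hL m φ hφ hm hy)
  have h4 : (fun b => α.logRep m' φ' (chartAt E m' y₀, b)) ∘ (φ' ∘ φ.symm) =ᶠ[𝓝 (φ y)]
      (fderiv ℝ (chartAt E m' ∘ (chartAt E m).symm) (chartAt E m y₀)) ∘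
        fun b => α.logRep m φ (chartAt E m y₀, b) := by
    have ho : IsOpen (φ.target ∩ φ.symm ⁻¹' (φ'.source ∩ (fun y => (y₀, y)) ⁻¹' α.target)) :=
      φ.symm.isOpen_inter_preimage (φ'.open_source.inter (α.open_target.preimage (by fun_prop)))
    have hin : φ y ∈ φ.target ∩ φ.symm ⁻¹' (φ'.source ∩ (fun y => (y₀, y)) ⁻¹' α.target) := by
      refine ⟨φ.map_source hy, ?_⟩
      rw [Set.mem_preimage, φ.left_inv hy]
      exact ⟨hy', h⟩
    filter_upwards [ho.mem_nhds hin] with b hb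
    have hp := α.proj_symm hb.2.2
    simp only [Function.comp_apply, logRep]
    rw [φ'.left_inv hb.2.1, (chartAt E m).left_inv hm, (chartAt E m').left_inv hm',
      trivializationAt_snd, trivializationAt_snd]
    simp only at hp
    rw [hp, fderiv_chart_trans_comp (mem_chart_source E y₀) hm hm']
    rfl
  have h5 := congrArg (fun T => T w) ((h2.congr_of_eventuallyEq h4.symm).unique h3)
  simp only [ContinuousLinearMap.comp_apply, ContinuousLinearMap.inr_apply] at h5
  rw [hτy] at h5
  exact h5.symm

end LocalAddition

namespace BanachManifold

universe u₁ v₁ w₁ u₂ v₂ w₂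

variable {X : Type u₁} {A : BanachManifold.{u₁, v₁, w₁} X} {Y : Type u₂}
  {B : BanachManifold.{u₂, v₂, w₂} Y} {P' : B.tangent.TBundle → B.TBundle} {f : X → Y}

/-- The value of a connection on the second differential of a smooth map, in charts. -/
theorem coord_connection_tmap_tmap (hf : IsSmooth A B f) {i : A.ι} {j : B.ι} {Γ'}
    (hΓ' : B.IsChristoffel P' j Γ') {e : A.TBundle} (η : A.tangent.Tangent e)
    (hi : e.1 ∈ (A.chart i).source) (hj : f e.1 ∈ (B.chart j).source) :
    coord j (P' (tmap A.tangent B.tangent (tmap A B f) ⟨e, η⟩)).2 =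
      fderiv ℝ (fderiv ℝ (rep A B i j f)) (A.chart i e.1) (dcoord i η).1 (coord i e.2) +
        fderiv ℝ (rep A B i j f) (A.chart i e.1) (dcoord i η).2 +
        Γ' (B.chart j (f e.1)) (fderiv ℝ (rep A B i j f) (A.chart i e.1) (dcoord i η).1)
          (fderiv ℝ (rep A B i j f) (A.chart i e.1) (coord i e.2)) := by
  have h1 : coord j (P' (tmap A.tangent B.tangent (tmap A B f) ⟨e, η⟩)).2 = _ :=
    hΓ'.coord_eq (tmap A B f e) (dmap A.tangent B.tangent (tmap A B f) e η) hj
  rw [hf.coord_dmap_tmap hi hj η] at h1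
  have h1' : coord j (tmap A B f e).2 = _ := hf.coord_dmap hi hj e.2
  rw [h1'] at h1
  exact h1

end BanachManifold

/-! ### Christoffel symbols of the natural connection -/

namespace LocalAddition

variable {E : Type*} [NormedAddCommGroup E] [NormedSpace ℝ E]
  {M : Type*} [TopologicalSpace M] [ChartedSpace E M] [IsManifold 𝓘(ℝ, E) ∞ M]
  (α : LocalAddition E M)

/-- The Christoffel symbols of a connection, pulled back along the fibres of a local addition, in
charts: `Γ` is the Christoffel symbol in the chart `φ`, and the argument `(a, ζ, u, v)` consists of
the coordinates of a base point, of a vector, and of two vectors tangent to the fibre. -/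
noncomputable def pullbackRep (m : M) (φ : OpenPartialHomeomorph M E) (Γ : E → E →L[ℝ] E →L[ℝ] E)
    (s : E × E × E × E) : E :=
  fderiv ℝ (α.logRep m φ) (s.1, α.expRep m φ (s.1, s.2.1))
    (0, fderiv ℝ (fderiv ℝ (α.expRep m φ)) (s.1, s.2.1) (0, s.2.2.1) (0, s.2.2.2) +
      Γ (α.expRep m φ (s.1, s.2.1)) (fderiv ℝ (α.expRep m φ) (s.1, s.2.1) (0, s.2.2.1))
        (fderiv ℝ (α.expRep m φ) (s.1, s.2.1) (0, s.2.2.2)))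

theorem contDiffOn_pullbackRep {m : M} {φ : OpenPartialHomeomorph M E} (hφ : φ ∈ atlas E M)
    {Γ : E → E →L[ℝ] E →L[ℝ] E} (hΓ : ContDiffOn ℝ ∞ Γ φ.target) :
    ContDiffOn ℝ ∞ (α.pullbackRep m φ Γ) {s | (s.1, s.2.1) ∈ α.expDomain m φ} := by
  have hW := α.contDiffOn_expRep (m := m) hφ
  have hW1 := hW.fderiv_of_isOpen (m := ∞) α.isOpen_expDomain (by simp)
  have hW2 := hW1.fderiv_of_isOpen (m := ∞) α.isOpen_expDomain (by simp)
  have hL1 := (α.contDiffOn_logRep (m := m) hφ).fderiv_of_isOpen (m := ∞) α.isOpen_logDomain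
    (by simp)
  set S : Set (E × E × E × E) := {s | (s.1, s.2.1) ∈ α.expDomain m φ}
  have hπ : ContDiffOn ℝ ∞ (fun s : E × E × E × E => (s.1, s.2.1)) S := by fun_prop
  have hu : ContDiffOn ℝ ∞ (fun s : E × E × E × E => ((0 : E), s.2.2.1)) S := by fun_prop
  have hv : ContDiffOn ℝ ∞ (fun s : E × E × E × E => ((0 : E), s.2.2.2)) S := by fun_prop
  have hWs := hW.comp hπ fun s hs => hs
  have hWu := (hW1.comp hπ fun s hs => hs).clm_apply hu
  have hWv := (hW1.comp hπ fun s hs => hs).clm_apply hv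
  have hWuv := ((hW2.comp hπ fun s hs => hs).clm_apply hu).clm_apply hv
  have hΓs := ((hΓ.comp hWs fun s hs => hs.2.2 |> φ.map_source).clm_apply hWu).clm_apply hWv
  have hLs := hL1.comp (contDiff_fst.contDiffOn.prodMk hWs)
    fun s hs => α.mk_expRep_mem_logDomain hs
  exact hLs.clm_apply (contDiffOn_const.prodMk (hWuv.add hΓs))

end LocalAddition

section NaturalConnection

variable {ED : Type*} [NormedAddCommGroup ED] [NormedSpace ℝ ED] {HD : Type*} [TopologicalSpace HD]
  {I : ModelWithCorners ℝ ED HD} {D : Type*} [TopologicalSpace D] [ChartedSpace HD D]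
  [IsManifold I ∞ D] [CompactSpace D] [T2Space D] {k : ℕ}
  {E : Type*} [NormedAddCommGroup E] [NormedSpace ℝ E] [FiniteDimensional ℝ E]
  {M : Type*} [TopologicalSpace M] [ChartedSpace E M] [IsManifold 𝓘(ℝ, E) ∞ M]

namespace MapChartIndex

variable (i : MapChartIndex I D E M k)

/-- The evaluation at `q`, in a chart of `C^k(D, M)` and a chart of `M`. -/
noncomputable def evalRep (φ : OpenPartialHomeomorph M E) (q : D) (z : CkField i.center) : E :=
  φ (i.chart.symm z q)

variable {i} {φ : OpenPartialHomeomorph M E} {z : CkField i.center} {r q : D}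

/-- The first two derivatives of the evaluation, in charts: it is a linear map followed by the local
addition. -/
theorem fderiv_evalRep (hφ : φ ∈ atlas E M) (hz : z ∈ i.chart.target)
    (hq : i.center q ∈ (chartAt E (i.center r)).source) (hzφ : i.chart.symm z q ∈ φ.source) :
    (∀ u, fderiv ℝ (i.evalRep φ q) z u = fderiv ℝ (i.add.expRep (i.center r) φ)
      (chartAt E (i.center r) (i.center q), evTriv i.center r q z) (0, evTriv i.center r q u)) ∧
    ∀ u v, fderiv ℝ (fderiv ℝ (i.evalRep φ q)) z u v =
      fderiv ℝ (fderiv ℝ (i.add.expRep (i.center r) φ))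
        (chartAt E (i.center r) (i.center q), evTriv i.center r q z)
        (0, evTriv i.center r q u) (0, evTriv i.center r q v) := by
  let J : CkField i.center →L[ℝ] E × E :=
    (ContinuousLinearMap.inr ℝ E E).comp (evTriv i.center r q)
  have hJ : ∀ v, ((chartAt E (i.center r) (i.center q), (0 : E)) : E × E) + J v =
      (chartAt E (i.center r) (i.center q), evTriv i.center r q v) := fun v => by simp [J]
  have h := fderiv_fderiv_comp_affine (g := i.evalRep φ q) (x := z) i.add.isOpen_expDomain
    (i.add.contDiffOn_expRep (m := i.center r) hφ) (chartAt E (i.center r) (i.center q), 0) J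
    (by rw [hJ]; exact i.mk_mem_expDomain hz hq hzφ) (by
      filter_upwards [i.isOpen_chart_target.mem_nhds hz] with v hv
      rw [hJ]
      exact i.chart_symm_rep hv hq φ)
  rw [hJ] at h
  exact h

variable (i) in
/-- The covariant derivative along the evaluation at `q`, in charts: `Γ` is the Christoffel symbol
of the connection of `M` in the chart `φ`. -/
noncomputable def covRep (φ : OpenPartialHomeomorph M E) (Γ : E → E →L[ℝ] E →L[ℝ] E) (q : D)
    (Z : CkField i.center × CkField i.center × CkField i.center) : E :=
  fderiv ℝ (fderiv ℝ (i.evalRep φ q)) Z.1 Z.2.1 Z.2.2 + Γ (i.evalRep φ q Z.1)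
    (fderiv ℝ (i.evalRep φ q) Z.1 Z.2.1) (fderiv ℝ (i.evalRep φ q) Z.1 Z.2.2)

variable {P : (ofManifold E M).tangent.TBundle → (ofManifold E M).TBundle}

/-- The covariant derivative along the evaluation is a tangent vector of `M`, i.e. its
representations in two charts are related by the derivative of the transition map. -/
theorem fderiv_trans_covRep (h : (mapAtlas I D E M k).IsSmoothAtlas) {φ φ' : atlas E M}
    {Γ Γ' : E → E →L[ℝ] E →L[ℝ] E} (hP : (ofManifold E M).IsConnection P)
    (hΓ : (ofManifold E M).IsChristoffel P φ Γ) (hΓ' : (ofManifold E M).IsChristoffel P φ' Γ')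
    {Z : CkField i.center × CkField i.center × CkField i.center} (hz : Z.1 ∈ i.chart.target)
    (hφ : i.chart.symm Z.1 q ∈ φ.1.source) (hφ' : i.chart.symm Z.1 q ∈ φ'.1.source) :
    fderiv ℝ (φ'.1 ∘ φ.1.symm) (i.evalRep φ.1 q Z.1) (i.covRep φ.1 Γ q Z) =
      i.covRep φ'.1 Γ' q Z := by
  obtain ⟨z, u, v⟩ := Z
  let A := mapManifold h
  have hx : i.chart.symm z ∈ (A.chart i).source := i.chart.map_target hz
  -- the covariant derivative is the value of `P` at the image of a vector with second component zero
  let e : A.TBundle := ⟨i.chart.symm z, A.ofCoord i _ v⟩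
  let η : A.tangent.Tangent e := A.ofDcoord i e ((u, 0) : CkField i.center × CkField i.center)
  have hη : dcoord (A := A) i η = ((u, 0) : CkField i.center × CkField i.center) :=
    dcoord_ofDcoord (A := A) (e := e) hx ((u, 0) : CkField i.center × CkField i.center)
  have he : coord (A := A) i e.2 = v := A.coord_ofCoord_self hx v
  have hzz : A.chart i e.1 = z := i.chart.right_inv hz
  let t := P (tmap A.tangent (ofManifold E M).tangent
    (tmap A (ofManifold E M) (fun y => y q)) ⟨e, η⟩)
  have ht : t.1 = i.chart.symm z q := hP.fst _
  have key : ∀ (φ : atlas E M) (Γ : E → E →L[ℝ] E →L[ℝ] E),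
      (ofManifold E M).IsChristoffel P φ Γ → i.chart.symm z q ∈ φ.1.source →
      coord (A := ofManifold E M) φ t.2 = i.covRep φ.1 Γ q (z, u, v) := by
    intro φ Γ hΓ hφ
    have h1 := coord_connection_tmap_tmap (A := A) (B := ofManifold E M) (i := i) (j := φ)
      (isSmooth_eval h q) hΓ η hx hφ
    rw [hη, he, hzz] at h1
    refine h1.trans ?_
    have h3 : fderiv ℝ (i.evalRep φ.1 q) z 0 = 0 := map_zero _
    change fderiv ℝ (fderiv ℝ (i.evalRep φ.1 q)) z u v + fderiv ℝ (i.evalRep φ.1 q) z 0 +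
      Γ (i.evalRep φ.1 q z) (fderiv ℝ (i.evalRep φ.1 q) z u) (fderiv ℝ (i.evalRep φ.1 q) z v) = _
    rw [h3, add_zero]
    rfl
  have h2 := (ofManifold E M).fderiv_trans_coord (x := t.1) (i := φ) (j := φ')
    (by rw [ht]; exact hφ) (by rw [ht]; exact hφ') t.2
  rw [key φ' Γ' hΓ' hφ', key φ Γ hΓ hφ, ht] at h2
  exact h2

variable (i) in
/-- The Christoffel symbol of the natural connection, in the chart `i` and at the arguments
`(z, u, v)`, as a vector field along the centre of the chart: it is obtained pointwise from the
covariant derivative along the evaluation, by the inverse of the local addition. -/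
noncomputable def christoffelField (Γ : atlas E M → E → E →L[ℝ] E →L[ℝ] E)
    (Z : CkField i.center × CkField i.center × CkField i.center) (q : D) :
    TangentSpace 𝓘(ℝ, E) (i.center q) :=
  fderiv ℝ (i.add.logRep (i.center q) (chartAt E (i.chart.symm Z.1 q)))
    (chartAt E (i.center q) (i.center q), i.evalRep (chartAt E (i.chart.symm Z.1 q)) q Z.1)
    (0, i.covRep (chartAt E (i.chart.symm Z.1 q)) (Γ ⟨_, chart_mem_atlas E (i.chart.symm Z.1 q)⟩) q Z)

variable {Γ : atlas E M → E → E →L[ℝ] E →L[ℝ] E}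

/-- In all charts, the field `christoffelField` is given by `LocalAddition.pullbackRep`. -/
theorem fieldTriv_christoffelField (h : (mapAtlas I D E M k).IsSmoothAtlas)
    (hP : (ofManifold E M).IsConnection P) (hΓ : ∀ φ, (ofManifold E M).IsChristoffel P φ (Γ φ))
    {Z : CkField i.center × CkField i.center × CkField i.center} (hz : Z.1 ∈ i.chart.target)
    (hq : i.center q ∈ (chartAt E (i.center r)).source) {φ : atlas E M}
    (hφ : i.chart.symm Z.1 q ∈ φ.1.source) :
    fieldTriv i.center r (i.christoffelField Γ Z) q =
      i.add.pullbackRep (i.center r) φ.1 (Γ φ) (chartAt E (i.center r) (i.center q),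
        evTriv i.center r q Z.1, evTriv i.center r q Z.2.1, evTriv i.center r q Z.2.2) := by
  have hmem : (i.center q, i.chart.symm Z.1 q) ∈ i.add.target := i.chart.map_target hz q
  rw [fieldTriv_apply, christoffelField]
  refine (i.add.fderiv_logRep_change (chart_mem_atlas E _) φ.2 hmem (_root_.mem_chart_source E _) hq
    (_root_.mem_chart_source E (i.chart.symm Z.1 q)) hφ _).trans ?_
  have h1 := fderiv_trans_covRep (φ := ⟨_, chart_mem_atlas E (i.chart.symm Z.1 q)⟩) (φ' := φ) h hP
    (hΓ _) (hΓ φ) hz (_root_.mem_chart_source E _) hφ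
  have h2 : i.evalRep φ.1 q Z.1 = _ := i.chart_symm_rep hz hq φ.1
  obtain ⟨h3, h4⟩ := fderiv_evalRep φ.2 hz hq hφ
  rw [LocalAddition.pullbackRep]
  simp only
  rw [← h2]
  refine congrArg (fun n => fderiv ℝ (i.add.logRep (i.center r) φ.1)
    (chartAt E (i.center r) (i.center q), i.evalRep φ.1 q Z.1) (0, n)) ?_
  refine h1.trans ?_
  rw [covRep, h3, h3, h4]

/-- The fields `christoffelField` have locally the form of a pushforward. This is the condition
`HasPushforwardForm`, for a family of fields that are not yet known to be of class `C^k`. -/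
theorem exists_christoffelField_form (h : (mapAtlas I D E M k).IsSmoothAtlas)
    (hP : (ofManifold E M).IsConnection P) (hΓ : ∀ φ, (ofManifold E M).IsChristoffel P φ (Γ φ))
    {Z₀ : CkField i.center × CkField i.center × CkField i.center} (hz : Z₀.1 ∈ i.chart.target)
    (hr : q ∈ (chartAt HD r).source) (hq : i.center q ∈ (chartAt E (i.center r)).source) :
    ∃ (ξ : D → E × E × E × E) (w : D → CkField i.center × CkField i.center × CkField i.center →L[ℝ]
      E × E × E × E) (f : E × E × E × E → E) (Ω : Set (E × E × E × E)), IsOpen Ω ∧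
      ContDiffOn ℝ ∞ f Ω ∧ (∀ᶠ q' in 𝓝 q, ContMDiffAt I 𝓘(ℝ, E × E × E × E) k ξ q') ∧
      CkBounded I k r q w ∧
      ∀ᶠ s : (CkField i.center × CkField i.center × CkField i.center) × D in 𝓝 (Z₀, q),
        ξ s.2 + w s.2 s.1 ∈ Ω ∧
        fieldTriv i.center r (i.christoffelField Γ s.1) s.2 = f (ξ s.2 + w s.2 s.1) := by
  let φ : atlas E M := ⟨_, chart_mem_atlas E (i.chart.symm Z₀.1 q)⟩
  have hev := ckBounded_evTriv hr hq
  let X := CkField i.center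
  let p₁ : X × X × X →L[ℝ] X := ContinuousLinearMap.fst ℝ X (X × X)
  let p₂ : X × X × X →L[ℝ] X :=
    (ContinuousLinearMap.fst ℝ X X).comp (ContinuousLinearMap.snd ℝ X (X × X))
  let p₃ : X × X × X →L[ℝ] X :=
    (ContinuousLinearMap.snd ℝ X X).comp (ContinuousLinearMap.snd ℝ X (X × X))
  let w : D → X × X × X →L[ℝ] E × E × E × E := fun q =>
    (ContinuousLinearMap.inr ℝ E (E × E × E)).comp (((evTriv i.center r q).comp p₁).prod
      (((evTriv i.center r q).comp p₂).prod ((evTriv i.center r q).comp p₃)))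
  have hw : CkBounded I k r q w :=
    ((hev.comp_clm p₁).prod ((hev.comp_clm p₂).prod (hev.comp_clm p₃))).clm_comp
      (a := fun _ => ContinuousLinearMap.inr ℝ E (E × E × E))
      (Filter.Eventually.of_forall fun _ => contMDiffAt_const)
  refine ⟨fun q' => (chartAt E (i.center r) (i.center q'), 0), w,
    i.add.pullbackRep (i.center r) φ.1 (Γ φ),
    {s | (s.1, s.2.1) ∈ i.add.expDomain (i.center r) φ.1},
    i.add.isOpen_expDomain.preimage (by fun_prop),
    i.add.contDiffOn_pullbackRep φ.2 (hΓ φ).smooth, ?_, hw, ?_⟩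
  · filter_upwards [eventually_mem_chartAt_source hq] with q' hq'
    exact (contMDiffAt_chartAt_comp hq').prodMk_space contMDiffAt_const
  · have hfst : ContinuousAt (fun s : (X × X × X) × D => s.1.1) (Z₀, q) := by fun_prop
    have hend : ContinuousAt (fun s : (X × X × X) × D => i.chart.symm s.1.1 s.2) (Z₀, q) :=
      ContinuousAt.comp (g := fun s : X × D => i.chart.symm s.1 s.2)
        (f := fun s : (X × X × X) × D => (s.1.1, s.2)) (i.continuousAt_chart_symm hz q)
        (by fun_prop)
    filter_upwards [hfst.eventually (i.isOpen_chart_target.mem_nhds hz),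
      (continuous_snd.continuousAt (x := (Z₀, q))).eventually (eventually_mem_chartAt_source hq),
      hend.eventually (φ.1.open_source.mem_nhds (_root_.mem_chart_source E _))] with s hs hsq hsφ
    have hsum : ((chartAt E (i.center r) (i.center s.2), 0) : E × E × E × E) + w s.2 s.1 =
        (chartAt E (i.center r) (i.center s.2), evTriv i.center r s.2 s.1.1,
          evTriv i.center r s.2 s.1.2.1, evTriv i.center r s.2 s.1.2.2) := by
      simp [w, p₁, p₂, p₃]
    rw [hsum]
    exact ⟨i.mk_mem_expDomain hs hsq hsφ, fieldTriv_christoffelField h hP hΓ hs hsq hsφ⟩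

/-- The fields `christoffelField` are of class `C^k`, although the charts of `M` in their definition
depend on the point: near each point they agree with a pushforward in fixed charts. -/
theorem contMDiff_christoffelField (h : (mapAtlas I D E M k).IsSmoothAtlas)
    (hP : (ofManifold E M).IsConnection P) (hΓ : ∀ φ, (ofManifold E M).IsChristoffel P φ (Γ φ))
    {Z : CkField i.center × CkField i.center × CkField i.center} (hz : Z.1 ∈ i.chart.target) :
    ContMDiff I 𝓘(ℝ, E).tangent k (fieldMap i.center (i.christoffelField Γ Z)) := by
  intro q
  have hq := _root_.mem_chart_source E (i.center q)
  rw [contMDiffAt_fieldMap_iff i.center hq]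
  obtain ⟨ξ, w, f, Ω, hΩ, hf, hξ, hw, hT⟩ :=
    exists_christoffelField_form h hP hΓ hz (_root_.mem_chart_source HD q) hq
  have h1 : ContMDiffAt I 𝓘(ℝ, E × E × E × E) k (fun q => ξ q + w q Z) q :=
    hξ.self_of_nhds.add (hw.smooth.self_of_nhds Z)
  have h2 : ContMDiffAt 𝓘(ℝ, E × E × E × E) 𝓘(ℝ, E) k f (ξ q + w q Z) :=
    ((hf.contDiffAt (hΩ.mem_nhds hT.self_of_nhds.1)).of_le (by exact_mod_cast le_top)).contMDiffAt
  refine (ContMDiffAt.comp (g := f) (f := fun q => ξ q + w q Z) q h2 h1).congr_of_eventuallyEq ?_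
  have h3 : Filter.Tendsto (fun q' => (Z, q')) (𝓝 q) (𝓝 (Z, q)) := by
    have : Continuous fun q' : D => (Z, q') := by fun_prop
    exact this.tendsto q
  filter_upwards [h3.eventually hT] with q' hq'
  exact hq'.2

variable (i) in
/-- The Christoffel symbols of the natural connection: in every chart of `C^k(D, M)` there is a
smooth family of bilinear maps, related by all evaluations to the Christoffel symbols of `M`. -/
theorem exists_christoffel (h : (mapAtlas I D E M k).IsSmoothAtlas)
    (hP : (ofManifold E M).IsConnection P) :
    ∃ G : CkField i.center → CkField i.center →L[ℝ] CkField i.center →L[ℝ] CkField i.center,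
      ContDiffOn ℝ ∞ G i.chart.target ∧
      ∀ z ∈ i.chart.target, ∀ (φ : atlas E M) (q : D), i.chart.symm z q ∈ φ.1.source →
        ∃ Γ, (ofManifold E M).IsChristoffel P φ Γ ∧ ∀ u v,
          fderiv ℝ (i.evalRep φ.1 q) z (G z u v) = i.covRep φ.1 Γ q (z, u, v) := by
  classical
  have : CompleteSpace E := FiniteDimensional.complete ℝ E
  obtain ⟨Γ, hΓ⟩ : ∃ Γ : atlas E M → E → E →L[ℝ] E →L[ℝ] E,
      ∀ φ, (ofManifold E M).IsChristoffel P φ (Γ φ) :=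
    ⟨fun φ => (hP.christoffel φ).choose, fun φ => (hP.christoffel φ).choose_spec⟩
  let X := CkField i.center
  -- the value outside of the target of the chart is irrelevant
  let Ψ : X × X × X → X := fun Z =>
    if hZ : ContMDiff I 𝓘(ℝ, E).tangent k (fieldMap i.center (i.christoffelField Γ Z)) then
      CkField.mk _ hZ else 0
  have hΨ : ∀ Z : X × X × X, Z.1 ∈ i.chart.target → (Ψ Z).val = i.christoffelField Γ Z := by
    intro Z hZ
    have h1 : Ψ Z = CkField.mk _ (contMDiff_christoffelField h hP hΓ hZ) :=
      dif_pos (contMDiff_christoffelField h hP hΓ hZ)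
    rw [h1]
    rfl
  have hval : ∀ (Z : X × X × X) (r q : D) (φ : atlas E M), Z.1 ∈ i.chart.target →
      i.center q ∈ (chartAt E (i.center r)).source → i.chart.symm Z.1 q ∈ φ.1.source →
      fieldTriv i.center r (Ψ Z).val q = i.add.pullbackRep (i.center r) φ.1 (Γ φ)
        (chartAt E (i.center r) (i.center q), evTriv i.center r q Z.1, evTriv i.center r q Z.2.1,
          evTriv i.center r q Z.2.2) := by
    intro Z r q φ hZ hq hφ
    rw [hΨ Z hZ]
    exact fieldTriv_christoffelField h hP hΓ hZ hq hφ
  have hop : IsOpen (i.chart.target ×ˢ (Set.univ : Set (X × X))) :=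
    i.isOpen_chart_target.prod isOpen_univ
  have hsm : ContDiffOn ℝ ∞ Ψ (i.chart.target ×ˢ Set.univ) := by
    refine contDiffOn_of_hasPushforwardForm (F := E × E × E × E) hop fun Z₀ hZ₀ r q hr hq => ?_
    obtain ⟨ξ, w, f, Ω, hΩ, hf, hξ, hw, hT⟩ :=
      exists_christoffelField_form h hP hΓ hZ₀.1 hr hq
    refine ⟨ξ, w, f, Ω, hΩ, hf, hξ, hw, ?_⟩
    filter_upwards [hT, (continuous_fst.continuousAt (x := (Z₀, q))).eventually (hop.mem_nhds hZ₀)]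
      with s hs hs'
    rw [hΨ s.1 hs'.1]
    exact hs
  -- homogeneity of `Ψ` follows from that of `pullbackRep`, in suitable charts at each point
  have hhom : ∀ (Z Z' : X × X × X) (c : ℝ), Z.1 ∈ i.chart.target → Z'.1 = Z.1 →
      (∀ q, i.add.pullbackRep (i.center q) (chartAt E (i.chart.symm Z.1 q))
        (Γ ⟨_, chart_mem_atlas E (i.chart.symm Z.1 q)⟩) (chartAt E (i.center q) (i.center q),
          evTriv i.center q q Z'.1, evTriv i.center q q Z'.2.1, evTriv i.center q q Z'.2.2) =
        c • i.add.pullbackRep (i.center q) (chartAt E (i.chart.symm Z.1 q))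
        (Γ ⟨_, chart_mem_atlas E (i.chart.symm Z.1 q)⟩) (chartAt E (i.center q) (i.center q),
          evTriv i.center q q Z.1, evTriv i.center q q Z.2.1, evTriv i.center q q Z.2.2)) →
      Ψ Z' = c • Ψ Z := by
    intro Z Z' c hZ hZ' hc
    refine CkField.ext fun q => ?_
    have hq := _root_.mem_chart_source E (i.center q)
    have hφ := _root_.mem_chart_source E (i.chart.symm Z.1 q)
    have h1 := hval Z q q ⟨_, chart_mem_atlas E (i.chart.symm Z.1 q)⟩ hZ hq hφ
    have h2 := hval Z' q q ⟨_, chart_mem_atlas E (i.chart.symm Z.1 q)⟩ (by rw [hZ']; exact hZ) hq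
      (by rw [hZ']; exact hφ)
    rw [fieldTriv_self] at h1 h2
    have h3 : (c • Ψ Z).val q = c • (Ψ Z).val q := rfl
    rw [h3, h1, h2]
    exact hc q
  obtain ⟨G, hG, hGΨ⟩ := exists_contDiffOn_bilinear i.isOpen_chart_target hsm
    (fun z hz c u v => hhom (z, u, v) (z, c • u, v) c hz rfl fun q => by
      have h0 : ∀ y : E, ((0 : E), c • y) = c • ((0 : E), y) := fun y => by simp
      simp only [LocalAddition.pullbackRep, map_smul, h0, _root_.smul_apply, ← smul_add])
    (fun z hz c u v => hhom (z, u, v) (z, u, c • v) c hz rfl fun q => by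
      have h0 : ∀ y : E, ((0 : E), c • y) = c • ((0 : E), y) := fun y => by simp
      simp only [LocalAddition.pullbackRep, map_smul, h0, ← smul_add])
  refine ⟨G, hG, fun z hz φ q hφ => ⟨Γ φ, hΓ φ, fun u v => ?_⟩⟩
  have hq := _root_.mem_chart_source E (i.center q)
  obtain ⟨h1, h2⟩ := fderiv_evalRep (r := q) φ.2 hz hq hφ
  rw [hGΨ z hz u v, covRep, h1, h1, h1, h2, evTriv_apply q q (Ψ (z, u, v)),
    hval (z, u, v) q q φ hz hq hφ, LocalAddition.pullbackRep]
  have h3 := i.add.fderiv_expRep_logRep φ.2 (i.mk_mem_expDomain hz hq hφ)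
  have h4 : i.evalRep φ.1 q z = _ := i.chart_symm_rep hz hq φ.1
  simp only at h3 ⊢
  rw [h3, h4]

end MapChartIndex

end NaturalConnection

/-! ### The natural connection and affine maps -/

section NaturalConnection

variable {ED : Type*} [NormedAddCommGroup ED] [NormedSpace ℝ ED] {HD : Type*} [TopologicalSpace HD]
  {I : ModelWithCorners ℝ ED HD} {D : Type*} [TopologicalSpace D] [ChartedSpace HD D]
  [IsManifold I ∞ D] [CompactSpace D] [T2Space D] {k : ℕ}
  {E : Type*} [NormedAddCommGroup E] [NormedSpace ℝ E] [FiniteDimensional ℝ E]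
  {M : Type*} [TopologicalSpace M] [ChartedSpace E M] [IsManifold 𝓘(ℝ, E) ∞ M]

/-- A tangent vector of `C^k(D, M)` is determined by its images under the evaluations: in charts, these
images are its values as a field, up to the injective fibre derivatives of the local addition. -/
theorem tmap_eval_injective (h : (mapAtlas I D E M k).IsSmoothAtlas) {t t' : (mapManifold h).TBundle}
    (ht : ∀ p, tmap (mapManifold h) (ofManifold E M) (fun x => x p) t =
      tmap (mapManifold h) (ofManifold E M) (fun x => x p) t') : t = t' := by
  obtain ⟨x, v⟩ := t
  obtain ⟨x', v'⟩ := t'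
  obtain rfl : x = x' := ContMDiffMap.ext fun p => congrArg Sigma.fst (ht p)
  refine congrArg (Sigma.mk x) ?_
  let i : MapChartIndex I D E M k := (mapManifold h).chartIdx x
  have hi : x ∈ i.chart.source := mem_chartIdx (A := mapManifold h) x
  refine coord_injective (A := mapManifold h) (i := i) hi (CkField.ext fun q => ?_)
  let φ : atlas E M := ⟨_, chart_mem_atlas E (x q)⟩
  have hφ : x q ∈ φ.1.source := _root_.mem_chart_source E (x q)
  have hq := _root_.mem_chart_source E (i.center q)
  have hz := i.chart.map_source hi
  have hx : i.chart.symm (i.chart x) = x := i.chart.left_inv hi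
  have hzφ : i.chart.symm (i.chart x) q ∈ φ.1.source := by rw [hx]; exact hφ
  have hd : ∀ w : (mapManifold h).Tangent x,
      coord φ (tmap (mapManifold h) (ofManifold E M) (fun x => x q) ⟨x, w⟩).2 =
        fderiv ℝ (i.add.expRep (i.center q) φ.1) (chartAt E (i.center q) (i.center q),
          evTriv i.center q q (i.chart x)) (0, evTriv i.center q q (coord (A := mapManifold h) i w)) := fun w =>
    ((isSmooth_eval h q).coord_dmap (i := i) (j := φ) hi hφ w).trans
      ((MapChartIndex.fderiv_evalRep φ.2 hz hq hzφ).1 _)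
  have hvec : dmap (mapManifold h) (ofManifold E M) (fun x => x q) x v =
      dmap (mapManifold h) (ofManifold E M) (fun x => x q) x v' :=
    eq_of_heq (Sigma.mk.inj (ht q)).2
  have h2 := (hd v).symm.trans ((congrArg (coord φ) hvec).trans (hd v'))
  have hinv := fun w => i.add.fderiv_logRep_expRep φ.2 (i.mk_mem_expDomain hz hq hzφ) w
  have h3 := (hinv _).symm.trans ((congrArg (fun y => fderiv ℝ (i.add.logRep (i.center q) φ.1) _
    ((0 : E), y)) h2).trans (hinv _))
  have hself : ∀ u : CkField i.center, evTriv i.center q q u = u.val q := fun u =>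
    fieldTriv_self _ _ _
  exact (hself _).symm.trans (h3.trans (hself _))

/-- In every chart, the values at `η` of the connection of `M`, transported by the evaluations, are
the images of one tangent vector of `C^k(D, M)`. -/
theorem exists_tmap_eval_eq (h : (mapAtlas I D E M k).IsSmoothAtlas)
    {P : (ofManifold E M).tangent.TBundle → (ofManifold E M).TBundle}
    (hP : (ofManifold E M).IsConnection P) (i : (mapManifold h).ι) :
    ∃ G : (mapManifold h).model i → (mapManifold h).model i →L[ℝ] (mapManifold h).model i →L[ℝ]
        (mapManifold h).model i, ContDiffOn ℝ ∞ G ((mapManifold h).chart i).target ∧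
      ∀ (e : (mapManifold h).TBundle) (η : (mapManifold h).tangent.Tangent e),
        e.1 ∈ ((mapManifold h).chart i).source → ∃ t : (mapManifold h).TBundle, t.1 = e.1 ∧
          coord i t.2 = (dcoord i η).2 +
            G ((mapManifold h).chart i e.1) (dcoord i η).1 (coord i e.2) ∧
          ∀ p, tmap (mapManifold h) (ofManifold E M) (fun x => x p) t =
            P (tmap (mapManifold h).tangent (ofManifold E M).tangent
              (tmap (mapManifold h) (ofManifold E M) (fun x => x p)) ⟨e, η⟩) := by
  let i' : MapChartIndex I D E M k := i
  obtain ⟨G, hG, hGΓ⟩ := i'.exists_christoffel h hP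
  refine ⟨G, hG, fun e η hi => ?_⟩
  let a : CkField i'.center := (dcoord i η).1
  let b : CkField i'.center := (dcoord i η).2
  let v : CkField i'.center := coord i e.2
  let w : CkField i'.center := b + G (i'.chart e.1) a v
  have hw : coord i ((mapManifold h).ofCoord i e.1 w) = w :=
    (mapManifold h).coord_ofCoord_self hi w
  refine ⟨⟨e.1, (mapManifold h).ofCoord i e.1 w⟩, rfl, hw, fun p => ?_⟩
  let φ : atlas E M := ⟨_, chart_mem_atlas E (e.1 p)⟩
  have hφ : e.1 p ∈ φ.1.source := _root_.mem_chart_source E (e.1 p)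
  have hx : i'.chart.symm (i'.chart e.1) = e.1 := i'.chart.left_inv hi
  obtain ⟨Γ, hΓ, hd⟩ := hGΓ (i'.chart e.1) (i'.chart.map_source hi) φ p (by rw [hx]; exact hφ)
  refine TBundle.ext_coord (A := ofManifold E M) (i := φ) (Eq.symm (hP.fst _)) hφ ?_
  refine ((isSmooth_eval h p).coord_dmap (i := i) (j := φ) hi hφ _).trans ?_
  refine Eq.trans ?_ (coord_connection_tmap_tmap (A := mapManifold h) (B := ofManifold E M)
    (i := i) (j := φ) (isSmooth_eval h p) hΓ η hi hφ).symm
  have h1 : (ofManifold E M).chart φ (e.1 p) = i'.evalRep φ.1 p (i'.chart e.1) :=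
    congrArg (fun y : C^k⟮I, D; 𝓘(ℝ, E), M⟯ => φ.1 (y p)) hx.symm
  rw [hw, h1]
  have h2 : fderiv ℝ (i'.evalRep φ.1 p) (i'.chart e.1) w =
      fderiv ℝ (i'.evalRep φ.1 p) (i'.chart e.1) b +
        fderiv ℝ (i'.evalRep φ.1 p) (i'.chart e.1) (G (i'.chart e.1) a v) := map_add _ _ _
  refine h2.trans ?_
  rw [hd, add_comm]
  exact add_right_comm _ _ _

/-- The vectors of `exists_tmap_eval_eq` do not depend on the chart, since they are determined by their
images under the evaluations; hence they define a connection. -/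
theorem exists_isNaturalConnection (h : (mapAtlas I D E M k).IsSmoothAtlas)
    {P : (ofManifold E M).tangent.TBundle → (ofManifold E M).TBundle}
    (hP : (ofManifold E M).IsConnection P) : ∃ Q, IsNaturalConnection h P Q := by
  have hex : ∀ η : (mapManifold h).tangent.TBundle, ∃ t : (mapManifold h).TBundle, t.1 = η.1.1 ∧
      ∀ p, tmap (mapManifold h) (ofManifold E M) (fun x => x p) t =
        P (tmap (mapManifold h).tangent (ofManifold E M).tangent
          (tmap (mapManifold h) (ofManifold E M) (fun x => x p)) η) := fun η => by
    obtain ⟨G, -, hG⟩ := exists_tmap_eval_eq h hP ((mapManifold h).chartIdx η.1.1)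
    obtain ⟨t, h1, -, h2⟩ := hG η.1 η.2 (mem_chartIdx (A := mapManifold h) η.1.1)
    exact ⟨t, h1, h2⟩
  choose Q hQ1 hQ2 using hex
  refine ⟨Q, isConnection_of_christoffel hQ1 fun i => ?_, fun p η => hQ2 η p⟩
  obtain ⟨G, hG, hGt⟩ := exists_tmap_eval_eq h hP i
  refine ⟨G, hG, fun e η hi => ?_⟩
  obtain ⟨t, -, h1, h2⟩ := hGt e η hi
  obtain rfl : Q ⟨e, η⟩ = t := tmap_eval_injective h fun p => (hQ2 _ p).trans (h2 p).symm
  exact h1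

theorem existsUnique_isNaturalConnection (h : (mapAtlas I D E M k).IsSmoothAtlas)
    {P : (ofManifold E M).tangent.TBundle → (ofManifold E M).TBundle}
    (hP : (ofManifold E M).IsConnection P) : ∃! Q, IsNaturalConnection h P Q := by
  obtain ⟨Q, hQ⟩ := exists_isNaturalConnection h hP
  exact ⟨Q, hQ, fun Q' hQ' => funext fun η => tmap_eval_injective h fun p =>
    (hQ'.2 p η).trans (hQ.2 p η).symm⟩

variable {E' : Type*} [NormedAddCommGroup E'] [NormedSpace ℝ E'] [FiniteDimensional ℝ E']
  {M' : Type*} [TopologicalSpace M'] [ChartedSpace E' M'] [IsManifold 𝓘(ℝ, E') ∞ M']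

/-- Evaluations commute with left-composition and intertwine natural connections with the connections
of `M` and `M'`, so that the identity to be proved becomes, under each evaluation, the one for `f`. -/
theorem isAffine_leftComp (h : (mapAtlas I D E M k).IsSmoothAtlas)
    (h' : (mapAtlas I D E' M' k).IsSmoothAtlas) {P P' Q Q'} (hQ : IsNaturalConnection h P Q)
    (hQ' : IsNaturalConnection h' P' Q') {f : C^∞⟮𝓘(ℝ, E), M; 𝓘(ℝ, E'), M'⟯}
    (hf : IsAffine (ofManifold E M) (ofManifold E' M') P P' f) :
    IsAffine (mapManifold h) (mapManifold h') Q Q' (leftComp I D k f) := by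
  have : CompleteSpace E' := FiniteDimensional.complete ℝ E'
  have hs := isSmooth_leftComp h h' f
  refine ⟨hs, fun η => tmap_eval_injective h' fun p => ?_⟩
  have hev := isSmooth_eval h p
  have hev' := isSmooth_eval h' p
  -- evaluation intertwines the left-composition with `f`, on all tangent bundles
  have hT : tmap (mapManifold h') (ofManifold E' M') (fun x => x p) ∘
      tmap (mapManifold h) (mapManifold h') (leftComp I D k f) =
      tmap (ofManifold E M) (ofManifold E' M') f ∘
        tmap (mapManifold h) (ofManifold E M) (fun x => x p) :=
    funext fun e => (tmap_comp hs hev' e).symm.trans (tmap_comp hev hf.1 e)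
  have h1 := (tmap_comp hs.tmap hev'.tmap η).symm.trans
    ((congrArg (fun F => tmap (mapManifold h).tangent (ofManifold E' M').tangent F η) hT).trans
      (tmap_comp hev.tmap hf.1.tmap η))
  calc _ = _ := hQ'.2 p _
    _ = _ := congrArg P' h1
    _ = _ := hf.2 _
    _ = _ := congrArg (tmap (ofManifold E M) (ofManifold E' M') f) (hQ.2 p η).symm
    _ = _ := (congrFun hT (Q η)).symm

end NaturalConnection

section Isometry

variable {E : Type*} [NormedAddCommGroup E] [NormedSpace ℝ E] [FiniteDimensional ℝ E]
  {M : Type*} [TopologicalSpace M] [ChartedSpace E M] [IsManifold 𝓘(ℝ, E) ∞ M]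
  {E' : Type*} [NormedAddCommGroup E'] [NormedSpace ℝ E'] [FiniteDimensional ℝ E']
  {M' : Type*} [TopologicalSpace M'] [ChartedSpace E' M'] [IsManifold 𝓘(ℝ, E') ∞ M']

theorem isSmooth_ofManifold {f : M → M'} (hf : ContMDiff 𝓘(ℝ, E) 𝓘(ℝ, E') ∞ f) :
    IsSmooth (ofManifold E M) (ofManifold E' M') f := by
  intro (φ : atlas E M) (ψ : atlas E' M')
  refine ⟨φ.1.symm.isOpen_inter_preimage (ψ.1.open_source.preimage hf.continuous), ?_⟩
  have h1 : ContMDiffOn 𝓘(ℝ, E) 𝓘(ℝ, E') ∞ (ψ.1 ∘ f ∘ φ.1.symm)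
      (φ.1.target ∩ φ.1.symm ⁻¹' (f ⁻¹' ψ.1.source)) :=
    (contMDiffOn_of_mem_maximalAtlas (IsManifold.subset_maximalAtlas ψ.2)).comp
      (hf.comp_contMDiffOn ((contMDiffOn_symm_of_mem_maximalAtlas
        (IsManifold.subset_maximalAtlas φ.2)).mono Set.inter_subset_left)) fun z hz => hz.2
  exact h1.contDiffOn

/-- The differential of an isometry is invertible, hence an isometry is a metric preserving submersion. -/
theorem isAffine_isometry {g : (ofManifold E M).SemiRiemannianMetric}
    {g' : (ofManifold E' M').SemiRiemannianMetric} {P P'} (hP : (ofManifold E M).IsLeviCivita g P)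
    (hP' : (ofManifold E' M').IsLeviCivita g' P') (φ : M ≃ₘ^∞⟮𝓘(ℝ, E), 𝓘(ℝ, E')⟯ M')
    (hg : PreservesMetric g g' φ) : IsAffine (ofManifold E M) (ofManifold E' M') P P' φ := by
  have : ∀ i, FiniteDimensional ℝ ((ofManifold E M).model i) := fun _ =>
    inferInstanceAs (FiniteDimensional ℝ E)
  have : ∀ i, FiniteDimensional ℝ ((ofManifold E' M').model i) := fun _ =>
    inferInstanceAs (FiniteDimensional ℝ E')
  have h1 := isSmooth_ofManifold φ.contMDiff
  have h2 := isSmooth_ofManifold φ.symm.contMDiff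
  refine isAffine_of_preservesMetric hP hP' h1 (fun x i j hi hj => ?_) hg
  have hx : φ.symm (φ x) = x := φ.symm_apply_apply x
  have h3 := h2.fderiv_rep_comp h1 (x := φ x) hj (j := i) (by rw [hx]; exact hi)
    (k := j) (by rw [hx]; exact hj)
  have h4 : φ ∘ φ.symm = id := funext φ.apply_symm_apply
  have h5 : fderiv ℝ (rep (ofManifold E' M') (ofManifold E' M') j j id)
      ((ofManifold E' M').chart j (φ x)) = ContinuousLinearMap.id ℝ _ :=
    (ofManifold E' M').fderiv_trans_self hj
  rw [h4, h5, hx] at h3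
  exact fun w => ⟨_, (congrArg (fun L => L w) h3).symm⟩

end Isometry

end BanachGeometry

theorem corollary2p7
    {ED : Type*} [NormedAddCommGroup ED] [NormedSpace ℝ ED] [FiniteDimensional ℝ ED]
    {HD : Type*} [TopologicalSpace HD] (I : ModelWithCorners ℝ ED HD)
    (D : Type*) [TopologicalSpace D] [ChartedSpace HD D] [IsManifold I ∞ D]
    [CompactSpace D] [T2Space D]
    (E : Type*) [NormedAddCommGroup E] [NormedSpace ℝ E] [FiniteDimensional ℝ E]
    (M : Type*) [TopologicalSpace M] [ChartedSpace E M] [IsManifold 𝓘(ℝ, E) ∞ M]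
    [T2Space M] [SecondCountableTopology M]
    (E' : Type*) [NormedAddCommGroup E'] [NormedSpace ℝ E'] [FiniteDimensional ℝ E']
    (M' : Type*) [TopologicalSpace M'] [ChartedSpace E' M'] [IsManifold 𝓘(ℝ, E') ∞ M']
    [T2Space M'] [SecondCountableTopology M']
    (k : ℕ) (hk : 2 ≤ k) :
    -- `C^k(D, M)` and `C^k(D, M')` are Banach manifolds
    ∃ (h : (mapAtlas I D E M k).IsSmoothAtlas) (h' : (mapAtlas I D E' M' k).IsSmoothAtlas),
      -- a connection on `M` or `M'` induces exactly one natural connection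
      (∀ P, (ofManifold E M).IsConnection P → ∃! Q, IsNaturalConnection h P Q) ∧
      (∀ P', (ofManifold E' M').IsConnection P' → ∃! Q', IsNaturalConnection h' P' Q') ∧
      -- left-composition with an affine map is affine
      (∀ P P' Q Q', (ofManifold E M).IsConnection P → (ofManifold E' M').IsConnection P' →
        IsNaturalConnection h P Q → IsNaturalConnection h' P' Q' →
        ∀ f : C^∞⟮𝓘(ℝ, E), M; 𝓘(ℝ, E'), M'⟯,
          IsAffine (ofManifold E M) (ofManifold E' M') P P' f →
          IsAffine (mapManifold h) (mapManifold h') Q Q' (leftComp I D k f)) ∧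
      -- left-composition with an isometry is affine for the connections induced by the
      -- Levi-Civita connections
      (∀ (g : (ofManifold E M).SemiRiemannianMetric) (g' : (ofManifold E' M').SemiRiemannianMetric)
        (P P' Q Q'), (ofManifold E M).IsLeviCivita g P → (ofManifold E' M').IsLeviCivita g' P' →
        IsNaturalConnection h P Q → IsNaturalConnection h' P' Q' →
        ∀ φ : M ≃ₘ^∞⟮𝓘(ℝ, E), 𝓘(ℝ, E')⟯ M', PreservesMetric g g' φ →
          IsAffine (mapManifold h) (mapManifold h') Q Q' (leftComp I D k φ.toContMDiffMap)) := by
  refine ⟨isSmoothAtlas_mapAtlas, isSmoothAtlas_mapAtlas,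
    fun P hP => existsUnique_isNaturalConnection _ hP,
    fun P' hP' => existsUnique_isNaturalConnection _ hP',
    fun P P' Q Q' _ _ hQ hQ' f hf => isAffine_leftComp _ _ hQ hQ' hf,
    fun g g' P P' Q Q' hP hP' hQ hQ' φ hg =>
      isAffine_leftComp _ _ hQ hQ' (isAffine_isometry hP hP' φ hg)⟩
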